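/- Let $F$ be a distribution function on $\mathbb R$, let $(X_i)_{i\in\mathbb Z}$ be independent random variables with distribution function $F$, and let $(c_i)_{i\in\mathbb Z}$ be real numbers. Write $\overline K=1-K$ for the tail of a distribution function $K$, $M_aF$ for the distribution function of $aX_0$, $G=\star_{i\in\mathbb Z}M_{c_i}F$ for the distribution function of $\sum_{i}c_iX_i$, and $G\natural M_{c_i}F$ for that of $\sum_{j\ne i}c_jX_j$. For real $a,b$ write $a\prec b$ if $\overline{M_aF}(t)=o(\overline{M_bF}(t))$ as $t\to\infty$, and $a\equiv b$ if there is $\epsilon>0$ with $\epsilon\,\overline{M_aF}\le\overline{M_bF}\le\epsilon^{-1}\,\overline{M_aF}$ ultimately (that is, on some neighborhood of $+\infty$). Let $c_{(1)}$ denote a largest weight: a weight such that every $c_i$ satisfies $c_i\prec c_{(1)}$ or $c_i\equiv c_{(1)}$. For a distribution function $K$ with $m$ finite moments, its Laplace character of order $m$ is the differential operator $$L_{K,m}=\sum_{k=0}^m\frac{(-1)^k}{k!}\Bigl(\int x^k\,dK(x)\Bigr)D^k .$$ A function is regularly varying of index $\beta$ if it is measurable and of constant sign ultimately, and $f(\lambda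 t)/f(t)\to\lambda^\beta$ as $t\to\infty$ for every $\lambda>0$. It is smoothly varying of index $\rho$ and order $m$ if it is ultimately $m$ times continuously differentiable and its $m$-th derivative is regularly varying of index $\rho-m$. Let $m\ge 0$ be an integer. Assume that $\overline F>0$, that $F$ is ultimately differentiable, and that the hazard rate $h=F'/\overline F$ satisfies, as $t\to\infty$, (0) $h(t)\to0$; (i) $t^{-1}\log t=o(h(t))$; (ii) $h$ is smoothly varying of some negative index and order $m$. Assume moreover that $\sum_{i}|c_i|^\delta<\infty$ for some $\delta\in(0,1)$ and that one of the following holds: (a) $F$ vanishes on a neighborhood of $-\infty$; (b) $F$ is strongly tail balanced, that is, $\overline F/\overline{M_{-1}F}$ has a positive finite limit at $+\infty$, and $M_{-1}F$ also has, ultimately, a hazard rate, which satisfies (0), (i) and (ii). Then $\sum_ic_iX_i$ converges almost surely and a largest weight exists. For every largest weight $c_{(1)}$, the set $\{i:c_i\equiv c_{(1)}\}$ is finite unless $c_{(1)}\equiv0$; for every $i$ in it, $G\natural M_{c_i}F$ has $m$ finite moments and $\overline{M_{c_i}F}$ is ultimately $m$ times continuously differentiable; and, as $t\to\infty$, $$\overline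 G(t)=\sum_{i:\,c_i\equiv c_{(1)}}\bigl(L_{G\natural M_{c_i}F,\,m}\,\overline{M_{c_i}F}\bigr)(t)+o\bigl(h(t)^m\,\overline{M_{c_{(1)}}F}(t)\bigr).$$ (If $c_{(1)}\equiv 0$, all terms vanish for large $t$, and the statement says that $\overline G$ vanishes ultimately.) -/

import Mathlib

open MeasureTheory ProbabilityTheory Filter Topology Asymptotics

noncomputable section

namespace WeightedConvolution

/-- The tail function `1 - F` of a distribution on the real line. -/
def tail (μ : Measure ℝ) (t : ℝ) : ℝ := μ.real (Set.Ioi t)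

/-- The distribution of `a * X` when `X` has distribution `μ`. -/
def scale (a : ℝ) (μ : Measure ℝ) : Measure ℝ := μ.map (fun x => a * x)

/-- The hazard rate `F' / (1 - F)` of a distribution. -/
def hazardRate (μ : Measure ℝ) (t : ℝ) : ℝ := deriv (fun s => cdf μ s) t / tail μ t

/-- The hazard rate exists ultimately: for large `t`, the tail is positive and the distribution
function is differentiable. -/
def HasHazardRate (μ : Measure ℝ) : Prop :=
  ∀ᶠ t in atTop, 0 < tail μ t ∧ DifferentiableAt ℝ (fun s => cdf μ s) t

/-- Regular variation at infinity with index `ρ`, for functions of ultimately constant sign. -/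
def RegularlyVarying (ρ : ℝ) (f : ℝ → ℝ) : Prop :=
  (∃ T : ℝ, Measurable ((Set.Ioi T).domRestrict f)) ∧
  ((∀ᶠ t in atTop, 0 < f t) ∨ (∀ᶠ t in atTop, f t < 0)) ∧
  ∀ l : ℝ, 0 < l → Tendsto (fun t => f (l * t) / f t) atTop (𝓝 (l ^ ρ))

/-- Smooth variation of index `ρ` and order `m`: ultimately `m` times continuously differentiable,
with an `m`-th derivative that is regularly varying of index `ρ - m`. -/
def SmoothlyVarying (ρ : ℝ) (m : ℕ) (f : ℝ → ℝ) : Prop :=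
  (∃ T : ℝ, ContDiffOn ℝ m f (Set.Ioi T)) ∧ RegularlyVarying (ρ - m) (iteratedDeriv m f)

/-- The requirements on a hazard rate `h`: it tends to zero, it is of larger order
than `log t / t`, and it is smoothly varying of negative index and order `m`. -/
def WeibullLike (m : ℕ) (h : ℝ → ℝ) : Prop :=
  Tendsto h atTop (𝓝 0) ∧
  (fun t => Real.log t / t) =o[atTop] h ∧
  ∃ ρ : ℝ, ρ < 0 ∧ SmoothlyVarying ρ m h

/-- The upper and the lower tails are asymptotically proportional. -/
def TailBalanced (μ : Measure ℝ) : Prop :=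
  ∃ L : ℝ, 0 < L ∧ Tendsto (fun t => tail μ t / tail (scale (-1) μ) t) atTop (𝓝 L)

/-- Strong tail balance relative to a property `p` of hazard rates: the distribution is tail
balanced, and the hazard rate of its reflection exists and has the property as well. -/
def StronglyTailBalanced (p : (ℝ → ℝ) → Prop) (μ : Measure ℝ) : Prop :=
  TailBalanced μ ∧ HasHazardRate (scale (-1) μ) ∧ p (hazardRate (scale (-1) μ))

/-- The distribution function vanishes on a neighborhood of minus infinity. -/
def VanishesNearBot (μ : Measure ℝ) : Prop := ∃ a : ℝ, μ (Set.Iic a) = 0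

/-- The standard conditions, for hazard rates that are required to have the property `p`. -/
def StandardConditions (p : (ℝ → ℝ) → Prop) (μ : Measure ℝ) (c : ℤ → ℝ) : Prop :=
  (∃ δ : ℝ, 0 < δ ∧ δ < 1 ∧ Summable fun i => |c i| ^ δ) ∧
  (VanishesNearBot μ ∨ StronglyTailBalanced p μ)

/-- The strict tail order on weights: `a ≺ b`. -/
def TailPrec (μ : Measure ℝ) (a b : ℝ) : Prop :=
  tail (scale a μ) =o[atTop] tail (scale b μ)

/-- Tail equivalence of weights: `a ≡ b`. -/
def TailEquiv (μ : Measure ℝ) (a b : ℝ) : Prop :=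
  ∃ ε : ℝ, 0 < ε ∧ ∀ᶠ t in atTop,
    ε * tail (scale a μ) t ≤ tail (scale b μ) t ∧
    tail (scale b μ) t ≤ ε⁻¹ * tail (scale a μ) t

/-- The weight `c i₁` is a largest one for the tail order, so that it may serve as `c_(1)`. -/
def IsLargestWeight (μ : Measure ℝ) (c : ℤ → ℝ) (i₁ : ℤ) : Prop :=
  ∀ i, TailPrec μ (c i) (c i₁) ∨ TailEquiv μ (c i) (c i₁)

/-- The distribution of the weighted sum `∑ c i * X i`. -/
def weightedLaw {Ω : Type*} [MeasurableSpace Ω] (P : Measure Ω) (X : ℤ → Ω → ℝ) (c : ℤ → ℝ) :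
    Measure ℝ :=
  P.map (fun ω => ∑' i, c i * X i ω)

/-- The distribution of the weighted sum `∑ c j * X j` over the indices `j ≠ i`. -/
def deletedLaw {Ω : Type*} [MeasurableSpace Ω] (P : Measure Ω) (X : ℤ → Ω → ℝ) (c : ℤ → ℝ)
    (i : ℤ) : Measure ℝ :=
  weightedLaw P X (Function.update c i 0)

/-- The Laplace character of order `m` of the distribution `K`, acting on the function `f`. -/
def laplaceCharacter (K : Measure ℝ) (m : ℕ) (f : ℝ → ℝ) (t : ℝ) : ℝ :=
  ∑ k ∈ Finset.range (m + 1),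
    (-1) ^ k / (k.factorial : ℝ) * (∫ x, x ^ k ∂K) * iteratedDeriv k f t

end WeightedConvolution

end

/-! The upper tail of `S = ∑ c i * X i` is governed by a single large summand.

The upper tail of `c i * X i` depends, up to constants, only on an effective weight `e (c i)`: the
positive part of `c i` if `X` is bounded below, and `|c i|` under tail balance (`WeightProfile`).
The tail order on weights is the order of their effective weights, so that the largest weights are
finitely many as soon as one of them is not equivalent to zero.

*One big jump* (`JumpFamily.one_big_jump`). Let `f` be the tail of `c i₁ * X i₁` for a largest
weight `c i₁` of positive effective weight. Its hazard rate is regularly varying of negative index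
and of larger order than `log t / t`, so `Q = -log f` grows sublinearly but faster than every
multiple of `log t`. It may be modified into a function with `Q x / x` decreasing, a `Gauge`, which
is subadditive. Let `U i` be the positive part of `c i * X i`. For `γ < 1`, the expectation of
`exp (γ * Q (U i))` is `1 + O(|c i|)`, so that `exp (γ * ∑ Q (U i))` is integrable. If `S > t`
while every `U i` is at most `(1 - δ) * t`, then `∑ Q (U i) ≥ Q ((1 - δ) * t) / (1 - δ)`, and
Markov's inequality with `γ` close to `1` shows that this event is negligible with respect to
`t ^ (-m) * f t`. So are two large jumps, a jump of a variable of smaller effective weight, and a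
large jump together with a value `R i > ε * t` of the remaining sum `R i = ∑_{j ≠ i} c j * X j`.
Hence `P (S > t)` is, up to `o (t ^ (-m) * f t)`, the sum over the largest weights `c i` of the
probabilities of the events `c i * X i + R i > t`, `R i ≤ ε * t`.

*Taylor expansion* (`RegularTail.exists_laplace_expansion`). By independence each of these
probabilities is the integral of `f (t - x)` over `x ≤ ε * t` against the law of `R i`, where `f`
is now the tail of `c i * X i` and `h` its hazard rate. Smooth variation makes the derivatives of
`f` of order `k ≤ m + 1` asymptotic to `(-h) ^ k * f`, so for fixed `x` the Taylor polynomial of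
order `m` is exact up to `o (h ^ m * f)`. The relative remainder is dominated by `|x| ^ m` and
`exp (Q (max x 0) / 2)`, which are integrable under the law of `R i`, and dominated convergence
turns the Taylor polynomial into the Laplace character. Since `t * h t → ∞`, the error
`t ^ (-m) * f t` of the first step is absorbed by `h t ^ m * f t`.

If all effective weights vanish, the summands and their sum are bounded above, and both sides of
the expansion vanish near infinity.
-/

open MeasureTheory ProbabilityTheory Filter Topology Asymptotics

noncomputable section

namespace WeightedConvolution

/-! ### Regular variation and uniform convergence -/

/-- Additive form of the uniform convergence theorem for a continuous function; the proof is a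
Baire category argument. -/
lemma eventually_uniform_of_continuous {k : ℝ → ℝ} (hk : Continuous k)
    (h : ∀ u, Tendsto (fun x => k (x + u) - k x) atTop (𝓝 0)) {ε : ℝ} (hε : 0 < ε) (B : ℝ) :
    ∀ᶠ x in atTop, ∀ u ∈ Set.Icc 0 B, |k (x + u) - k x| ≤ ε := by
  let A : ℕ → Set ℝ := fun n => {u | ∀ x : ℝ, (n : ℝ) ≤ x → |k (x + u) - k x| ≤ ε / 3}
  have hclosed : ∀ n, IsClosed (A n) := by
    intro n
    have : A n = ⋂ (x : ℝ) (_ : (n : ℝ) ≤ x), {u | |k (x + u) - k x| ≤ ε / 3} := by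
      ext u; simp [A]
    rw [this]
    exact isClosed_biInter fun x _ => isClosed_le (by fun_prop) continuous_const
  have hcover : ⋃ n, A n = Set.univ := by
    refine Set.eq_univ_of_forall fun u => ?_
    have h3 : (0 : ℝ) < ε / 3 := by positivity
    obtain ⟨N, hN⟩ := eventually_atTop.1 ((Metric.tendsto_nhds.1 (h u)) _ h3)
    obtain ⟨n, hn⟩ := exists_nat_ge N
    refine Set.mem_iUnion.2 ⟨n, fun x hx => ?_⟩
    have := hN x (hn.trans hx)
    rw [Real.dist_eq, sub_zero] at this
    exact this.le
  obtain ⟨n, u₀, hu₀⟩ := nonempty_interior_of_iUnion_of_closed hclosed hcover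
  obtain ⟨r, hr, hball⟩ := Metric.isOpen_iff.1 isOpen_interior u₀ hu₀
  have hmem : ∀ v ∈ Set.Icc 0 (r / 2), u₀ + v ∈ A n := fun v hv => by
    refine interior_subset (hball ?_)
    rw [Metric.mem_ball, Real.dist_eq, add_sub_cancel_left, abs_of_nonneg hv.1]
    linarith [hv.2]
  have hshort : ∀ x : ℝ, n + u₀ ≤ x → ∀ v ∈ Set.Icc 0 (r / 2), |k (x + v) - k x| ≤ 2 * ε / 3 := by
    intro x hx v hv
    have h1 := hmem v hv (x - u₀) (by linarith)
    have h2 := hmem 0 ⟨le_rfl, by positivity⟩ (x - u₀) (by linarith)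
    rw [show x - u₀ + (u₀ + v) = x + v by ring] at h1
    rw [show x - u₀ + (u₀ + 0) = x by ring] at h2
    rw [abs_le] at *
    constructor <;> linarith [h1.1, h1.2, h2.1, h2.2]
  set δ := r / 2 with hδ
  have hδ0 : 0 < δ := by positivity
  have hgrid : ∀ᶠ x in atTop, ∀ j ∈ Finset.range (⌊B / δ⌋₊ + 1), |k (x + j * δ) - k x| ≤ ε / 3 := by
    rw [Filter.eventually_all_finset]
    intro j _
    filter_upwards [(Metric.tendsto_nhds.1 (h (j * δ))) (ε / 3) (by positivity)] with x hx
    rw [Real.dist_eq, sub_zero] at hx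
    exact hx.le
  filter_upwards [hgrid, eventually_ge_atTop ((n : ℝ) + u₀), eventually_ge_atTop 0]
    with x hx hx1 hx0 u hu
  set j := ⌊u / δ⌋₊
  have hj1 : (j : ℝ) ≤ u / δ := Nat.floor_le (div_nonneg hu.1 hδ0.le)
  have hj2 : u / δ < j + 1 := Nat.lt_floor_add_one _
  rw [le_div_iff₀ hδ0] at hj1
  rw [div_lt_iff₀ hδ0] at hj2
  have hjr : j ∈ Finset.range (⌊B / δ⌋₊ + 1) := by
    rw [Finset.mem_range, Nat.lt_succ_iff]
    exact Nat.floor_mono (by gcongr; exact hu.2)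
  have h1 := hx j hjr
  have hjpos : 0 ≤ (j : ℝ) * δ := by positivity
  have h2 := hshort (x + j * δ) (by linarith) (u - j * δ) ⟨by linarith, by linarith⟩
  rw [show x + j * δ + (u - j * δ) = x + u by ring] at h2
  rw [abs_le] at *
  constructor <;> linarith [h1.1, h1.2, h2.1, h2.2]

/-- An ultimately positive and continuous function that is regularly varying of index `ρ`. -/
structure PosRegVar (ρ : ℝ) (g : ℝ → ℝ) : Prop where
  pos : ∀ᶠ t in atTop, 0 < g t
  cont : ∃ T, ContinuousOn g (Set.Ioi T)
  ratio : ∀ l : ℝ, 0 < l → Tendsto (fun t => g (l * t) / g t) atTop (𝓝 (l ^ ρ))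

/-- The uniform convergence theorem for regularly varying functions. -/
lemma PosRegVar.uniform {ρ : ℝ} {g : ℝ → ℝ} (hg : PosRegVar ρ g) (B : ℝ) {c : ℝ} (hc : 1 < c) :
    ∀ᶠ s in atTop, ∀ t ∈ Set.Icc s (B * s),
      c⁻¹ * (s / t) ^ ρ * g t ≤ g s ∧ g s ≤ c * (s / t) ^ ρ * g t := by
  obtain ⟨T₁, hT₁⟩ := hg.cont
  obtain ⟨T₂, hT₂⟩ := eventually_atTop.1 hg.pos
  set T := max (max T₁ T₂) 0 + 1 with hT
  have hTT₁ : T₁ < T := by have := le_max_left T₁ T₂; have := le_max_left (max T₁ T₂) 0; linarith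
  have hTT₂ : T₂ ≤ T := by have := le_max_right T₁ T₂; have := le_max_left (max T₁ T₂) 0; linarith
  have hT0 : 0 < T := by have := le_max_right (max T₁ T₂) 0; linarith
  let k : ℝ → ℝ := fun x => Real.log (g (max (Real.exp x) T)) - ρ * x
  have hk : Continuous k := by
    have h1 : Continuous fun x => g (max (Real.exp x) T) := by
      have : Continuous fun x : ℝ => max (Real.exp x) T := by fun_prop
      exact hT₁.comp_continuous this fun x => lt_of_lt_of_le hTT₁ (le_max_right _ _)
    exact (h1.log fun x => (hT₂ _ (hTT₂.trans (le_max_right _ _))).ne').sub (by fun_prop)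
  have hlim : ∀ u, Tendsto (fun x => k (x + u) - k x) atTop (𝓝 0) := by
    intro u
    have h1 := (hg.ratio _ (Real.exp_pos u)).comp Real.tendsto_exp_atTop
    have h2 := (h1.log (by positivity)).sub_const (ρ * u)
    rw [Real.log_rpow (Real.exp_pos u), Real.log_exp, sub_self] at h2
    refine h2.congr' ?_
    filter_upwards [Real.tendsto_exp_atTop.eventually_ge_atTop T,
      (Real.tendsto_exp_atTop.comp
        (tendsto_atTop_add_const_right atTop u tendsto_id)).eventually_ge_atTop T] with x hx1 hx2
    simp only [Function.comp_apply, id_eq] at hx2 ⊢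
    have hx3 : Real.exp (x + u) = Real.exp u * Real.exp x := by rw [Real.exp_add, mul_comm]
    rw [Real.log_div]
    · simp only [k]
      rw [max_eq_left hx1, max_eq_left hx2, hx3]
      ring
    · rw [← hx3]; exact (hT₂ _ (hTT₂.trans hx2)).ne'
    · exact (hT₂ _ (hTT₂.trans hx1)).ne'
  have hlogc : 0 < Real.log c := Real.log_pos hc
  have hu := eventually_uniform_of_continuous hk hlim hlogc (Real.log B)
  filter_upwards [Real.tendsto_log_atTop.eventually hu, eventually_ge_atTop T] with s hs hsT t ht
  have hs0 : 0 < s := hT0.trans_le hsT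
  have ht0 : 0 < t := hs0.trans_le ht.1
  have hgs : 0 < g s := hT₂ _ (hTT₂.trans hsT)
  have hgt : 0 < g t := hT₂ _ (hTT₂.trans (hsT.trans ht.1))
  have hle : t / s ≤ B := by rw [div_le_iff₀ hs0]; exact ht.2
  have h1 := hs (Real.log (t / s)) ⟨Real.log_nonneg (by rw [le_div_iff₀ hs0]; linarith [ht.1]),
    Real.log_le_log (by positivity) hle⟩
  simp only [k] at h1
  rw [Real.log_div ht0.ne' hs0.ne', add_sub_cancel, Real.exp_log ht0, Real.exp_log hs0,
    max_eq_left (hsT.trans ht.1), max_eq_left hsT, abs_le] at h1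
  have hr : Real.log ((s / t) ^ ρ) = ρ * (Real.log s - Real.log t) := by
    rw [Real.log_rpow (by positivity), Real.log_div hs0.ne' ht0.ne']
  have hc0 : 0 < c := by linarith
  have hrp : 0 < (s / t) ^ ρ := by positivity
  constructor
  · rw [← Real.log_le_log_iff (by positivity) hgs, Real.log_mul (by positivity) hgt.ne',
      Real.log_mul (by positivity) hrp.ne', hr, Real.log_inv]
    nlinarith [h1.1, h1.2]
  · rw [← Real.log_le_log_iff hgs (by positivity), Real.log_mul (by positivity) hgt.ne',
      Real.log_mul (by positivity) hrp.ne', hr]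
    nlinarith [h1.1, h1.2]

lemma PosRegVar.exists_bound {ρ : ℝ} {g : ℝ → ℝ} (hg : PosRegVar ρ g) (B : ℝ) :
    ∃ C : ℝ, 1 ≤ C ∧ ∀ᶠ s in atTop, ∀ t ∈ Set.Icc s (B * s), g t ≤ C * g s ∧ g s ≤ C * g t := by
  refine ⟨2 * max 1 B ^ |ρ|, ?_, ?_⟩
  · have : (1 : ℝ) ≤ max 1 B ^ |ρ| := Real.one_le_rpow (le_max_left _ _) (abs_nonneg _)
    linarith
  filter_upwards [hg.uniform B (c := 2) (by norm_num), eventually_gt_atTop 0,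
    eventually_forall_ge_atTop.2 hg.pos] with s hs hs0 hpos t ht
  obtain ⟨h1, h2⟩ := hs t ht
  have ht0 : 0 < t := hs0.trans_le ht.1
  have hgs := hpos s le_rfl
  have hgt := hpos t ht.1
  set M := max 1 B
  have hM : 1 ≤ M := le_max_left _ _
  have hq1 : s / t ≤ 1 := by rw [div_le_one ht0]; exact ht.1
  have hq0 : 0 < s / t := by positivity
  have hqM : M⁻¹ ≤ s / t := by
    rw [le_div_iff₀ ht0, inv_mul_le_iff₀ (by linarith)]
    exact ht.2.trans (mul_le_mul_of_nonneg_right (le_max_right _ _) hs0.le)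
  have hup : (s / t) ^ ρ ≤ M ^ |ρ| := by
    calc (s / t) ^ ρ ≤ (s / t) ^ (-|ρ|) :=
          Real.rpow_le_rpow_of_exponent_ge hq0 hq1 (neg_abs_le ρ)
      _ ≤ (M⁻¹) ^ (-|ρ|) :=
          Real.rpow_le_rpow_of_nonpos (by positivity) hqM (by simp)
      _ = M ^ |ρ| := by rw [Real.inv_rpow (by positivity), Real.rpow_neg (by positivity), inv_inv]
  have hlow : (M ^ |ρ|)⁻¹ ≤ (s / t) ^ ρ := by
    calc (M ^ |ρ|)⁻¹ = (M⁻¹) ^ |ρ| := by rw [Real.inv_rpow (by positivity)]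
      _ ≤ (s / t) ^ |ρ| := Real.rpow_le_rpow (by positivity) hqM (abs_nonneg _)
      _ ≤ (s / t) ^ ρ := Real.rpow_le_rpow_of_exponent_ge hq0 hq1 (le_abs_self ρ)
  have hK : 0 < M ^ |ρ| := by positivity
  constructor
  · have : 2⁻¹ * (M ^ |ρ|)⁻¹ * g t ≤ g s := le_trans (by gcongr) h1
    rw [← mul_inv, inv_mul_le_iff₀ (by positivity)] at this
    exact this
  · exact h2.trans (by gcongr)

/-! ### Smooth variation -/

lemma eventually_sign_of_monotoneOn {φ : ℝ → ℝ} {T : ℝ}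
    (h : MonotoneOn φ (Set.Ioi T) ∨ AntitoneOn φ (Set.Ioi T)) :
    (∀ᶠ t in atTop, 0 ≤ φ t) ∨ (∀ᶠ t in atTop, φ t ≤ 0) := by
  rcases h with h | h
  · by_cases hex : ∃ t, T < t ∧ 0 ≤ φ t
    · obtain ⟨t, ht, h0⟩ := hex
      left
      filter_upwards [eventually_ge_atTop t] with s hs
      exact h0.trans (h ht (Set.mem_Ioi.2 (lt_of_lt_of_le ht hs)) hs)
    · right
      push Not at hex
      filter_upwards [eventually_gt_atTop T] with s hs using (hex s hs).le
  · by_cases hex : ∃ t, T < t ∧ φ t ≤ 0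
    · obtain ⟨t, ht, h0⟩ := hex
      right
      filter_upwards [eventually_ge_atTop t] with s hs
      exact (h ht (Set.mem_Ioi.2 (lt_of_lt_of_le ht hs)) hs).trans h0
    · left
      push Not at hex
      filter_upwards [eventually_gt_atTop T] with s hs using (hex s hs).le

lemma exists_monotoneOn_of_deriv_sign {φ φ' : ℝ → ℝ}
    (hd : ∀ᶠ t in atTop, HasDerivAt φ (φ' t) t)
    (h : (∀ᶠ t in atTop, 0 ≤ φ' t) ∨ (∀ᶠ t in atTop, φ' t ≤ 0)) :
    ∃ T, MonotoneOn φ (Set.Ioi T) ∨ AntitoneOn φ (Set.Ioi T) := by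
  rcases h with h | h <;>
  · obtain ⟨T, hT⟩ := eventually_atTop.1 (hd.and h)
    have hmem : ∀ t ∈ Set.Ioi T, T ≤ t := fun t ht => le_of_lt ht
    have hc : ContinuousOn φ (Set.Ioi T) := fun t ht =>
      (hT t (hmem t ht)).1.continuousAt.continuousWithinAt
    have hdi : DifferentiableOn ℝ φ (interior (Set.Ioi T)) := fun t ht =>
      (hT t (hmem t (interior_subset ht))).1.differentiableAt.differentiableWithinAt
    refine ⟨T, ?_⟩
    first
    | refine Or.inl (monotoneOn_of_deriv_nonneg (convex_Ioi T) hc hdi fun t ht => ?_)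
      rw [(hT t (hmem t (interior_subset ht))).1.deriv]
      exact (hT t (hmem t (interior_subset ht))).2
    | refine Or.inr (antitoneOn_of_deriv_nonpos (convex_Ioi T) hc hdi fun t ht => ?_)
      rw [(hT t (hmem t (interior_subset ht))).1.deriv]
      exact (hT t (hmem t (interior_subset ht))).2

/-- A monotone derivative of a function that tends to zero tends to zero. -/
lemma tendsto_deriv_zero_of_monotoneOn {φ φ' : ℝ → ℝ} {T : ℝ}
    (hd : ∀ᶠ t in atTop, HasDerivAt φ (φ' t) t) (h0 : Tendsto φ atTop (𝓝 0))
    (h : MonotoneOn φ' (Set.Ioi T) ∨ AntitoneOn φ' (Set.Ioi T)) :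
    Tendsto φ' atTop (𝓝 0) := by
  obtain ⟨T', hT'⟩ := eventually_atTop.1 hd
  have hmvt : ∀ t, T' ≤ t → ∃ ξ ∈ Set.Ioo t (t + 1), φ' ξ = φ (t + 1) - φ t := by
    intro t ht
    obtain ⟨ξ, hξ, he⟩ := exists_hasDerivAt_eq_slope φ φ' (show t < t + 1 by linarith)
      (fun x hx => (hT' x (ht.trans hx.1)).continuousAt.continuousWithinAt)
      (fun x hx => hT' x (ht.trans hx.1.le))
    exact ⟨ξ, hξ, by rw [he]; simp⟩
  have hup : Tendsto (fun t => φ (t + 1) - φ t) atTop (𝓝 0) := by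
    simpa using (h0.comp (tendsto_atTop_add_const_right atTop 1 tendsto_id)).sub h0
  have hdown : Tendsto (fun t => φ t - φ (t - 1)) atTop (𝓝 0) := by
    simpa [sub_eq_add_neg] using
      h0.sub (h0.comp (tendsto_atTop_add_const_right atTop (-1) tendsto_id))
  have hboth : ∀ᶠ t in atTop, (φ t - φ (t - 1) ≤ φ' t ∧ φ' t ≤ φ (t + 1) - φ t) ∨
      (φ (t + 1) - φ t ≤ φ' t ∧ φ' t ≤ φ t - φ (t - 1)) := by
    filter_upwards [eventually_ge_atTop (T' + 1), eventually_gt_atTop (T + 1)] with t ht1 ht2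
    obtain ⟨ξ, hξ, he⟩ := hmvt t (by linarith)
    obtain ⟨ζ, hζ, hz⟩ := hmvt (t - 1) (by linarith)
    rw [sub_add_cancel] at hz hζ
    have mt : t ∈ Set.Ioi T := Set.mem_Ioi.2 (by linarith)
    have mξ : ξ ∈ Set.Ioi T := Set.mem_Ioi.2 (by linarith [hξ.1])
    have mζ : ζ ∈ Set.Ioi T := Set.mem_Ioi.2 (by linarith [hζ.1])
    rw [← he, ← hz]
    rcases h with h | h
    · exact Or.inl ⟨h mζ mt hζ.2.le, h mt mξ hξ.1.le⟩
    · exact Or.inr ⟨h mt mξ hξ.1.le, h mζ mt hζ.2.le⟩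
  have hmin := hup.min hdown
  have hmax := hup.max hdown
  rw [min_self] at hmin
  rw [max_self] at hmax
  refine tendsto_of_tendsto_of_tendsto_of_le_of_le' hmin hmax ?_ ?_
  · filter_upwards [hboth] with t ht
    rcases ht with ht | ht
    · exact (min_le_right _ _).trans ht.1
    · exact (min_le_left _ _).trans ht.1
  · filter_upwards [hboth] with t ht
    rcases ht with ht | ht
    · exact ht.2.trans (le_max_left _ _)
    · exact ht.2.trans (le_max_right _ _)

/-- Karamata's theorem for the primitive `G` that vanishes at infinity of a regularly varying
function `g` of index less than `-1`. -/
lemma PosRegVar.primitive {σ : ℝ} {g G : ℝ → ℝ} (hg : PosRegVar σ g)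
    (hd : ∀ᶠ t in atTop, HasDerivAt G (g t) t) (h0 : Tendsto G atTop (𝓝 0)) :
    PosRegVar (σ + 1) (fun t => -G t) ∧ ∃ C, ∀ᶠ t in atTop, t * g t ≤ C * (-G t) := by
  obtain ⟨T, hT⟩ := eventually_atTop.1 (hd.and hg.pos)
  have hmem : ∀ t ∈ Set.Ioi T, T ≤ t := fun t ht => le_of_lt ht
  have hcont : ContinuousOn G (Set.Ioi T) := fun t ht =>
    (hT t (hmem t ht)).1.continuousAt.continuousWithinAt
  have hmono : StrictMonoOn G (Set.Ioi T) := by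
    refine strictMonoOn_of_deriv_pos (convex_Ioi T) hcont fun t ht => ?_
    rw [(hT t (hmem t (interior_subset ht))).1.deriv]
    exact (hT t (hmem t (interior_subset ht))).2
  have hneg : ∀ t ∈ Set.Ioi T, G t < 0 := by
    intro t ht
    have ht1 : t + 1 ∈ Set.Ioi T := Set.mem_Ioi.2 (by have := Set.mem_Ioi.1 ht; linarith)
    have h1 : G t < G (t + 1) := hmono ht ht1 (by linarith)
    have h2 : G (t + 1) ≤ 0 := by
      refine ge_of_tendsto h0 ?_
      filter_upwards [eventually_ge_atTop (t + 1)] with s hs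
      exact hmono.monotoneOn ht1 (Set.mem_Ioi.2 (lt_of_lt_of_le ht1 hs)) hs
    linarith
  have hevneg : ∀ᶠ t in atTop, G t < 0 := by
    filter_upwards [eventually_gt_atTop T] with t ht using hneg t ht
  refine ⟨⟨?_, ⟨T, hcont.neg⟩, ?_⟩, ?_⟩
  · filter_upwards [hevneg] with t ht
    linarith
  · intro l hl
    have hlt : Tendsto (fun t => l * t) atTop atTop := tendsto_id.const_mul_atTop hl
    have hd' : ∀ᶠ t in atTop, HasDerivAt (fun t => G (l * t)) (g (l * t) * l) t := by
      filter_upwards [hlt.eventually hd] with t ht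
      have := ht.comp t ((hasDerivAt_id t).const_mul l)
      simpa [Function.comp_def] using this
    have hq := HasDerivAt.lhopital_zero_atTop hd' hd (hg.pos.mono fun t ht => ht.ne')
      (h0.comp hlt) h0 (l := 𝓝 (l ^ (σ + 1))) (by
        have := (hg.ratio l hl).mul_const l
        rw [Real.rpow_add_one hl.ne']
        refine this.congr fun t => ?_
        rw [div_mul_eq_mul_div])
    refine hq.congr fun t => ?_
    rw [neg_div_neg_eq]
  · obtain ⟨C, hC1, hC⟩ := hg.exists_bound 2
    refine ⟨C, ?_⟩
    filter_upwards [hC, eventually_gt_atTop T, eventually_gt_atTop 0] with t ht htT ht0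
    obtain ⟨ξ, hξ, he⟩ := exists_hasDerivAt_eq_slope G g (show t < 2 * t by linarith)
      (fun x hx => (hT x (by linarith [hx.1])).1.continuousAt.continuousWithinAt)
      (fun x hx => (hT x (by linarith [hx.1])).1)
    have h1 := (ht ξ ⟨hξ.1.le, hξ.2.le⟩).2
    have h2 := hneg (2 * t) (Set.mem_Ioi.2 (by linarith))
    rw [eq_div_iff (by linarith)] at he
    have h3 : t * g t ≤ C * (G (2 * t) - G t) := by
      rw [← he]; nlinarith
    nlinarith

lemma hasDerivAt_iteratedDeriv_of_contDiffOn {m k : ℕ} {h : ℝ → ℝ} {T t : ℝ}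
    (hs : ContDiffOn ℝ m h (Set.Ioi T)) (hk : k < m) (ht : T < t) :
    HasDerivAt (iteratedDeriv k h) (iteratedDeriv (k + 1) h t) t := by
  have h1 : DifferentiableOn ℝ (iteratedDerivWithin k h (Set.Ioi T)) (Set.Ioi T) :=
    hs.differentiableOn_iteratedDerivWithin (by exact_mod_cast hk) (uniqueDiffOn_Ioi T)
  have h2 : DifferentiableAt ℝ (iteratedDeriv k h) t := by
    refine ((h1.congr fun x hx => (iteratedDerivWithin_of_isOpen isOpen_Ioi hx).symm) t
      ht).differentiableAt (Ioi_mem_nhds ht)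
  rw [iteratedDeriv_succ]
  exact h2.hasDerivAt

lemma continuousOn_iteratedDeriv_of_contDiffOn {m k : ℕ} {h : ℝ → ℝ} {T : ℝ}
    (hs : ContDiffOn ℝ m h (Set.Ioi T)) (hk : k ≤ m) :
    ContinuousOn (iteratedDeriv k h) (Set.Ioi T) :=
  (hs.continuousOn_iteratedDerivWithin (by exact_mod_cast hk) (uniqueDiffOn_Ioi T)).congr
    fun _ hx => (iteratedDerivWithin_of_isOpen isOpen_Ioi hx).symm

lemma tendsto_iteratedDeriv_zero {m : ℕ} {h : ℝ → ℝ} {T : ℝ} (h0 : Tendsto h atTop (𝓝 0))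
    (hs : ContDiffOn ℝ m h (Set.Ioi T))
    (hsign : (∀ᶠ t in atTop, 0 ≤ iteratedDeriv m h t) ∨ (∀ᶠ t in atTop, iteratedDeriv m h t ≤ 0)) :
    ∀ k < m, Tendsto (iteratedDeriv k h) atTop (𝓝 0) := by
  have hd : ∀ k < m, ∀ᶠ t in atTop,
      HasDerivAt (iteratedDeriv k h) (iteratedDeriv (k + 1) h t) t := fun k hk => by
    filter_upwards [eventually_gt_atTop T] with t ht
    exact hasDerivAt_iteratedDeriv_of_contDiffOn hs hk ht
  have hsigns : ∀ k ≤ m, (∀ᶠ t in atTop, 0 ≤ iteratedDeriv k h t) ∨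
      (∀ᶠ t in atTop, iteratedDeriv k h t ≤ 0) := by
    intro k hk
    induction hk using Nat.decreasingInduction with
    | self => exact hsign
    | of_succ k hk ih =>
      obtain ⟨S, hS⟩ := exists_monotoneOn_of_deriv_sign (hd k hk) ih
      exact eventually_sign_of_monotoneOn hS
  intro k
  induction k with
  | zero => intro _; simpa using h0
  | succ k ih =>
    intro hk
    obtain ⟨S, hS⟩ := exists_monotoneOn_of_deriv_sign (hd (k + 1) hk) (hsigns (k + 2) hk)
    exact tendsto_deriv_zero_of_monotoneOn (hd k (by omega)) (ih (by omega)) hS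

/-- The derivatives of a smoothly varying function of negative index that tends to zero. -/
lemma SmoothlyVarying.regVar_and_bound {m : ℕ} {ρ : ℝ} {h : ℝ → ℝ}
    (hv : SmoothlyVarying ρ m h) (h0 : Tendsto h atTop (𝓝 0)) (hpos : ∀ᶠ t in atTop, 0 < h t) :
    PosRegVar ρ h ∧ ∀ k ≤ m, ∃ C, ∀ᶠ t in atTop, t ^ k * |iteratedDeriv k h t| ≤ C * h t := by
  obtain ⟨⟨T, hs⟩, -, hsgn, hratio⟩ := hv
  have hd : ∀ k < m, ∀ᶠ t in atTop,
      HasDerivAt (iteratedDeriv k h) (iteratedDeriv (k + 1) h t) t := fun k hk => by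
    filter_upwards [eventually_gt_atTop T] with t ht
    exact hasDerivAt_iteratedDeriv_of_contDiffOn hs hk ht
  have hlim := tendsto_iteratedDeriv_zero h0 hs
    (hsgn.imp (fun h => h.mono fun _ => le_of_lt) (fun h => h.mono fun _ => le_of_lt))
  have key : ∀ k ≤ m, (PosRegVar (ρ - k) (iteratedDeriv k h) ∨
        PosRegVar (ρ - k) (fun t => -iteratedDeriv k h t)) ∧
      (k < m → ∃ C, ∀ᶠ t in atTop,
        t * |iteratedDeriv (k + 1) h t| ≤ C * |iteratedDeriv k h t|) := by
    intro k hk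
    induction hk using Nat.decreasingInduction with
    | self =>
      refine ⟨?_, fun hm => absurd hm (lt_irrefl _)⟩
      rcases hsgn with hsgn | hsgn
      · exact Or.inl ⟨hsgn, ⟨T, continuousOn_iteratedDeriv_of_contDiffOn hs le_rfl⟩, hratio⟩
      · refine Or.inr ⟨hsgn.mono fun t ht => by linarith,
          ⟨T, (continuousOn_iteratedDeriv_of_contDiffOn hs le_rfl).neg⟩, fun l hl => ?_⟩
        refine (hratio l hl).congr fun t => ?_
        rw [neg_div_neg_eq]
    | of_succ k hk ih =>
      have hexp : ρ - ((k + 1 : ℕ) : ℝ) + 1 = ρ - k := by push_cast; ring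
      rcases ih.1 with hp | hp
      · obtain ⟨h1, C, hC⟩ := hp.primitive (hd k hk) (hlim k hk)
        rw [hexp] at h1
        refine ⟨Or.inr h1, fun _ => ⟨C, ?_⟩⟩
        filter_upwards [hC, hp.pos, h1.pos] with t ht hg hG
        rw [abs_of_pos hg, abs_of_neg (by linarith)]
        exact ht
      · obtain ⟨h1, C, hC⟩ := hp.primitive (G := fun t => -iteratedDeriv k h t)
          ((hd k hk).mono fun t ht => ht.neg) (by simpa using (hlim k hk).neg)
        rw [hexp] at h1
        simp only [neg_neg] at h1 hC
        refine ⟨Or.inl h1, fun _ => ⟨C, ?_⟩⟩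
        filter_upwards [hC, hp.pos, h1.pos] with t ht hg hG
        rw [abs_of_neg (by linarith), abs_of_pos hG]
        exact ht
  refine ⟨?_, ?_⟩
  · rcases (key 0 (Nat.zero_le _)).1 with hp | hp
    · simpa using hp
    · obtain ⟨t, ht1, ht2⟩ := (hpos.and hp.pos).exists
      rw [iteratedDeriv_zero] at ht2
      linarith
  · intro k
    induction k with
    | zero =>
      intro _
      refine ⟨1, ?_⟩
      filter_upwards [hpos] with t ht
      rw [iteratedDeriv_zero, abs_of_pos ht]
      simp
    | succ k ih =>
      intro hk
      obtain ⟨C, hC⟩ := ih (by omega)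
      obtain ⟨D, hD⟩ := (key k (by omega)).2 hk
      refine ⟨|D| * C, ?_⟩
      filter_upwards [hC, hD, eventually_ge_atTop 0] with t h1 h2 h3
      calc t ^ (k + 1) * |iteratedDeriv (k + 1) h t|
          = t ^ k * (t * |iteratedDeriv (k + 1) h t|) := by ring
        _ ≤ t ^ k * (|D| * |iteratedDeriv k h t|) := by
          refine mul_le_mul_of_nonneg_left ?_ (by positivity)
          exact h2.trans (mul_le_mul_of_nonneg_right (le_abs_self D) (abs_nonneg _))
        _ = |D| * (t ^ k * |iteratedDeriv k h t|) := by ring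
        _ ≤ |D| * (C * h t) := by gcongr
        _ = |D| * C * h t := by ring

/-! ### Tails with a Weibull-like hazard rate -/

/-- The function `f` is a positive tail with hazard rate `h`, which tends to zero, dominates
`log t / t` and is regularly varying of negative index, and the derivatives of `f` of order
`k ≤ n` are equivalent to `(-h) ^ k * f`. -/
structure RegularTail (n : ℕ) (f h : ℝ → ℝ) : Prop where
  pos : ∀ t, 0 < f t
  le_one : ∀ t, f t ≤ 1
  anti : Antitone f
  hasDeriv : ∀ᶠ t in atTop, HasDerivAt f (-(h t * f t)) t
  hazard_tendsto : Tendsto h atTop (𝓝 0)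
  hazard_log : (fun t => Real.log t / t) =o[atTop] h
  hazard_regVar : ∃ ρ < 0, PosRegVar ρ h
  smooth : ∃ T, ContDiffOn ℝ n f (Set.Ioi T)
  deriv_asymp : ∀ k ≤ n, Tendsto (fun t => iteratedDeriv k f t / (h t ^ k * f t)) atTop
    (𝓝 ((-1) ^ k))

lemma contDiffOn_of_hazard {m : ℕ} {f h : ℝ → ℝ} {T : ℝ} (hs : ContDiffOn ℝ m h (Set.Ioi T))
    (hd : ∀ t, T < t → HasDerivAt f (-(h t * f t)) t) :
    ContDiffOn ℝ (m + 1 : ℕ) f (Set.Ioi T) := by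
  have : ∀ k ≤ m + 1, ContDiffOn ℝ k f (Set.Ioi T) := by
    intro k
    induction k with
    | zero =>
      intro _
      rw [Nat.cast_zero, contDiffOn_zero]
      exact fun t ht => (hd t ht).continuousAt.continuousWithinAt
    | succ k ih =>
      intro hk
      rw [Nat.cast_add, Nat.cast_one, contDiffOn_succ_iff_deriv_of_isOpen isOpen_Ioi]
      refine ⟨fun t ht => (hd t ht).differentiableAt.differentiableWithinAt, by simp, ?_⟩
      have h1 : ContDiffOn ℝ k (fun t => -(h t * f t)) (Set.Ioi T) :=
        ((hs.of_le (by exact_mod_cast (by omega : k ≤ m))).mul (ih (by omega))).neg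
      exact h1.congr fun t ht => (hd t ht).deriv
  exact this (m + 1) le_rfl

/-- Leibniz' rule for `f' = -h f`, when the derivatives of `h` of positive order are negligible. -/
lemma tendsto_iteratedDeriv_div {m : ℕ} {f h : ℝ → ℝ} {T : ℝ}
    (hs : ContDiffOn ℝ m h (Set.Ioi T)) (hd : ∀ t, T < t → HasDerivAt f (-(h t * f t)) t)
    (hf : ∀ t, 0 < f t) (hh : ∀ᶠ t in atTop, 0 < h t)
    (hsmall : ∀ k ≤ m, 1 ≤ k →
      Tendsto (fun t => iteratedDeriv k h t / h t ^ (k + 1)) atTop (𝓝 0)) :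
    ∀ k ≤ m + 1, Tendsto (fun t => iteratedDeriv k f t / (h t ^ k * f t)) atTop
      (𝓝 ((-1) ^ k)) := by
  have hfs := contDiffOn_of_hazard hs hd
  intro k
  induction k using Nat.strong_induction_on with
  | _ k ih =>
    intro hk
    rcases k with _ | k
    · simp only [iteratedDeriv_zero, pow_zero, one_mul]
      exact tendsto_const_nhds.congr fun t => (div_self (hf t).ne').symm
    · have hterm : ∀ i ∈ Finset.range (k + 1), Tendsto (fun t => (k.choose i : ℝ) *
          (iteratedDeriv i h t / h t ^ (i + 1)) *
          (iteratedDeriv (k - i) f t / (h t ^ (k - i) * f t))) atTop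
          (𝓝 ((k.choose i : ℝ) * (if i = 0 then 1 else 0) * (-1) ^ (k - i))) := by
        intro i hi
        rw [Finset.mem_range] at hi
        refine (Tendsto.const_mul _ ?_).mul (ih (k - i) (by omega) (by omega))
        split_ifs with h0
        · subst h0
          refine tendsto_const_nhds.congr' ?_
          filter_upwards [hh] with t ht
          simp [ht.ne']
        · exact hsmall i (by omega) (by omega)
      have hsum := (tendsto_finsetSum _ hterm).neg
      have hval : -∑ i ∈ Finset.range (k + 1), (k.choose i : ℝ) * (if i = 0 then 1 else 0) *
          (-1) ^ (k - i) = (-1) ^ (k + 1) := by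
        rw [Finset.sum_eq_single 0 (by intro i _ hi; simp [hi]) (by simp)]
        simp [pow_succ]
      rw [hval] at hsum
      refine hsum.congr' ?_
      filter_upwards [hh, eventually_gt_atTop T] with t ht htT
      have hev : deriv f =ᶠ[𝓝 t] fun s => -(h s * f s) := by
        filter_upwards [Ioi_mem_nhds htT] with s hs' using (hd s hs').deriv
      have hkm : k ≤ m := by omega
      have hh' : ContDiffAt ℝ k h t :=
        (hs.of_le (by exact_mod_cast hkm)).contDiffAt (Ioi_mem_nhds htT)
      have hf' : ContDiffAt ℝ k f t :=
        (hfs.of_le (by exact_mod_cast (by omega : k ≤ m + 1))).contDiffAt (Ioi_mem_nhds htT)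
      rw [iteratedDeriv_succ', hev.iteratedDeriv_eq, iteratedDeriv_fun_neg,
        iteratedDeriv_fun_mul hh' hf', neg_div, Finset.sum_div]
      congr 1
      refine Finset.sum_congr rfl fun i hi => ?_
      rw [Finset.mem_range] at hi
      have : h t ^ (k + 1) = h t ^ (i + 1) * h t ^ (k - i) := by
        rw [← pow_add]; congr 1; omega
      rw [this]
      have := (hf t).ne'
      have := ht.ne'
      field_simp

lemma hazard_eventually_pos {h : ℝ → ℝ} (hlog : (fun t => Real.log t / t) =o[atTop] h)
    (hnn : ∀ᶠ t in atTop, 0 ≤ h t) : ∀ᶠ t in atTop, 0 < h t := by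
  filter_upwards [hnn, hlog.bound one_pos, eventually_gt_atTop 1] with t h1 h2 h3
  refine lt_of_le_of_ne h1 fun h0 => ?_
  rw [← h0, norm_zero, mul_zero, norm_le_zero_iff] at h2
  have := div_pos (Real.log_pos h3) (by linarith : (0 : ℝ) < t)
  linarith

/-- The product `t * h t` eventually exceeds any multiple of `log t`. -/
lemma eventually_mul_log_le {h : ℝ → ℝ} (hlog : (fun t => Real.log t / t) =o[atTop] h)
    (hnn : ∀ᶠ t in atTop, 0 < h t) (A : ℝ) : ∀ᶠ t in atTop, A * Real.log t ≤ t * h t := by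
  have hA : 0 < |A| + 1 := by positivity
  filter_upwards [hnn, hlog.bound (inv_pos.2 hA), eventually_gt_atTop 1] with t h1 h2 h3
  have hl := Real.log_pos h3
  have ht : 0 < t := by linarith
  rw [Real.norm_of_nonneg (by positivity), Real.norm_of_nonneg h1.le, div_le_iff₀ ht,
    mul_assoc, ← div_eq_inv_mul, le_div_iff₀ hA] at h2
  nlinarith [le_abs_self A]

lemma tendsto_inv_mul_hazard {h : ℝ → ℝ} (hlog : (fun t => Real.log t / t) =o[atTop] h)
    (hnn : ∀ᶠ t in atTop, 0 < h t) : Tendsto (fun t => (t * h t)⁻¹) atTop (𝓝 0) := by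
  refine Tendsto.inv_tendsto_atTop ?_
  refine tendsto_atTop_mono' _ ?_ Real.tendsto_log_atTop
  filter_upwards [eventually_mul_log_le hlog hnn 1] with t ht
  linarith

lemma tail_eq_one_sub_cdf (ν : Measure ℝ) [IsProbabilityMeasure ν] (t : ℝ) :
    tail ν t = 1 - cdf ν t := by
  rw [tail, cdf_eq_real, ← probReal_compl_eq_one_sub measurableSet_Iic, Set.compl_Iic]

lemma tail_antitone (ν : Measure ℝ) [IsProbabilityMeasure ν] : Antitone (tail ν) :=
  fun _ _ hst => measureReal_mono (Set.Ioi_subset_Ioi hst)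

lemma tail_pos_of_hasHazardRate {ν : Measure ℝ} [IsProbabilityMeasure ν] (hh : HasHazardRate ν)
    (t : ℝ) : 0 < tail ν t := by
  obtain ⟨s, hs, hst⟩ := (hh.and (eventually_ge_atTop t)).exists
  exact hs.1.trans_le (tail_antitone ν hst)

/-- A distribution with a Weibull-like hazard rate has a regular tail, one order smoother. -/
lemma regularTail_of_weibullLike {m : ℕ} {ν : Measure ℝ} [IsProbabilityMeasure ν]
    (hh : HasHazardRate ν) (hw : WeibullLike m (hazardRate ν)) :
    RegularTail (m + 1) (tail ν) (hazardRate ν) := by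
  obtain ⟨h0, hlog, ρ, hρ, hv⟩ := hw
  have hpos := tail_pos_of_hasHazardRate hh
  have hd : ∀ᶠ t in atTop, HasDerivAt (tail ν) (-(hazardRate ν t * tail ν t)) t := by
    filter_upwards [hh] with t ht
    have h1 := (ht.2.hasDerivAt.const_sub 1)
    have h2 : (fun s => 1 - cdf ν s) = tail ν := funext fun s => (tail_eq_one_sub_cdf ν s).symm
    rw [h2] at h1
    rwa [hazardRate, div_mul_cancel₀ _ (hpos t).ne']
  have hnn : ∀ t, 0 ≤ hazardRate ν t := fun t =>
    div_nonneg (Monotone.deriv_nonneg (monotone_cdf ν)) (hpos t).le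
  have hhpos := hazard_eventually_pos hlog (Eventually.of_forall hnn)
  obtain ⟨hrv, hb⟩ := hv.regVar_and_bound h0 hhpos
  obtain ⟨T₁, hT₁⟩ := hv.1
  obtain ⟨T₂, hT₂⟩ := eventually_atTop.1 hd
  have hs : ContDiffOn ℝ m (hazardRate ν) (Set.Ioi (max T₁ T₂)) :=
    hT₁.mono (Set.Ioi_subset_Ioi (le_max_left _ _))
  have hd' : ∀ t, max T₁ T₂ < t → HasDerivAt (tail ν) (-(hazardRate ν t * tail ν t)) t :=
    fun t ht => hT₂ t ((le_max_right _ _).trans ht.le)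
  refine ⟨hpos, fun t => measureReal_le_one, tail_antitone ν, hd, h0, hlog, ⟨ρ, hρ, hrv⟩,
    ⟨_, contDiffOn_of_hazard hs hd'⟩, tendsto_iteratedDeriv_div hs hd' hpos hhpos ?_⟩
  intro k hk hk1
  obtain ⟨C, hC⟩ := hb k hk
  have hlim : Tendsto (fun t => C * ((t * hazardRate ν t)⁻¹) ^ k) atTop (𝓝 0) := by
    have := ((tendsto_inv_mul_hazard hlog hhpos).pow k).const_mul C
    rwa [zero_pow (by omega), mul_zero] at this
  refine squeeze_zero_norm' ?_ hlim
  filter_upwards [hC, hhpos, eventually_gt_atTop 0] with t h1 h2 h3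
  rw [norm_div, Real.norm_eq_abs, Real.norm_of_nonneg (by positivity), div_le_iff₀ (by positivity)]
  have h4 : C * ((t * hazardRate ν t)⁻¹) ^ k * hazardRate ν t ^ (k + 1)
      = C * hazardRate ν t / t ^ k := by
    rw [mul_inv, mul_pow, inv_pow, inv_pow, pow_succ]
    field_simp
  rw [h4, le_div_iff₀ (by positivity)]
  linarith

lemma iteratedDeriv_comp_mul_left_real (f : ℝ → ℝ) (a : ℝ) (k : ℕ) (t : ℝ) :
    iteratedDeriv k (fun x => f (a * x)) t = a ^ k * iteratedDeriv k f (a * t) := by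
  induction k generalizing t with
  | zero => simp
  | succ k ih =>
    rw [iteratedDeriv_succ, iteratedDeriv_succ]
    have : iteratedDeriv k (fun x => f (a * x)) = fun t => a ^ k * iteratedDeriv k f (a * t) :=
      funext ih
    rw [this, deriv_const_mul_field, deriv_comp_mul_left, smul_eq_mul]
    ring

lemma PosRegVar.comp_mul {ρ a : ℝ} {g : ℝ → ℝ} (hg : PosRegVar ρ g) (ha : 0 < a) :
    PosRegVar ρ (fun t => a * g (a * t)) := by
  have hat : Tendsto (fun t => a * t) atTop atTop := tendsto_id.const_mul_atTop ha
  obtain ⟨T, hT⟩ := hg.cont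
  refine ⟨(hat.eventually hg.pos).mono fun t ht => mul_pos ha ht, ⟨a⁻¹ * T, ?_⟩, fun l hl => ?_⟩
  · refine continuousOn_const.mul (hT.comp (by fun_prop) fun t ht => ?_)
    rw [Set.mem_Ioi, inv_mul_lt_iff₀ ha] at ht
    exact ht
  · refine ((hg.ratio l hl).comp hat).congr fun t => ?_
    simp only [Function.comp_apply]
    rw [mul_div_mul_left _ _ ha.ne', show l * (a * t) = a * (l * t) by ring]

/-- Change of scale for regular tails. -/
lemma RegularTail.comp_mul {n : ℕ} {f h : ℝ → ℝ} (hf : RegularTail n f h) {a : ℝ} (ha : 0 < a) :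
    RegularTail n (fun t => f (a * t)) (fun t => a * h (a * t)) := by
  have hat : Tendsto (fun t => a * t) atTop atTop := tendsto_id.const_mul_atTop ha
  obtain ⟨ρ, hρ, hrv⟩ := hf.hazard_regVar
  obtain ⟨T, hT⟩ := hf.smooth
  refine ⟨fun t => hf.pos _, fun t => hf.le_one _,
    fun s t hst => hf.anti (mul_le_mul_of_nonneg_left hst ha.le), ?_, ?_, ?_,
    ⟨ρ, hρ, hrv.comp_mul ha⟩, ⟨a⁻¹ * T, ?_⟩, fun k hk => ?_⟩
  · filter_upwards [hat.eventually hf.hasDeriv] with t ht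
    have := ht.comp t ((hasDerivAt_id t).const_mul a)
    simp only [Function.comp_def, mul_one] at this
    exact this.congr_deriv (by ring)
  · simpa using (hf.hazard_tendsto.comp hat).const_mul a
  · have h1 : (fun t => Real.log (a * t) / (a * t)) =o[atTop] fun t => a * h (a * t) :=
      ((isLittleO_const_mul_right_iff ha.ne').2 (hf.hazard_log.comp_tendsto hat))
    refine IsBigO.trans_isLittleO ?_ h1
    refine IsBigO.of_bound (2 * a) ?_
    have h2 : ∀ᶠ t in atTop, -2 * Real.log a ≤ Real.log t :=
      Real.tendsto_log_atTop.eventually_ge_atTop _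
    filter_upwards [h2, eventually_gt_atTop 1, hat.eventually_gt_atTop 1] with t h2 h3 h4
    have ht : 0 < t := by linarith
    have hl := Real.log_pos h3
    have hl' := Real.log_pos h4
    rw [Real.norm_of_nonneg (by positivity), Real.norm_of_nonneg (by positivity)]
    rw [Real.log_mul ha.ne' ht.ne'] at hl' ⊢
    rw [show 2 * a * ((Real.log a + Real.log t) / (a * t))
      = 2 * (Real.log a + Real.log t) / t by field_simp]
    gcongr
    linarith
  · refine hT.comp (by fun_prop) fun t ht => ?_
    rw [Set.mem_Ioi, inv_mul_lt_iff₀ ha] at ht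
    exact ht
  · refine ((hf.deriv_asymp k hk).comp hat).congr fun t => ?_
    simp only [Function.comp_apply]
    rw [iteratedDeriv_comp_mul_left_real, mul_pow, mul_assoc,
      mul_div_mul_left _ _ (pow_ne_zero k ha.ne')]

/-! ### Growth of the cumulative hazard -/

lemma RegularTail.hazard_pos {n : ℕ} {f h : ℝ → ℝ} (hf : RegularTail n f h) :
    ∀ᶠ t in atTop, 0 < h t := by
  obtain ⟨ρ, -, hrv⟩ := hf.hazard_regVar
  exact hrv.pos

lemma RegularTail.hasDerivAt_neg_log {n : ℕ} {f h : ℝ → ℝ} (hf : RegularTail n f h) :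
    ∀ᶠ t in atTop, HasDerivAt (fun s => -Real.log (f s)) (h t) t := by
  filter_upwards [hf.hasDeriv] with t ht
  refine (ht.log (hf.pos t).ne').neg.congr_deriv ?_
  have := (hf.pos t).ne'
  field_simp

lemma RegularTail.neg_log_nonneg {n : ℕ} {f h : ℝ → ℝ} (hf : RegularTail n f h) (t : ℝ) :
    0 ≤ -Real.log (f t) :=
  neg_nonneg.2 (Real.log_nonpos (hf.pos t).le (hf.le_one t))

lemma RegularTail.neg_log_mono {n : ℕ} {f h : ℝ → ℝ} (hf : RegularTail n f h) :
    Monotone fun t => -Real.log (f t) := fun _ t hst =>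
  neg_le_neg (Real.log_le_log (hf.pos t) (hf.anti hst))

/-- The mean value theorem for the cumulative hazard `-log f`. -/
lemma RegularTail.exists_slope {n : ℕ} {f h : ℝ → ℝ} (hf : RegularTail n f h) :
    ∀ᶠ x in atTop, ∀ y, x < y →
      ∃ ξ ∈ Set.Ioo x y, -Real.log (f y) - -Real.log (f x) = h ξ * (y - x) := by
  filter_upwards [eventually_forall_ge_atTop.2 hf.hasDerivAt_neg_log] with x hx y hxy
  obtain ⟨ξ, hξ, he⟩ := exists_hasDerivAt_eq_slope (fun s => -Real.log (f s)) h hxy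
    (fun z hz => (hx z hz.1).continuousAt.continuousWithinAt) (fun z hz => hx z hz.1.le)
  refine ⟨ξ, hξ, ?_⟩
  rw [he, div_mul_cancel₀ _ (by linarith)]

/-- Since `h` has negative index, `t * h t` is at most a fraction of the cumulative hazard. -/
lemma RegularTail.exists_mul_hazard_le {n : ℕ} {f h : ℝ → ℝ} (hf : RegularTail n f h) :
    ∃ κ : ℝ, 0 < κ ∧ κ < 1 ∧ ∀ᶠ t in atTop, t * h t ≤ (1 - κ) * -Real.log (f t) := by
  obtain ⟨ρ, hρ, hrv⟩ := hf.hazard_regVar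
  set D : ℝ := (2 : ℝ)⁻¹ ^ ρ with hD
  have hD1 : 1 < D := Real.one_lt_rpow_of_pos_of_lt_one_of_neg (by norm_num) (by norm_num) hρ
  set x : ℝ := (D - 1) / 8 with hx
  have hx0 : 0 < x := by rw [hx]; linarith
  have hDx : D = 1 + 8 * x := by rw [hx]; ring
  set a : ℝ := x / D with ha
  have ha0 : 0 < a := by positivity
  have haD : a * D = x := by rw [ha]; field_simp
  have ha2 : a < 1 / 2 := by
    rw [ha, div_lt_iff₀ (by linarith)]; linarith
  refine ⟨2 * x / (1 + 3 * x), by positivity, by rw [div_lt_one (by positivity)]; linarith, ?_⟩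
  have hat : Tendsto (fun t => a * t) atTop atTop := tendsto_id.const_mul_atTop ha0
  filter_upwards [hat.eventually (eventually_forall_ge_atTop.2
      (hrv.uniform a⁻¹ (c := 1 + x) (by linarith))),
    hat.eventually (eventually_forall_ge_atTop.2 hf.exists_slope), hf.hazard_pos,
    eventually_gt_atTop 0] with t hu hm hpos ht0
  have hlow : ∀ s, a * t ≤ s → s ≤ t → (s / t) ^ ρ * h t ≤ (1 + x) * h s := by
    intro s hs hst
    have h1 := (hu s hs t ⟨hst, by rw [← div_eq_inv_mul, le_div_iff₀ ha0]; linarith⟩).1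
    rwa [mul_assoc, inv_mul_le_iff₀ (by linarith)] at h1
  have hat0 : 0 < a * t := by positivity
  have hat2 : a * t < t / 2 := by nlinarith
  obtain ⟨ξ, hξ, he⟩ := hm (t / 2) hat2.le t (by linarith)
  obtain ⟨ζ, hζ, hz⟩ := hm (a * t) le_rfl (t / 2) hat2
  have h1 := hlow ξ (by linarith [hξ.1]) hξ.2.le
  have h2 := hlow ζ hζ.1.le (by linarith [hζ.2])
  have hξ0 : 0 < ξ := by linarith [hξ.1]
  have hζ0 : 0 < ζ := by linarith [hζ.1]
  have h3 : (1 : ℝ) ≤ (ξ / t) ^ ρ :=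
    Real.one_le_rpow_of_pos_of_le_one_of_nonpos (by positivity)
      (by rw [div_le_one ht0]; exact hξ.2.le) hρ.le
  have h4 : D ≤ (ζ / t) ^ ρ :=
    Real.rpow_le_rpow_of_nonpos (by positivity)
      (by rw [div_le_iff₀ ht0]; linarith [hζ.2]) hρ.le
  have h5 : h t ≤ (1 + x) * h ξ := by nlinarith
  have h6 : D * h t ≤ (1 + x) * h ζ := by nlinarith
  have h7 := hf.neg_log_nonneg (a * t)
  have h8 : (1 + x) * -Real.log (f t) ≥ (t / 2) * h t + (t / 2 - a * t) * (D * h t) := by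
    nlinarith [mul_le_mul_of_nonneg_left h5 (by linarith : (0:ℝ) ≤ t / 2),
      mul_le_mul_of_nonneg_left h6 (by linarith : (0:ℝ) ≤ t / 2 - a * t)]
  have h9 : (t / 2) * h t + (t / 2 - a * t) * (D * h t) = (1 + 3 * x) * (t * h t) := by
    have : a * t * (D * h t) = x * (t * h t) := by rw [← haD]; ring
    rw [sub_mul, this, hDx]; ring
  rw [h9] at h8
  rw [show 1 - 2 * x / (1 + 3 * x) = (1 + x) / (1 + 3 * x) by field_simp; ring,
    div_mul_eq_mul_div, le_div_iff₀ (by positivity)]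
  linarith

/-- The cumulative hazard has a growth exponent less than one. -/
lemma RegularTail.exists_growth {n : ℕ} {f h : ℝ → ℝ} (hf : RegularTail n f h) :
    ∃ κ : ℝ, 0 < κ ∧ κ < 1 ∧ ∀ᶠ x in atTop, ∀ y, x ≤ y →
      -Real.log (f y) ≤ (y / x) ^ (1 - κ) * -Real.log (f x) := by
  obtain ⟨κ, hκ0, hκ1, hκ⟩ := hf.exists_mul_hazard_le
  refine ⟨κ, hκ0, hκ1, ?_⟩
  obtain ⟨T, hT⟩ := eventually_atTop.1 ((hκ.and hf.hasDerivAt_neg_log).and (eventually_gt_atTop 0))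
  let φ : ℝ → ℝ := fun s => -Real.log (f s) * s ^ (κ - 1)
  have hd : ∀ s ∈ Set.Ici T, HasDerivAt φ
      (h s * s ^ (κ - 1) + -Real.log (f s) * ((κ - 1) * s ^ (κ - 1 - 1))) s := fun s hs =>
    (hT s hs).1.2.mul (Real.hasDerivAt_rpow_const (Or.inl (hT s hs).2.ne'))
  have hanti : AntitoneOn φ (Set.Ici T) := by
    refine antitoneOn_of_deriv_nonpos (convex_Ici T)
      (fun s hs => (hd s hs).continuousAt.continuousWithinAt)
      (fun s hs => (hd s (interior_subset hs)).differentiableAt.differentiableWithinAt)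
      fun s hs => ?_
    have hs' := interior_subset hs
    rw [(hd s hs').deriv]
    have h0 := (hT s hs').2
    have h1 := (hT s hs').1.1
    have h2 : s ^ (κ - 1) = s ^ (κ - 1 - 1) * s := by
      rw [← Real.rpow_add_one h0.ne']; congr 1; ring
    rw [h2]
    have h3 : 0 < s ^ (κ - 1 - 1) := by positivity
    nlinarith
  filter_upwards [eventually_ge_atTop T] with x hx y hxy
  have hx0 := (hT x hx).2
  have hy0 : 0 < y := by linarith
  have h1 := hanti hx (Set.mem_Ici.2 (hx.trans hxy)) hxy
  simp only [φ] at h1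
  rw [Real.div_rpow hy0.le hx0.le]
  have h2 : y ^ (κ - 1) = (y ^ (1 - κ))⁻¹ := by rw [← Real.rpow_neg hy0.le]; congr 1; ring
  have h3 : x ^ (κ - 1) = (x ^ (1 - κ))⁻¹ := by rw [← Real.rpow_neg hx0.le]; congr 1; ring
  rw [h2, h3, ← div_eq_mul_inv, div_le_iff₀ (by positivity)] at h1
  calc -Real.log (f y) ≤ -Real.log (f x) * (x ^ (1 - κ))⁻¹ * y ^ (1 - κ) := h1
    _ = _ := by ring

lemma RegularTail.mul_log_le {n : ℕ} {f h : ℝ → ℝ} (hf : RegularTail n f h) (A : ℝ) :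
    ∀ᶠ t in atTop, A * Real.log t ≤ -Real.log (f t) := by
  obtain ⟨κ, hκ0, hκ1, hκ⟩ := hf.exists_mul_hazard_le
  filter_upwards [hκ, eventually_mul_log_le hf.hazard_log hf.hazard_pos A] with t h1 h2
  nlinarith [hf.neg_log_nonneg t]

/-- Rapid variation: shrinking the scale makes the tail smaller by any power of `t`. -/
lemma RegularTail.scale_isLittleO {n : ℕ} {f h : ℝ → ℝ} (hf : RegularTail n f h) (m : ℕ)
    {l : ℝ} (hl : 1 < l) : (fun t => f (l * t)) =o[atTop] fun t => f t / t ^ m := by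
  rw [isLittleO_iff]
  intro c hc
  set A : ℝ := l / (l - 1) * (m + 1) with hA
  have hl1 : 0 < l - 1 := by linarith
  have hpt := tendsto_inv_atTop_zero (𝕜 := ℝ).eventually (ge_mem_nhds hc)
  filter_upwards [hf.exists_slope, eventually_forall_ge_atTop.2
    (eventually_mul_log_le hf.hazard_log hf.hazard_pos A), eventually_gt_atTop 1, hpt]
    with t h1 h2 ht hct
  have ht0 : 0 < t := by linarith
  obtain ⟨ξ, hξ, he⟩ := h1 (l * t) (by nlinarith)
  have h3 := h2 ξ hξ.1.le
  have hlog : 0 < Real.log t := Real.log_pos ht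
  have hlξ : Real.log t ≤ Real.log ξ := Real.log_le_log ht0 hξ.1.le
  have hξ0 : 0 < ξ := by linarith [hξ.1]
  have hA0 : 0 < A := by positivity
  have hhξ : 0 < h ξ := by
    have : 0 < ξ * h ξ := lt_of_lt_of_le (by nlinarith) h3
    exact (pos_iff_pos_of_mul_pos this).1 hξ0
  -- the increment of `-log f` over `[t, l t]` is at least `(m + 1) log t`
  have h4 : (m + 1) * Real.log t ≤ h ξ * (l * t - t) := by
    have h5 : A * Real.log t ≤ l * t * h ξ := by
      calc A * Real.log t ≤ A * Real.log ξ := by gcongr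
        _ ≤ ξ * h ξ := h3
        _ ≤ l * t * h ξ := by gcongr; exact hξ.2.le
    have h6 : (l - 1) / l * (A * Real.log t) ≤ (l - 1) / l * (l * t * h ξ) := by gcongr
    have h7 : (l - 1) / l * (A * Real.log t) = (m + 1) * Real.log t := by
      rw [hA]; field_simp
    rw [h7] at h6
    refine h6.trans (le_of_eq ?_)
    field_simp
  rw [← he] at h4
  have h5 : Real.log (f (l * t)) ≤ Real.log (f t * (t ^ (m + 1))⁻¹) := by
    rw [Real.log_mul (hf.pos t).ne' (by positivity), Real.log_inv, Real.log_pow]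
    push_cast
    linarith
  rw [Real.log_le_log_iff (hf.pos _) (mul_pos (hf.pos t) (by positivity))] at h5
  rw [Real.norm_of_nonneg (hf.pos _).le,
    Real.norm_of_nonneg (div_pos (hf.pos t) (by positivity)).le]
  refine h5.trans ?_
  rw [pow_succ, mul_inv, div_eq_mul_inv]
  have hft := hf.pos t
  have : 0 < f t * (t ^ m)⁻¹ := by positivity
  calc f t * ((t ^ m)⁻¹ * t⁻¹) = t⁻¹ * (f t * (t ^ m)⁻¹) := by ring
    _ ≤ _ := by gcongr

/-! ### Gauges -/

/-- A gauge is a continuous increasing function that grows at most linearly, with `Q x / x`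
decreasing, and faster than the logarithm. It is a globally defined substitute for the cumulative
hazard. -/
structure Gauge (Q : ℝ → ℝ) : Prop where
  cont : Continuous Q
  mono : Monotone Q
  star : ∀ x y, 0 < x → x ≤ y → x * Q y ≤ y * Q x
  lip : ∃ L, 0 ≤ L ∧ ∀ x, 0 ≤ x → Q x ≤ L * x
  zero : Q 0 = 0
  log : ∀ A : ℝ, ∀ᶠ t in atTop, A * Real.log t ≤ Q t

lemma Gauge.nonneg {Q : ℝ → ℝ} (hQ : Gauge Q) {x : ℝ} (hx : 0 ≤ x) : 0 ≤ Q x :=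
  hQ.zero ▸ hQ.mono hx

lemma Gauge.tendsto {Q : ℝ → ℝ} (hQ : Gauge Q) : Tendsto Q atTop atTop := by
  refine tendsto_atTop_mono' _ ?_ Real.tendsto_log_atTop
  filter_upwards [hQ.log 1] with t ht
  linarith

/-- The gauge of a regular tail agrees with the cumulative hazard near infinity and is linear
elsewhere. -/
lemma RegularTail.exists_gauge {n : ℕ} {f h : ℝ → ℝ} (hf : RegularTail n f h) :
    ∃ Q, Gauge Q ∧ (∃ C, 0 < C ∧ ∀ x, f x ≤ C * Real.exp (-Q x)) ∧
      ∀ᶠ t in atTop, Q t = -Real.log (f t) := by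
  obtain ⟨κ, hκ0, hκ1, hκ⟩ := hf.exists_growth
  obtain ⟨T, hT⟩ := eventually_atTop.1
    ((hκ.and hf.hasDerivAt_neg_log).and (eventually_gt_atTop 0))
  set H : ℝ → ℝ := fun t => -Real.log (f t) with hH
  have hT0 : 0 < T := (hT T le_rfl).2
  have hHT : 0 ≤ H T := hf.neg_log_nonneg T
  let Q : ℝ → ℝ := fun t => if t ≤ T then H T / T * t else H t
  have hQ1 : ∀ t, t ≤ T → Q t = H T / T * t := fun t ht => if_pos ht
  have hQ2 : ∀ t, T ≤ t → Q t = H t := by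
    intro t ht
    rcases ht.eq_or_lt with rfl | ht
    · rw [hQ1 _ le_rfl]; field_simp
    · exact if_neg (not_le.2 ht)
  have hmono : Monotone Q := by
    intro s t hst
    rcases le_total t T with h1 | h1
    · rw [hQ1 t h1, hQ1 s (hst.trans h1)]
      gcongr
    · rcases le_total s T with h2 | h2
      · rw [hQ2 t h1]
        refine le_trans ?_ (hf.neg_log_mono h1)
        rw [hQ1 s h2]
        calc H T / T * s ≤ H T / T * T := by gcongr
          _ = H T := by field_simp
      · rw [hQ2 t h1, hQ2 s h2]
        exact hf.neg_log_mono hst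
  have hstar' : ∀ x y, T ≤ x → x ≤ y → x * H y ≤ y * H x := by
    intro x y hx hxy
    have hx0 : 0 < x := hT0.trans_le hx
    have h1 := (hT x hx).1.1 y hxy
    have h2 : (y / x) ^ (1 - κ) ≤ y / x := by
      conv_rhs => rw [← Real.rpow_one (y / x)]
      exact Real.rpow_le_rpow_of_exponent_le (by rw [le_div_iff₀ hx0]; linarith) (by linarith)
    have h3 : H y ≤ y / x * H x :=
      h1.trans (mul_le_mul_of_nonneg_right h2 (hf.neg_log_nonneg x))
    calc x * H y ≤ x * (y / x * H x) := by gcongr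
      _ = y * H x := by field_simp
  have hlin : ∀ y, T ≤ y → H y ≤ H T / T * y := by
    intro y hy
    have := hstar' T y le_rfl hy
    rw [div_mul_eq_mul_div, le_div_iff₀ hT0]
    linarith
  refine ⟨Q, ⟨?_, hmono, ?_, ⟨H T / T, by positivity, ?_⟩, ?_, fun A => ?_⟩,
    ⟨Real.exp (H T), by positivity, fun x => ?_⟩, ?_⟩
  · have : Continuous fun t => if t ≤ T then H T / T * t else H (max t T) := by
      refine Continuous.if_le (by fun_prop) ?_ continuous_id continuous_const ?_
      · have hc : ContinuousOn H (Set.Ici T) := fun t ht =>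
          (hT t ht).1.2.continuousAt.continuousWithinAt
        exact hc.comp_continuous (by fun_prop) fun x => Set.mem_Ici.2 (le_max_right _ _)
      · intro x hx
        rw [hx, max_self]; field_simp
    convert this using 2 with t
    simp only [Q]
    split_ifs with h1
    · rfl
    · rw [max_eq_left (not_le.1 h1).le]
  · intro x y hx hxy
    rcases le_total y T with h1 | h1
    · rw [hQ1 y h1, hQ1 x (hxy.trans h1)]
      apply le_of_eq; ring
    · rcases le_total x T with h2 | h2
      · rw [hQ2 y h1, hQ1 x h2]
        have := hlin y h1
        nlinarith
      · rw [hQ2 y h1, hQ2 x h2]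
        exact hstar' x y h2 hxy
  · intro x hx
    rcases le_total x T with h1 | h1
    · exact (hQ1 x h1).le
    · rw [hQ2 x h1]; exact hlin x h1
  · rw [hQ1 0 hT0.le, mul_zero]
  · filter_upwards [hf.mul_log_le A, eventually_ge_atTop T] with t ht h1
    rw [hQ2 t h1]; exact ht
  · rcases le_total x T with h1 | h1
    · rw [← Real.exp_add]
      refine (hf.le_one x).trans (Real.one_le_exp ?_)
      have := hmono h1
      rw [hQ2 T le_rfl] at this
      linarith
    · rw [hQ2 x h1, hH]
      simp only [neg_neg]
      rw [Real.exp_log (hf.pos x)]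
      have := Real.one_le_exp hHT
      nlinarith [hf.pos x]
  · filter_upwards [eventually_ge_atTop T] with t ht using hQ2 t ht

lemma Gauge.exp_isLittleO {Q : ℝ → ℝ} (hQ : Gauge Q) {η : ℝ} (hη : 0 < η) (m : ℕ) :
    (fun t => Real.exp (-(η * Q t))) =o[atTop] fun t => (t ^ m)⁻¹ := by
  rw [isLittleO_iff]
  intro c hc
  have hpt := tendsto_inv_atTop_zero (𝕜 := ℝ).eventually (ge_mem_nhds hc)
  filter_upwards [hQ.log ((m + 1) / η), eventually_gt_atTop 0, hpt] with t h1 h2 h3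
  rw [Real.norm_of_nonneg (by positivity), Real.norm_of_nonneg (by positivity)]
  have h4 : Real.exp (-(η * Q t)) ≤ (t ^ (m + 1))⁻¹ := by
    rw [← Real.exp_log (show 0 < (t ^ (m + 1))⁻¹ by positivity), Real.exp_le_exp, Real.log_inv,
      Real.log_pow, neg_le_neg_iff]
    rw [div_mul_eq_mul_div, div_le_iff₀ hη] at h1
    push_cast
    linarith
  calc _ ≤ (t ^ (m + 1))⁻¹ := h4
    _ = t⁻¹ * (t ^ m)⁻¹ := by rw [pow_succ, mul_inv, mul_comm]
    _ ≤ _ := by gcongr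

/-- Gauges are subadditive, also over infinite sums. -/
lemma Gauge.le_tsum {ι : Type*} {Q : ℝ → ℝ} (hQ : Gauge Q) {x : ι → ℝ} (hx : ∀ i, 0 ≤ x i)
    (hs : Summable x) {a : ℝ} (ha : 0 < a) (hle : ∀ i, x i ≤ a) :
    Summable (fun i => Q (x i)) ∧ (∑' i, x i) * (Q a / a) ≤ ∑' i, Q (x i) := by
  obtain ⟨L, hL0, hL⟩ := hQ.lip
  have hsum : Summable (fun i => Q (x i)) :=
    Summable.of_nonneg_of_le (fun i => hQ.nonneg (hx i)) (fun i => hL _ (hx i)) (hs.mul_left L)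
  refine ⟨hsum, ?_⟩
  rw [← tsum_mul_right]
  refine (hs.mul_right _).tsum_le_tsum (fun i => ?_) hsum
  rcases (hx i).eq_or_lt with h0 | h0
  · rw [← h0, zero_mul, hQ.zero]
  · rw [mul_div_assoc', div_le_iff₀ ha]
    linarith [hQ.star _ _ h0 (hle i)]

/-! ### Exponential moments of a gauge of a sum -/

lemma Gauge.exists_pow_le {Q : ℝ → ℝ} (hQ : Gauge Q) {η : ℝ} (hη : 0 < η) (k : ℕ) :
    ∃ M, 0 ≤ M ∧ ∀ z, 0 ≤ z → z ^ k ≤ M * Real.exp (η * Q z) := by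
  obtain ⟨z₀, hz₀⟩ := eventually_atTop.1 ((hQ.log (k / η)).and (eventually_gt_atTop 0))
  have hz0 : 0 < z₀ := (hz₀ z₀ le_rfl).2
  refine ⟨max 1 (z₀ ^ k), by positivity, fun z hz => ?_⟩
  rcases le_total z₀ z with h | h
  · have hz' : 0 < z := by linarith
    have h1 := (hz₀ z h).1
    rw [div_mul_eq_mul_div, div_le_iff₀ hη] at h1
    have h2 : z ^ k ≤ Real.exp (η * Q z) := by
      rw [← Real.log_le_iff_le_exp (by positivity), Real.log_pow]
      linarith
    calc z ^ k ≤ 1 * Real.exp (η * Q z) := by linarith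
      _ ≤ _ := by gcongr; exact le_max_left _ _
  · calc z ^ k ≤ z₀ ^ k * 1 := by rw [mul_one]; gcongr
      _ ≤ max 1 (z₀ ^ k) * Real.exp (η * Q z) := by
        gcongr
        · exact le_max_right _ _
        · exact Real.one_le_exp (mul_nonneg hη.le (hQ.nonneg hz))

section

variable {Ω : Type*} [MeasurableSpace Ω] {P : Measure Ω} [IsProbabilityMeasure P]

lemma Gauge.measurable {Q : ℝ → ℝ} (hQ : Gauge Q) : Measurable Q := hQ.cont.measurable

/-- If the tail of `W` is dominated by `exp (-Q)`, then `exp (γ Q(W))` has a finite expectation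
for every `γ < 1`. -/
lemma Gauge.exists_lintegral_exp_le {Q : ℝ → ℝ} (hQ : Gauge Q) {γ : ℝ} (hγ : 0 < γ)
    (hγ1 : γ < 1) (C : ℝ) :
    ∃ K : ℝ, 0 ≤ K ∧ ∀ W : Ω → ℝ, Measurable W → (∀ ω, 0 ≤ W ω) →
      (∀ z, 0 ≤ z → P.real {ω | z < W ω} ≤ C * Real.exp (-Q z)) →
      ∫⁻ ω, ENNReal.ofReal (Real.exp (γ * Q (W ω))) ∂P ≤ ENNReal.ofReal K := by
  set D := max C 1
  have hD : 0 < D := lt_of_lt_of_le one_pos (le_max_right _ _)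
  let a : ℕ → ℝ := fun n => Real.exp (γ * (n + 1)) * (D * Real.exp (1 - n))
  have ha : ∀ n, a n = D * Real.exp (γ + 1) * Real.exp (γ - 1) ^ n := by
    intro n
    rw [← Real.exp_nat_mul, mul_assoc, ← Real.exp_add]
    simp only [a]
    rw [mul_left_comm, ← Real.exp_add]
    congr 2; ring
  have hasum : Summable a := by
    simp_rw [funext ha]
    refine (summable_geometric_of_lt_one (by positivity) ?_).mul_left _
    rw [Real.exp_lt_one_iff]; linarith
  have ha0 : ∀ n, 0 ≤ a n := fun n => by positivity
  refine ⟨∑' n, a n, tsum_nonneg ha0, fun W hW hW0 htail => ?_⟩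
  have hlevel : ∀ n : ℕ, P {ω | (n : ℝ) ≤ Q (W ω)} ≤ ENNReal.ofReal (D * Real.exp (1 - n)) := by
    intro n
    rw [← ofReal_measureReal]
    refine ENNReal.ofReal_le_ofReal ?_
    rcases n with _ | n
    · refine measureReal_le_one.trans ?_
      have h1 : 1 ≤ D := le_max_right _ _
      have h2 : (1 : ℝ) ≤ Real.exp (1 - (0 : ℕ)) := Real.one_le_exp (by simp)
      nlinarith
    · obtain ⟨z, hz⟩ : ∃ z, 0 ≤ z ∧ Q z = n := by
        obtain ⟨y, hy0, hy⟩ := ((eventually_ge_atTop 0).and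
          (hQ.tendsto.eventually_ge_atTop (n : ℝ))).exists
        have := intermediate_value_Icc hy0 hQ.cont.continuousOn
        obtain ⟨z, hz, hzn⟩ := this ⟨by rw [hQ.zero]; positivity, hy⟩
        exact ⟨z, hz.1, hzn⟩
      calc P.real {ω | ((n + 1 : ℕ) : ℝ) ≤ Q (W ω)} ≤ P.real {ω | z < W ω} := by
            refine measureReal_mono fun ω hω => ?_
            simp only [Set.mem_ofPred_eq] at hω ⊢
            by_contra hcon
            have := hQ.mono (not_lt.1 hcon)
            rw [hz.2] at this
            push_cast at hω
            linarith
        _ ≤ C * Real.exp (-Q z) := htail z hz.1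
        _ ≤ D * Real.exp (1 - (n + 1 : ℕ)) := by
            rw [hz.2]
            push_cast
            rw [show (1 : ℝ) - (n + 1) = -n by ring]
            gcongr
            exact le_max_left _ _
  have hset : ∀ n : ℕ, MeasurableSet {ω | (n : ℝ) ≤ Q (W ω)} := fun n =>
    measurableSet_le measurable_const (hQ.measurable.comp hW)
  calc ∫⁻ ω, ENNReal.ofReal (Real.exp (γ * Q (W ω))) ∂P
      ≤ ∫⁻ ω, ∑' n : ℕ, {ω | (n : ℝ) ≤ Q (W ω)}.indicator
          (fun _ => ENNReal.ofReal (Real.exp (γ * (n + 1)))) ω ∂P := by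
        refine lintegral_mono fun ω => ?_
        refine le_trans ?_ (ENNReal.le_tsum ⌊Q (W ω)⌋₊)
        have hfl := Nat.floor_le (hQ.nonneg (hW0 ω))
        rw [Set.indicator_of_mem (by exact hfl)]
        have := (Nat.lt_floor_add_one (Q (W ω))).le
        gcongr
    _ = ∑' n : ℕ, ∫⁻ ω, {ω | (n : ℝ) ≤ Q (W ω)}.indicator
          (fun _ => ENNReal.ofReal (Real.exp (γ * (n + 1)))) ω ∂P := by
        refine lintegral_tsum fun n => (Measurable.aemeasurable ?_)
        exact measurable_const.indicator (hset n)
    _ ≤ ∑' n : ℕ, ENNReal.ofReal (a n) := by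
        refine ENNReal.tsum_le_tsum fun n => ?_
        rw [lintegral_indicator_const (hset n), ENNReal.ofReal_mul (by positivity)]
        gcongr
        exact hlevel n
    _ = ENNReal.ofReal (∑' n, a n) := (ENNReal.ofReal_tsum_of_nonneg ha0 hasum).symm

/-- The expectation of `exp (γ Q(V))` is at most `1 + K b` when `V` is of scale `b`. -/
lemma Gauge.exists_integral_exp_le {Q : ℝ → ℝ} (hQ : Gauge Q) {γ : ℝ} (hγ : 0 < γ)
    (hγ1 : γ < 1) (C : ℝ) :
    ∃ K : ℝ, 0 ≤ K ∧ ∀ (V : Ω → ℝ) (b : ℝ), Measurable V → (∀ ω, 0 ≤ V ω) → 0 ≤ b → b ≤ 1 →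
      (∀ z, 0 ≤ z → P.real {ω | b * z < V ω} ≤ C * Real.exp (-Q z)) →
      Integrable (fun ω => Real.exp (γ * Q (V ω))) P ∧
      ∫ ω, Real.exp (γ * Q (V ω)) ∂P ≤ 1 + K * b := by
  obtain ⟨L, hL0, hL⟩ := hQ.lip
  set γ' := (1 + γ) / 2 with hγ'
  have hη : 0 < γ' - γ := by rw [hγ']; linarith
  obtain ⟨M, hM0, hM⟩ := hQ.exists_pow_le hη 1
  obtain ⟨K, hK0, hK⟩ := hQ.exists_lintegral_exp_le (P := P) (γ := γ') (by linarith)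
    (by rw [hγ']; linarith) C
  refine ⟨L * M * K, by positivity, fun V b hV hV0 hb0 hb1 htail => ?_⟩
  have hmeas : Measurable fun ω => Real.exp (γ * Q (V ω)) := by
    have := hQ.measurable.comp hV
    exact Real.measurable_exp.comp (this.const_mul γ)
  suffices hbound : ∫⁻ ω, ENNReal.ofReal (Real.exp (γ * Q (V ω))) ∂P
      ≤ ENNReal.ofReal (1 + L * M * K * b) by
    have hint : Integrable (fun ω => Real.exp (γ * Q (V ω))) P := by
      rw [← lintegral_ofReal_ne_top_iff_integrable hmeas.aestronglyMeasurable
        (Eventually.of_forall fun ω => (Real.exp_pos _).le)]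
      exact ne_top_of_le_ne_top ENNReal.ofReal_ne_top hbound
    refine ⟨hint, ?_⟩
    rw [← ENNReal.ofReal_le_ofReal_iff (by positivity), ofReal_integral_eq_lintegral_ofReal hint
      (Eventually.of_forall fun ω => (Real.exp_pos _).le)]
    exact hbound
  rcases hb0.eq_or_lt with rfl | hb
  · have hzero : ∀ᵐ ω ∂P, V ω = 0 := by
      have h1 : P.real {ω | 0 < V ω} = 0 := by
        refine le_antisymm ?_ measureReal_nonneg
        have hlim : Tendsto (fun z => C * Real.exp (-Q z)) atTop (𝓝 0) := by
          simpa using (Real.tendsto_exp_neg_atTop_nhds_zero.comp hQ.tendsto).const_mul C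
        refine ge_of_tendsto hlim ?_
        filter_upwards [eventually_ge_atTop 0] with z hz
        simpa using htail z hz
      rw [measureReal_eq_zero_iff] at h1
      rw [ae_iff]
      refine measure_mono_null (fun ω hω => ?_) h1
      exact lt_of_le_of_ne (hV0 ω) (Ne.symm hω)
    have : ∫⁻ ω, ENNReal.ofReal (Real.exp (γ * Q (V ω))) ∂P = ∫⁻ ω, 1 ∂P := by
      refine lintegral_congr_ae ?_
      filter_upwards [hzero] with ω hω
      simp [hω, hQ.zero]
    rw [this]; simp
  · have hWtail := hK (fun ω => V ω / b) (hV.div_const b) (fun ω => div_nonneg (hV0 ω) hb0)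
      (fun z hz => by
        refine le_trans (le_of_eq ?_) (htail z hz)
        congr 1
        ext ω
        simp only [Set.mem_ofPred_eq]
        rw [lt_div_iff₀ hb, mul_comm])
    have hpt : ∀ ω, Real.exp (γ * Q (V ω)) ≤
        1 + L * M * b * Real.exp (γ' * Q (V ω / b)) := by
      intro ω
      set Z := V ω / b with hZ
      have hZ0 : 0 ≤ Z := div_nonneg (hV0 ω) hb0
      have hVZ : V ω = b * Z := by rw [hZ]; field_simp
      have hle : Q (V ω) ≤ Q Z := hQ.mono (by rw [hVZ]; nlinarith)
      have h0 : 0 ≤ Q (V ω) := hQ.nonneg (hV0 ω)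
      have h1 : Q (V ω) ≤ L * (b * Z) := hVZ ▸ hL _ (hV0 ω)
      have h2 : Real.exp (γ * Q (V ω)) ≤ 1 + γ * Q (V ω) * Real.exp (γ * Q (V ω)) := by
        have h3 := Real.add_one_le_exp (-(γ * Q (V ω)))
        have h4 : Real.exp (-(γ * Q (V ω))) * Real.exp (γ * Q (V ω)) = 1 := by
          rw [← Real.exp_add]; simp
        nlinarith [Real.exp_pos (γ * Q (V ω))]
      have h5 : Z ≤ M * Real.exp ((γ' - γ) * Q Z) := by simpa using hM Z hZ0
      calc Real.exp (γ * Q (V ω)) ≤ 1 + γ * Q (V ω) * Real.exp (γ * Q (V ω)) := h2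
        _ ≤ 1 + 1 * (L * (b * Z)) * Real.exp (γ * Q Z) := by gcongr
        _ ≤ 1 + 1 * (L * (b * (M * Real.exp ((γ' - γ) * Q Z)))) * Real.exp (γ * Q Z) := by
          gcongr
        _ = 1 + L * M * b * (Real.exp ((γ' - γ) * Q Z) * Real.exp (γ * Q Z)) := by ring
        _ = _ := by rw [← Real.exp_add]; congr 3; ring
    calc ∫⁻ ω, ENNReal.ofReal (Real.exp (γ * Q (V ω))) ∂P
        ≤ ∫⁻ ω, (1 + ENNReal.ofReal (L * M * b) *
            ENNReal.ofReal (Real.exp (γ' * Q (V ω / b)))) ∂P := by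
          refine lintegral_mono fun ω => ?_
          rw [← ENNReal.ofReal_mul (by positivity), ← ENNReal.ofReal_one,
            ← ENNReal.ofReal_add zero_le_one (by positivity)]
          exact ENNReal.ofReal_le_ofReal (hpt ω)
      _ = 1 + ENNReal.ofReal (L * M * b) *
            ∫⁻ ω, ENNReal.ofReal (Real.exp (γ' * Q (V ω / b))) ∂P := by
          rw [lintegral_add_left measurable_const, lintegral_const_mul']
          · simp
          · exact ENNReal.ofReal_ne_top
      _ ≤ 1 + ENNReal.ofReal (L * M * b) * ENNReal.ofReal K := by gcongr
      _ = ENNReal.ofReal (1 + L * M * K * b) := by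
          rw [← ENNReal.ofReal_mul (by positivity), ← ENNReal.ofReal_one,
            ← ENNReal.ofReal_add zero_le_one (by positivity)]
          congr 1; ring

/-- For independent `V i` of scales `b i`, with a finite sum of scales, the gauges of the `V i`
have a sum with finite exponential moments of order less than one. -/
lemma Gauge.integrable_exp_tsum {ι : Type*} [Countable ι] {Q : ℝ → ℝ} (hQ : Gauge Q) {γ : ℝ}
    (hγ : 0 < γ) (hγ1 : γ < 1) {C : ℝ} {V : ι → Ω → ℝ} {b : ι → ℝ} (hV : ∀ i, Measurable (V i))
    (hind : iIndepFun V P) (hV0 : ∀ i ω, 0 ≤ V i ω) (hb0 : ∀ i, 0 ≤ b i) (hb1 : ∀ i, b i ≤ 1)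
    (hb : Summable b) (hsum : ∀ᵐ ω ∂P, Summable fun i => V i ω)
    (htail : ∀ i z, 0 ≤ z → P.real {ω | b i * z < V i ω} ≤ C * Real.exp (-Q z)) :
    Integrable (fun ω => Real.exp (γ * ∑' i, Q (V i ω))) P := by
  obtain ⟨K, hK0, hK⟩ := hQ.exists_integral_exp_le (P := P) hγ hγ1 C
  obtain ⟨L, hL0, hL⟩ := hQ.lip
  have hK' := fun i => hK (V i) (b i) (hV i) (hV0 i) (hb0 i) (hb1 i) (htail i)
  have hQV : ∀ i, Measurable fun ω => Q (V i ω) := fun i => hQ.measurable.comp (hV i)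
  have hindQ : iIndepFun (fun i ω => Q (V i ω)) P := hind.comp (fun _ => Q) fun _ => hQ.measurable
  have hfin : ∀ s : Finset ι, ∫⁻ ω, ENNReal.ofReal (Real.exp (γ * ∑ i ∈ s, Q (V i ω))) ∂P
      ≤ ENNReal.ofReal (Real.exp (K * ∑' i, b i)) := by
    intro s
    have hint := hindQ.integrable_exp_mul_sum hQV (s := s) (t := γ) (fun i _ => (hK' i).1)
    have hmgf := hindQ.mgf_sum hQV s (t := γ)
    simp only [Finset.sum_apply] at hint
    rw [← ofReal_integral_eq_lintegral_ofReal hint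
      (Eventually.of_forall fun ω => (Real.exp_pos _).le)]
    refine ENNReal.ofReal_le_ofReal ?_
    have h1 : ∫ ω, Real.exp (γ * ∑ i ∈ s, Q (V i ω)) ∂P
        = ∏ i ∈ s, ∫ ω, Real.exp (γ * Q (V i ω)) ∂P := by
      have h2 := hmgf
      simp only [mgf, Finset.sum_apply] at h2
      exact h2
    rw [h1]
    calc ∏ i ∈ s, ∫ ω, Real.exp (γ * Q (V i ω)) ∂P
        ≤ ∏ i ∈ s, Real.exp (K * b i) := by
          refine Finset.prod_le_prod (fun i _ => integral_nonneg fun ω => (Real.exp_pos _).le)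
            fun i _ => (hK' i).2.trans ?_
          linarith [Real.add_one_le_exp (K * b i)]
      _ = Real.exp (K * ∑ i ∈ s, b i) := by rw [← Real.exp_sum, Finset.mul_sum]
      _ ≤ _ := by
          gcongr
          exact hb.sum_le_tsum s fun i _ => hb0 i
  have hmeas : Measurable fun ω => Real.exp (γ * ∑' i, Q (V i ω)) :=
    Real.measurable_exp.comp ((Measurable.tsum hQV).const_mul γ)
  rw [← lintegral_ofReal_ne_top_iff_integrable hmeas.aestronglyMeasurable
    (Eventually.of_forall fun ω => (Real.exp_pos _).le)]
  refine ne_top_of_le_ne_top (ENNReal.ofReal_ne_top (r := Real.exp (K * ∑' i, b i))) ?_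
  calc ∫⁻ ω, ENNReal.ofReal (Real.exp (γ * ∑' i, Q (V i ω))) ∂P
      = ∫⁻ ω, liminf (fun s : Finset ι => ENNReal.ofReal (Real.exp (γ * ∑ i ∈ s, Q (V i ω))))
          atTop ∂P := by
        refine lintegral_congr_ae ?_
        filter_upwards [hsum] with ω hω
        have hs : Summable fun i => Q (V i ω) :=
          Summable.of_nonneg_of_le (fun i => hQ.nonneg (hV0 i ω)) (fun i => hL _ (hV0 i ω))
            (hω.mul_left L)
        refine (Tendsto.liminf_eq ?_).symm
        have := hs.hasSum.const_mul γ
        exact ENNReal.tendsto_ofReal ((Real.continuous_exp.tendsto _).comp this)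
    _ ≤ liminf (fun s : Finset ι =>
          ∫⁻ ω, ENNReal.ofReal (Real.exp (γ * ∑ i ∈ s, Q (V i ω))) ∂P) atTop := by
        refine lintegral_liminf_le fun s => ?_
        exact (Real.measurable_exp.comp
          ((Finset.measurable_fun_sum s fun i _ => hQV i).const_mul γ)).ennreal_ofReal
    _ ≤ _ := by
        refine liminf_le_of_le (by isBoundedDefault) fun c hc => ?_
        obtain ⟨s, hs⟩ := hc.exists
        exact hs.trans (hfin s)

end

/-! ### Comparisons for regular tails -/

lemma RegularTail.exp_neg_gauge {n : ℕ} {f h Q : ℝ → ℝ} (hf : RegularTail n f h)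
    (hQf : ∀ᶠ t in atTop, Q t = -Real.log (f t)) :
    ∀ᶠ t in atTop, Real.exp (-Q t) = f t := by
  filter_upwards [hQf] with t ht
  rw [ht, neg_neg, Real.exp_log (hf.pos t)]

lemma RegularTail.eventually_one_le_mul {n : ℕ} {f h : ℝ → ℝ} (hf : RegularTail n f h) (A : ℝ) :
    ∀ᶠ t in atTop, A ≤ t * h t := by
  filter_upwards [eventually_mul_log_le hf.hazard_log hf.hazard_pos 1,
    Real.tendsto_log_atTop.eventually_ge_atTop A] with t h1 h2
  linarith

lemma RegularTail.eventually_le_div_mul {n : ℕ} {f h : ℝ → ℝ} (hf : RegularTail n f h) :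
    ∀ᶠ x in atTop, ∀ y, x ≤ y → f y ≤ x / y * f x := by
  filter_upwards [eventually_forall_ge_atTop.2 (hf.eventually_one_le_mul 1),
    eventually_forall_ge_atTop.2 hf.hasDerivAt_neg_log, eventually_gt_atTop 0]
    with x hx hs hx0 y hxy
  rcases hxy.eq_or_lt with rfl | hlt
  · rw [div_self hx0.ne', one_mul]
  have hy0 : 0 < y := by linarith
  obtain ⟨ξ, hξ, he⟩ := exists_ratio_hasDerivAt_eq_ratio_slope (fun s => -Real.log (f s)) h hlt
    (fun s hs' => (hs s hs'.1).continuousAt.continuousWithinAt) (fun s hs' => hs s hs'.1.le)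
    Real.log (fun s => s⁻¹)
    (fun s hs' => (Real.continuousAt_log (by linarith [hs'.1])).continuousWithinAt)
    (fun s hs' => Real.hasDerivAt_log (by linarith [hs'.1]))
  have hξ0 : 0 < ξ := by linarith [hξ.1]
  rw [← div_eq_mul_inv, eq_div_iff hξ0.ne'] at he
  have h1 := hx ξ hξ.1.le
  have h2 : 0 ≤ Real.log y - Real.log x := by
    linarith [Real.log_le_log hx0 hlt.le]
  have h3 : Real.log y - Real.log x ≤ -Real.log (f y) - -Real.log (f x) := by
    rw [← he]; nlinarith
  have h4 : 0 < x / y * f x := mul_pos (by positivity) (hf.pos x)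
  rw [← Real.log_le_log_iff (hf.pos y) h4, Real.log_mul (by positivity) (hf.pos x).ne',
    Real.log_div hx0.ne' hy0.ne']
  linarith

/-- The gain in moving the argument of the tail by `δ t` is compensated by the probability of a
deviation of order `ε t`, when `δ` is small compared to `ε`. -/
lemma RegularTail.exists_shift_le {n : ℕ} {f h Q : ℝ → ℝ} (hf : RegularTail n f h)
    (hQ : Gauge Q) (hQf : ∀ᶠ t in atTop, Q t = -Real.log (f t)) {ε : ℝ} (hε : 0 < ε)
    (hε1 : ε ≤ 1) :
    ∃ δ₀, 0 < δ₀ ∧ ∀ δ, 0 < δ → δ ≤ δ₀ → ∀ᶠ t in atTop,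
      f ((1 - δ) * t) * Real.exp (-(1 / 2 * Q (ε * t))) ≤
        f t * Real.exp (-(ε / 4 * Q t)) := by
  obtain ⟨ρ, -, hrv⟩ := hf.hazard_regVar
  obtain ⟨C₁, hC₁, hb₁⟩ := hrv.exists_bound 2
  obtain ⟨C₂, hC₂, hb₂⟩ := hrv.exists_bound ε⁻¹
  obtain ⟨κ, hκ0, hκ1, hκ⟩ := hf.exists_mul_hazard_le
  refine ⟨min (1 / 2) (ε / (4 * C₁ * C₂)), by positivity, fun δ hδ hδ₀ => ?_⟩
  have hδ2 : δ ≤ 1 / 2 := hδ₀.trans (min_le_left _ _)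
  have hδC : δ * (C₁ * C₂) ≤ ε / 4 := by
    have := hδ₀.trans (min_le_right _ _)
    rw [le_div_iff₀ (by positivity)] at this
    linarith
  have hεt : Tendsto (fun t => ε * t) atTop atTop := tendsto_id.const_mul_atTop hε
  have hδt : Tendsto (fun t => (1 - δ) * t) atTop atTop :=
    tendsto_id.const_mul_atTop (by linarith)
  filter_upwards [hδt.eventually hf.exists_slope,
    hδt.eventually (eventually_forall_ge_atTop.2 hb₁), hεt.eventually hb₂,
    hεt.eventually hκ, hεt.eventually hQf, hεt.eventually hf.hazard_pos, hQf,
    eventually_gt_atTop 0] with t h1 h2 h3 h4 h5 h6 h7 ht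
  obtain ⟨ξ, hξ, he⟩ := h1 t (by nlinarith)
  have hξ1 := (h2 ξ hξ.1.le t ⟨hξ.2.le, by nlinarith [hξ.1]⟩).2
  have hεt2 := (h3 t ⟨by nlinarith, by field_simp; exact le_rfl⟩).1
  have h8 : h ξ ≤ C₁ * (C₂ * h (ε * t)) := hξ1.trans (by gcongr)
  have h9 : h ξ * (t - (1 - δ) * t) ≤ Q (ε * t) / 4 := by
    calc h ξ * (t - (1 - δ) * t) = δ * t * h ξ := by ring
      _ ≤ δ * t * (C₁ * (C₂ * h (ε * t))) := by gcongr
      _ = δ * (C₁ * C₂) * (t * h (ε * t)) := by ring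
      _ ≤ ε / 4 * (t * h (ε * t)) := by gcongr
      _ = (ε * t * h (ε * t)) / 4 := by ring
      _ ≤ ((1 - κ) * -Real.log (f (ε * t))) / 4 := by linarith
      _ ≤ Q (ε * t) / 4 := by
        rw [h5]
        have := hf.neg_log_nonneg (ε * t)
        nlinarith
  have h10 : ε * Q t ≤ Q (ε * t) := by
    have := hQ.star (ε * t) t (by positivity) (by nlinarith)
    have h11 : t * (ε * Q t) ≤ t * Q (ε * t) := by linarith
    exact le_of_mul_le_mul_left h11 ht
  rw [← Real.exp_log (hf.pos ((1 - δ) * t)), ← Real.exp_log (hf.pos t), ← Real.exp_add,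
    ← Real.exp_add, Real.exp_le_exp]
  linarith

lemma RegularTail.sq_le {n : ℕ} {f h Q : ℝ → ℝ} (hf : RegularTail n f h)
    (hQ : Gauge Q) (hQf : ∀ᶠ t in atTop, Q t = -Real.log (f t)) {ε : ℝ} (hε : 0 < ε)
    (hε1 : ε ≤ 1 / 4) :
    ∀ᶠ t in atTop, f ((1 - ε) * t) ^ 2 ≤ f t * Real.exp (-(1 / 2 * Q t)) := by
  have hδt : Tendsto (fun t => (1 - ε) * t) atTop atTop :=
    tendsto_id.const_mul_atTop (by linarith)
  filter_upwards [hf.exp_neg_gauge hQf, hδt.eventually (hf.exp_neg_gauge hQf),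
    eventually_gt_atTop 0] with t h1 h2 ht
  have hs := hQ.star ((1 - ε) * t) t (mul_pos (by linarith) ht) (by nlinarith)
  have h3 : (1 - ε) * Q t ≤ Q ((1 - ε) * t) := by
    refine le_of_mul_le_mul_left (a := t) ?_ ht
    linarith
  have h4 := hQ.nonneg ht.le
  rw [← h1, ← h2, ← Real.exp_nat_mul, ← Real.exp_add, Real.exp_le_exp]
  push_cast
  nlinarith

/-- With all jumps below `(1 - δ) t`, exceeding `t` is exponentially unlikely on a scale larger
than the cumulative hazard at `t`. -/
lemma RegularTail.exists_truncated_le {n : ℕ} {f h Q : ℝ → ℝ} (hf : RegularTail n f h)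
    (hQf : ∀ᶠ t in atTop, Q t = -Real.log (f t)) {δ : ℝ} (hδ : 0 < δ) (hδ1 : δ < 1) :
    ∃ γ η : ℝ, 0 < γ ∧ γ < 1 ∧ 0 < η ∧ ∀ᶠ t in atTop,
      Real.exp (-(γ * (t * (Q ((1 - δ) * t) / ((1 - δ) * t))))) ≤
        f t * Real.exp (-(η * Q t)) := by
  obtain ⟨κ, hκ0, hκ1, hκ⟩ := hf.exists_growth
  have hδ' : 0 < 1 - δ := by linarith
  set u : ℝ := (1 - δ)⁻¹ with hu
  have hu1 : 1 < u := (one_lt_inv₀ hδ').2 (by linarith)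
  set ν : ℝ := u ^ κ with hν
  have hν1 : 1 < ν := Real.one_lt_rpow hu1 hκ0
  refine ⟨(1 + ν) / (2 * ν), (ν - 1) / 2, by positivity, ?_, by linarith, ?_⟩
  · rw [div_lt_one (by positivity)]; linarith
  have hδt : Tendsto (fun t => (1 - δ) * t) atTop atTop := tendsto_id.const_mul_atTop hδ'
  filter_upwards [hδt.eventually hκ, hδt.eventually hQf, hQf, hf.exp_neg_gauge hQf,
    eventually_gt_atTop 0] with t h1 h2 h3 h4 ht
  have h5 := h1 t (by nlinarith)
  rw [← h3, ← h2] at h5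
  have h6 : t / ((1 - δ) * t) = u := by rw [hu]; field_simp
  rw [h6, Real.rpow_sub (by positivity), Real.rpow_one, ← hν, div_mul_eq_mul_div,
    le_div_iff₀ (by positivity)] at h5
  have h7 : t * (Q ((1 - δ) * t) / ((1 - δ) * t)) = u * Q ((1 - δ) * t) := by
    rw [← h6]; ring
  rw [h7, ← h4, ← Real.exp_add, Real.exp_le_exp]
  have h8 : (1 + ν) / (2 * ν) * (u * Q ((1 - δ) * t)) ≥ (1 + ν) / (2 * ν) * (Q t * ν) := by
    gcongr
  have h9 : (1 + ν) / (2 * ν) * (Q t * ν) = (1 + (ν - 1) / 2) * Q t := by field_simp; ring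
  rw [h9] at h8
  linarith

/-! ### Sums of independent variables: one big jump -/

/-- The sum of the family without its `i`-th member. -/
def restSum {Ω ι : Type*} [DecidableEq ι] (U : ι → Ω → ℝ) (i : ι) (ω : Ω) : ℝ :=
  ∑' j, if j = i then 0 else U j ω

section

variable {Ω ι : Type*} [MeasurableSpace Ω] {P : Measure Ω}

lemma measurable_restSum [Countable ι] [DecidableEq ι] {U : ι → Ω → ℝ} {i : ι}
    (hU : ∀ j ≠ i, Measurable (U j)) : Measurable (restSum U i) := by
  refine Measurable.tsum fun j => ?_
  split_ifs with hj
  · exact measurable_const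
  · exact hU j hj

lemma indepFun_restSum [Countable ι] [DecidableEq ι] {U : ι → Ω → ℝ}
    (hU : ∀ i, Measurable (U i)) (hind : iIndepFun U P) (i : ι) :
    IndepFun (U i) (restSum U i) P := by
  have h1 := indep_iSup_of_disjoint (fun j => (hU j).comap_le) hind.iIndep
    (S := {i}) (T := {i}ᶜ) disjoint_compl_right
  rw [IndepFun_iff_Indep]
  refine indep_of_indep_of_le_right (indep_of_indep_of_le_left h1 ?_) ?_
  · simp
  · rw [← measurable_iff_comap_le]
    refine @measurable_restSum Ω ι (_) _ _ U i fun j hj => ?_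
    refine Measurable.mono (comap_measurable (U j)) ?_ le_rfl
    exact le_iSup₂ (f := fun k (_ : k ∈ ({i}ᶜ : Set ι)) => MeasurableSpace.comap (U k) _) j
      (by simpa using hj)

/-- Independent variables `U i` with tails dominated by the tail `f`, up to the scale `b i ≤ 1`,
with a summable sequence of scales. -/
structure JumpFamily (P : Measure Ω) (f : ℝ → ℝ) (U : ι → Ω → ℝ) (b : ι → ℝ) (C : ℝ) :
    Prop where
  meas : ∀ i, Measurable (U i)
  indep : iIndepFun U P
  ae_summable : ∀ᵐ ω ∂P, Summable fun i => U i ω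
  nonneg : ∀ i, 0 ≤ b i
  le_one : ∀ i, b i ≤ 1
  summable : Summable b
  const_pos : 0 < C
  tail : ∀ i z, 0 ≤ z → P.real {ω | b i * z < U i ω} ≤ C * f z

lemma JumpFamily.integrable_exp [Countable ι] [IsProbabilityMeasure P] {f Q : ℝ → ℝ} {U : ι → Ω → ℝ}
    {b : ι → ℝ} {C C' : ℝ} (hJ : JumpFamily P f U b C) (hQ : Gauge Q)
    (hfQ : ∀ x, f x ≤ C' * Real.exp (-Q x)) {γ : ℝ} (hγ : 0 < γ) (hγ1 : γ < 1) :
    Integrable (fun ω => Real.exp (γ * ∑' i, Q (max (U i ω) 0))) P := by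
  refine hQ.integrable_exp_tsum hγ hγ1 (C := C * C') (V := fun i ω => max (U i ω) 0) (b := b)
    (fun i => (hJ.meas i).max measurable_const) ?_ (fun i ω => le_max_right _ _) hJ.nonneg
    hJ.le_one hJ.summable ?_ fun i z hz => ?_
  · exact hJ.indep.comp (fun _ x => max x 0) fun _ => measurable_id.max measurable_const
  · filter_upwards [hJ.ae_summable] with ω hω
    refine Summable.of_nonneg_of_le (fun i => le_max_right _ _) (fun i => ?_) hω.abs
    exact max_le (le_abs_self _) (abs_nonneg _)
  · have hset : {ω | b i * z < max (U i ω) 0} = {ω | b i * z < U i ω} := by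
      ext ω
      have : 0 ≤ b i * z := mul_nonneg (hJ.nonneg i) hz
      simp [not_lt.2 this]
    rw [hset, mul_assoc]
    exact (hJ.tail i z hz).trans (mul_le_mul_of_nonneg_left (hfQ z) hJ.const_pos.le)

lemma Gauge.map_tsum_le {Q : ℝ → ℝ} (hQ : Gauge Q) {x : ι → ℝ} (hx : ∀ i, 0 ≤ x i)
    (hs : Summable x) : Q (∑' i, x i) ≤ ∑' i, Q (x i) := by
  rcases (tsum_nonneg hx).eq_or_lt with h0 | h0
  · rw [← h0, hQ.zero]
    exact tsum_nonneg fun i => hQ.nonneg (hx i)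
  · have := (hQ.le_tsum hx hs h0 fun i => hs.le_tsum i fun j _ => hx j).2
    rwa [mul_div_cancel₀ _ h0.ne'] at this

lemma JumpFamily.integrable_exp_restSum [Countable ι] [DecidableEq ι]
    [IsProbabilityMeasure P] {f Q : ℝ → ℝ} {U : ι → Ω → ℝ}
    {b : ι → ℝ} {C C' : ℝ} (hJ : JumpFamily P f U b C) (hQ : Gauge Q)
    (hfQ : ∀ x, f x ≤ C' * Real.exp (-Q x)) {γ : ℝ} (hγ : 0 < γ) (hγ1 : γ < 1) (i : ι) :
    Integrable (fun ω => Real.exp (γ * Q (max (restSum U i ω) 0))) P := by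
  refine (hJ.integrable_exp hQ hfQ hγ hγ1).mono' ?_ ?_
  · have h1 := (measurable_restSum fun j (_ : j ≠ i) => hJ.meas j).max
      (measurable_const (a := (0 : ℝ)))
    exact (Real.measurable_exp.comp ((hQ.measurable.comp h1).const_mul γ)).aestronglyMeasurable
  · filter_upwards [hJ.ae_summable] with ω hω
    rw [Real.norm_of_nonneg (Real.exp_pos _).le]
    have hV : Summable fun j => max (U j ω) 0 :=
      Summable.of_nonneg_of_le (fun j => le_max_right _ _)
        (fun j => max_le (le_abs_self _) (abs_nonneg _)) hω.abs
    have hle : restSum U i ω ≤ ∑' j, max (U j ω) 0 := by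
      refine Summable.tsum_le_tsum (fun j => ?_) ?_ hV
      · split_ifs
        · exact le_max_right _ _
        · exact le_max_left _ _
      · refine Summable.of_norm_bounded hω.abs fun j => ?_
        split_ifs
        · simp
        · exact le_rfl
    have h0 : 0 ≤ ∑' j, max (U j ω) 0 := tsum_nonneg fun j => le_max_right _ _
    gcongr
    exact (hQ.mono (max_le hle h0)).trans (hQ.map_tsum_le (fun j => le_max_right _ _) hV)

lemma exp_markov [IsProbabilityMeasure P] {γ : ℝ} {Y : Ω → ℝ} (hγ : 0 < γ)
    (hY : Integrable (fun ω => Real.exp (γ * Y ω)) P) (y : ℝ) :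
    P.real {ω | y ≤ Y ω} ≤ (∫ ω, Real.exp (γ * Y ω) ∂P) * Real.exp (-(γ * y)) := by
  have h1 := mul_meas_ge_le_integral_of_nonneg
    (Eventually.of_forall fun ω => (Real.exp_pos (γ * Y ω)).le) hY (Real.exp (γ * y))
  have h2 : {ω | Real.exp (γ * y) ≤ Real.exp (γ * Y ω)} = {ω | y ≤ Y ω} := by
    ext ω; simp [hγ]
  rw [h2] at h1
  rw [Real.exp_neg, ← div_eq_mul_inv, le_div_iff₀ (Real.exp_pos _)]
  linarith

lemma sum_measureReal_le [DecidableEq ι] [IsProbabilityMeasure P] {A : ι → Set Ω}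
    (hA : ∀ i, MeasurableSet (A i))
    {d : ℝ} (s : Finset ι)
    (hd : ∀ i ∈ s, ∀ j ∈ s, i ≠ j → P.real (A i ∩ A j) ≤ d) :
    ∑ i ∈ s, P.real (A i) ≤ P.real (⋃ i ∈ s, A i) + s.card * s.card * |d| := by
  induction s using Finset.induction_on with
  | empty => simp
  | insert k s hk ih =>
    rw [Finset.sum_insert hk, Finset.set_biUnion_insert, Finset.card_insert_of_notMem hk]
    have ih' := ih fun i hi j hj hij =>
      hd i (Finset.mem_insert_of_mem hi) j (Finset.mem_insert_of_mem hj) hij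
    have h1 := measureReal_union_add_inter (μ := P) (s := A k) (t := ⋃ i ∈ s, A i)
      (Finset.measurableSet_biUnion s fun i _ => hA i) (measure_ne_top _ _) (measure_ne_top _ _)
    have h2 : P.real (A k ∩ ⋃ i ∈ s, A i) ≤ s.card * |d| := by
      rw [Set.inter_iUnion₂]
      refine (measureReal_biUnion_finset_le s _).trans ?_
      refine (Finset.sum_le_card_nsmul s _ |d| fun i hi => ?_).trans (by simp)
      exact (hd k (Finset.mem_insert_self _ _) i (Finset.mem_insert_of_mem hi)
        (fun h => hk (h ▸ hi))).trans (le_abs_self d)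
    push_cast
    nlinarith [abs_nonneg d]

/-- The principle of one big jump: the sum exceeds `t` mainly because a single one of the largest
variables is large, the other variables having a sum at most `ε t`. -/
lemma JumpFamily.one_big_jump [Countable ι] [DecidableEq ι] [IsProbabilityMeasure P]
    {n : ℕ} {f h : ℝ → ℝ} {U : ι → Ω → ℝ} {b : ι → ℝ} {C : ℝ} (hJ : JumpFamily P f U b C)
    (hf : RegularTail n f h)
    (I : Finset ι) {β : ℝ} (hβ0 : 0 < β) (hβ1 : β < 1) (hβ : ∀ i ∉ I, b i ≤ β) {ε : ℝ}
    (hε : 0 < ε) (hε1 : ε ≤ 1 / 4) (m : ℕ) :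
    (fun t => P.real {ω | t < ∑' i, U i ω} -
      ∑ i ∈ I, P.real {ω | t < U i ω + restSum U i ω ∧ restSum U i ω ≤ ε * t})
      =o[atTop] fun t => f t / t ^ m := by
  obtain ⟨Q, hQ, ⟨C', hC', hfQ⟩, hQf⟩ := hf.exists_gauge
  obtain ⟨δ₀, hδ₀, hshift⟩ := hf.exists_shift_le hQ hQf hε (by linarith)
  set δ := min δ₀ ((1 - β) / 2) with hδdef
  have hδ : 0 < δ := lt_min hδ₀ (by linarith)
  have hδβ : δ ≤ (1 - β) / 2 := min_le_right _ _
  have hδ1 : δ < 1 := by linarith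
  obtain ⟨γ, η, hγ, hγ1, hη, htrunc⟩ := hf.exists_truncated_le hQf hδ hδ1
  set l := (1 + β) / (2 * β) with hl
  have hl1 : 1 < l := by rw [hl, lt_div_iff₀ (by positivity)]; linarith
  set K₁ := ∫ ω, Real.exp (γ * ∑' i, Q (max (U i ω) 0)) ∂P
  set K₂ : ι → ℝ := fun i => ∫ ω, Real.exp (1 / 2 * Q (max (restSum U i ω) 0)) ∂P
  have hK₂ : ∀ i, 0 ≤ K₂ i := fun i => integral_nonneg fun ω => (Real.exp_pos _).le
  have hmeasR := fun i => measurable_restSum fun j (_ : j ≠ i) => hJ.meas j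
  have hsplit : ∀ᵐ ω ∂P, ∀ i, ∑' j, U j ω = U i ω + restSum U i ω := by
    filter_upwards [hJ.ae_summable] with ω hω i
    exact hω.tsum_eq_add_tsum_ite i
  have hUtail : ∀ i, ∀ a, 0 ≤ a → P.real {ω | a < U i ω} ≤ C * f a := by
    intro i a ha
    refine le_trans (measureReal_mono fun ω hω => ?_) (hJ.tail i a ha)
    simp only [Set.mem_ofPred_eq] at hω ⊢
    nlinarith [hJ.le_one i]
  -- two simultaneous jumps
  let E₀ : ℝ → ℝ := fun t => I.card * I.card * (C ^ 2 * (f t * Real.exp (-(1 / 2 * Q t))))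
  -- a jump compensated by the remaining sum
  let E₁ : ℝ → ℝ := fun t => ∑ i ∈ I, C * K₂ i * (f t * Real.exp (-(ε / 4 * Q t)))
  -- a jump of a variable of smaller scale
  let E₂ : ℝ → ℝ := fun t => C / β * (∑' i, b i) * f (l * t)
  -- no jump at all
  let E₃ : ℝ → ℝ := fun t => K₁ * (f t * Real.exp (-(η * Q t)))
  have hexp : ∀ η' : ℝ, 0 < η' → (fun t => f t * Real.exp (-(η' * Q t)))
      =o[atTop] fun t => f t / t ^ m := fun η' hη' => by
    simp_rw [div_eq_mul_inv]
    exact (isBigO_refl f atTop).mul_isLittleO (hQ.exp_isLittleO hη' m)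
  have hE₀ : E₀ =o[atTop] fun t => f t / t ^ m :=
    ((hexp _ (by norm_num)).const_mul_left _).const_mul_left _
  have hE₁ : E₁ =o[atTop] fun t => f t / t ^ m :=
    (IsLittleO.sum (s := I) fun i _ => (hexp (ε / 4) (by positivity)).const_mul_left
      (C * K₂ i)).congr_left fun t => by simp [E₁]
  have hE₂ : E₂ =o[atTop] fun t => f t / t ^ m := (hf.scale_isLittleO m hl1).const_mul_left _
  have hE₃ : E₃ =o[atTop] fun t => f t / t ^ m := (hexp _ hη).const_mul_left _
  refine IsBigO.trans_isLittleO (g := fun t => |E₀ t| + |E₁ t| + |E₂ t| + |E₃ t|) ?_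
    (((hE₀.abs_left.add hE₁.abs_left).add hE₂.abs_left).add hE₃.abs_left)
  refine IsBigO.of_bound 1 ?_
  have hlt : Tendsto (fun t => l * t) atTop atTop := tendsto_id.const_mul_atTop (by linarith)
  filter_upwards [eventually_gt_atTop 0, hf.sq_le hQ hQf hε hε1,
    hshift δ hδ (min_le_left _ _), htrunc, hlt.eventually hf.eventually_le_div_mul]
    with t ht hsq hsh htr hdiv
  set a := (1 - δ) * t with ha
  have ha0 : 0 < a := mul_pos (by linarith) ht
  set A : ι → Set Ω := fun i => {ω | t < U i ω + restSum U i ω ∧ restSum U i ω ≤ ε * t} with hA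
  have hAm : ∀ i, MeasurableSet (A i) := fun i =>
    (measurableSet_lt measurable_const ((hJ.meas i).add (hmeasR i))).inter
      (measurableSet_le (hmeasR i) measurable_const)
  have hlower : ∑ i ∈ I, P.real (A i) ≤ P.real {ω | t < ∑' i, U i ω} + |E₀ t| := by
    have h1 := sum_measureReal_le (P := P) hAm (d := C ^ 2 * (f t * Real.exp (-(1 / 2 * Q t)))) I
      (fun i _ j _ hij => by
        have hind := hJ.indep.indepFun hij
        have h2 := hind.measure_inter_preimage_eq_mul (Set.Ioi ((1 - ε) * t))
          (Set.Ioi ((1 - ε) * t)) measurableSet_Ioi measurableSet_Ioi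
        have h3 : 0 ≤ (1 - ε) * t := mul_nonneg (by linarith) ht.le
        calc P.real (A i ∩ A j)
            ≤ P.real (U i ⁻¹' Set.Ioi ((1 - ε) * t) ∩ U j ⁻¹' Set.Ioi ((1 - ε) * t)) := by
              refine measureReal_mono fun ω hω => ?_
              obtain ⟨⟨hi1, hi2⟩, hj1, hj2⟩ := hω
              exact ⟨by simp only [Set.mem_preimage, Set.mem_Ioi]; linarith,
                by simp only [Set.mem_preimage, Set.mem_Ioi]; linarith⟩
          _ = P.real {ω | (1 - ε) * t < U i ω} * P.real {ω | (1 - ε) * t < U j ω} := by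
              rw [measureReal_def, h2, ENNReal.toReal_mul]; rfl
          _ ≤ (C * f ((1 - ε) * t)) * (C * f ((1 - ε) * t)) :=
              mul_le_mul (hUtail i _ h3) (hUtail j _ h3) measureReal_nonneg
                (mul_nonneg hJ.const_pos.le (hf.pos _).le)
          _ = C ^ 2 * f ((1 - ε) * t) ^ 2 := by ring
          _ ≤ _ := by gcongr)
    refine h1.trans (add_le_add ?_ ?_)
    · refine ENNReal.toReal_mono (measure_ne_top _ _) (measure_mono_ae ?_)
      filter_upwards [hsplit] with ω hω hmem
      obtain ⟨i, -, hi⟩ := Set.mem_iUnion₂.1 hmem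
      change t < ∑' i, U i ω
      rw [hω i]
      exact hi.1
    · refine le_trans (le_of_eq ?_) (le_abs_self _)
      simp only [E₀]
      rw [abs_of_nonneg]
      have := hf.pos t
      positivity
  have hα : P.real (⋃ i ∈ I, {ω | a < U i ω ∧ ε * t ≤ restSum U i ω}) ≤ E₁ t := by
    refine (measureReal_biUnion_finset_le I _).trans (Finset.sum_le_sum fun i _ => ?_)
    have h2 := (indepFun_restSum hJ.meas hJ.indep i).measure_inter_preimage_eq_mul (Set.Ioi a)
      (Set.Ici (ε * t)) measurableSet_Ioi measurableSet_Ici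
    have h3 : P.real {ω | ε * t ≤ restSum U i ω} ≤ K₂ i * Real.exp (-(1 / 2 * Q (ε * t))) := by
      refine le_trans (measureReal_mono fun ω hω => ?_)
        (exp_markov (by norm_num) (hJ.integrable_exp_restSum hQ hfQ (by norm_num) (by norm_num) i)
          (Q (ε * t)))
      exact hQ.mono ((show ε * t ≤ _ from hω).trans (le_max_left _ _))
    calc P.real {ω | a < U i ω ∧ ε * t ≤ restSum U i ω}
        = P.real {ω | a < U i ω} * P.real {ω | ε * t ≤ restSum U i ω} := by
          rw [measureReal_def, measureReal_def, measureReal_def, ← ENNReal.toReal_mul]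
          exact congrArg ENNReal.toReal h2
      _ ≤ (C * f a) * (K₂ i * Real.exp (-(1 / 2 * Q (ε * t)))) :=
          mul_le_mul (hUtail i a ha0.le) h3 measureReal_nonneg
            (mul_nonneg hJ.const_pos.le (hf.pos _).le)
      _ = C * K₂ i * (f a * Real.exp (-(1 / 2 * Q (ε * t)))) := by ring
      _ ≤ _ := mul_le_mul_of_nonneg_left hsh (mul_nonneg hJ.const_pos.le (hK₂ i))
  have hβ' : P.real (⋃ i ∈ {i | i ∉ I}, {ω | a < U i ω}) ≤ E₂ t := by
    have hflt := hf.pos (l * t)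
    have hterm : ∀ i ∉ I, P.real {ω | a < U i ω} ≤ C / β * b i * f (l * t) := by
      intro i hi
      have hkey : ∀ y, l * t ≤ y → b i * y ≤ a → P.real {ω | a < U i ω} ≤
          C * (l * t / y * f (l * t)) := by
        intro y hy hya
        have hy0 : 0 < y := lt_of_lt_of_le (by positivity) hy
        calc P.real {ω | a < U i ω} ≤ P.real {ω | b i * y < U i ω} :=
              measureReal_mono fun ω hω => lt_of_le_of_lt hya hω
          _ ≤ C * f y := hJ.tail i y hy0.le
          _ ≤ _ := mul_le_mul_of_nonneg_left (hdiv y hy) hJ.const_pos.le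
      rcases (hJ.nonneg i).eq_or_lt with h0 | h0
      · rw [← h0, mul_zero, zero_mul]
        have hlim : Tendsto (fun y => C * (l * t / y * f (l * t))) atTop (𝓝 0) := by
          have h1 : Tendsto (fun y : ℝ => l * t / y) atTop (𝓝 0) :=
            tendsto_const_nhds.div_atTop tendsto_id
          simpa using (h1.mul_const (f (l * t))).const_mul C
        refine ge_of_tendsto hlim ?_
        filter_upwards [eventually_ge_atTop (l * t)] with y hy
        exact hkey y hy (by rw [← h0, zero_mul]; exact ha0.le)
      · refine (hkey (l * t * (β / b i)) ?_ ?_).trans (le_of_eq ?_)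
        · have : 1 ≤ β / b i := by rw [le_div_iff₀ h0]; linarith [hβ i hi]
          have hlt0 : 0 < l * t := by positivity
          nlinarith
        · have h1 : b i * (l * t * (β / b i)) = (1 + β) / 2 * t := by rw [hl]; field_simp
          rw [h1, ha]
          gcongr
          linarith
        · have := hJ.const_pos
          field_simp
    have hsum : Summable fun i => C / β * b i * f (l * t) :=
      (hJ.summable.mul_left _).mul_right _
    have hC := hJ.const_pos
    have hnn : ∀ i, 0 ≤ C / β * b i * f (l * t) := fun i => by
      have := hJ.nonneg i
      positivity
    rw [measureReal_def]
    refine ENNReal.toReal_le_of_le_ofReal ?_ ?_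
    · simp only [E₂]
      have : 0 ≤ ∑' i, b i := tsum_nonneg hJ.nonneg
      positivity
    calc P (⋃ i ∈ {i | i ∉ I}, {ω | a < U i ω}) ≤
          ∑' i, P (⋃ (_ : i ∈ {i | i ∉ I}), {ω | a < U i ω}) := measure_iUnion_le _
      _ ≤ ∑' i, ENNReal.ofReal (C / β * b i * f (l * t)) := by
          refine ENNReal.tsum_le_tsum fun i => ?_
          by_cases hi : i ∈ I
          · simp [hi]
          · simp only [Set.mem_ofPred_eq, hi, not_false_eq_true, Set.iUnion_true]
            rw [← ofReal_measureReal]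
            exact ENNReal.ofReal_le_ofReal (hterm i hi)
      _ = ENNReal.ofReal (E₂ t) := by
          rw [← ENNReal.ofReal_tsum_of_nonneg hnn hsum, tsum_mul_right, tsum_mul_left]
  have hγ' : P.real {ω | t * (Q a / a) ≤ ∑' i, Q (max (U i ω) 0)} ≤ E₃ t := by
    refine (exp_markov hγ (hJ.integrable_exp hQ hfQ hγ hγ1) _).trans ?_
    exact mul_le_mul_of_nonneg_left htr (integral_nonneg fun ω => (Real.exp_pos _).le)
  have hupper : P.real {ω | t < ∑' i, U i ω} ≤
      ∑ i ∈ I, P.real (A i) + (E₁ t + (E₂ t + E₃ t)) := by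
    have hincl : P.real {ω | t < ∑' i, U i ω} ≤ P.real ((⋃ i ∈ I, A i) ∪
        ((⋃ i ∈ I, {ω | a < U i ω ∧ ε * t ≤ restSum U i ω}) ∪
          ((⋃ i ∈ {i | i ∉ I}, {ω | a < U i ω}) ∪
            {ω | t * (Q a / a) ≤ ∑' i, Q (max (U i ω) 0)}))) := by
      refine ENNReal.toReal_mono (measure_ne_top _ _) (measure_mono_ae ?_)
      filter_upwards [hsplit, hJ.ae_summable] with ω hω hs hmem
      have hmem' : t < ∑' i, U i ω := hmem
      by_cases hex : ∃ i, a < U i ω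
      · obtain ⟨i, hi⟩ := hex
        by_cases hiI : i ∈ I
        · rcases le_total (restSum U i ω) (ε * t) with hr | hr
          · left
            refine Set.mem_iUnion₂.2 ⟨i, hiI, ?_, hr⟩
            rw [← hω i]; exact hmem'
          · right; left
            exact Set.mem_iUnion₂.2 ⟨i, hiI, hi, hr⟩
        · right; right; left
          exact Set.mem_iUnion₂.2 ⟨i, hiI, hi⟩
      · push Not at hex
        right; right; right
        have hV : Summable fun j => max (U j ω) 0 :=
          Summable.of_nonneg_of_le (fun j => le_max_right _ _)
            (fun j => max_le (le_abs_self _) (abs_nonneg _)) hs.abs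
        have h1 := (hQ.le_tsum (fun j => le_max_right (U j ω) 0) hV ha0
          fun j => max_le (hex j) ha0.le).2
        have h2 : ∑' i, U i ω ≤ ∑' i, max (U i ω) 0 :=
          hs.tsum_le_tsum (fun j => le_max_left _ _) hV
        have h3 : 0 ≤ Q a / a := div_nonneg (hQ.nonneg ha0.le) ha0.le
        exact (mul_le_mul_of_nonneg_right (hmem'.le.trans h2) h3).trans h1
    refine hincl.trans ((measureReal_union_le _ _).trans (add_le_add
      (measureReal_biUnion_finset_le I A) ((measureReal_union_le _ _).trans (add_le_add hα
      ((measureReal_union_le _ _).trans (add_le_add hβ' hγ'))))))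
  rw [one_mul, Real.norm_eq_abs, Real.norm_of_nonneg (by positivity), abs_le]
  have e1 := le_abs_self (E₁ t)
  have e2 := le_abs_self (E₂ t)
  have e3 := le_abs_self (E₃ t)
  have e1' := abs_nonneg (E₁ t)
  have e2' := abs_nonneg (E₂ t)
  have e3' := abs_nonneg (E₃ t)
  have e0' := abs_nonneg (E₀ t)
  constructor <;> linarith

end

/-! ### Taylor expansion under the integral -/

lemma exists_taylor_lagrange {m : ℕ} {f : ℝ → ℝ} {T t x : ℝ}
    (hf : ContDiffOn ℝ (m + 1 : ℕ) f (Set.Ioi T)) (ht : T < t) (htx : T < t - x) :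
    ∃ ξ ∈ Set.uIcc t (t - x), f (t - x) -
      ∑ k ∈ Finset.range (m + 1), (-x) ^ k / (k.factorial : ℝ) * iteratedDeriv k f t =
      iteratedDeriv (m + 1) f ξ * (-x) ^ (m + 1) / ((m + 1).factorial : ℝ) := by
  rcases eq_or_ne x 0 with rfl | hx
  · refine ⟨t, Set.left_mem_uIcc, ?_⟩
    rw [Finset.sum_eq_single 0]
    · simp
    · intro k _ hk
      simp [hk]
    · simp
  · have hne : t ≠ t - x := by intro h; apply hx; linarith
    have hsub : Set.uIcc t (t - x) ⊆ Set.Ioi T := fun y hy =>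
      lt_of_lt_of_le (lt_min ht htx) hy.1
    obtain ⟨ξ, hξ, he⟩ := taylor_mean_remainder_lagrange_iteratedDeriv (n := m) hne
      (by exact_mod_cast hf.mono hsub)
    refine ⟨ξ, Set.uIoo_subset_uIcc_self hξ, ?_⟩
    rw [show t - x - t = -x by ring] at he
    rw [← he, taylor_within_apply]
    congr 1
    refine Finset.sum_congr rfl fun k hk => ?_
    rw [Finset.mem_range] at hk
    have hat : ContDiffAt ℝ k f t :=
      (hf.of_le (by exact_mod_cast hk.le)).contDiffAt (Ioi_mem_nhds ht)
    rw [iteratedDerivWithin_eq_iteratedDeriv (uniqueDiffOn_uIcc hne) hat Set.left_mem_uIcc,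
      show t - x - t = -x by ring, smul_eq_mul]
    ring

lemma RegularTail.eventually_deriv_bound {n : ℕ} {f h : ℝ → ℝ} (hf : RegularTail n f h) :
    ∀ᶠ t in atTop, ∀ k ≤ n, |iteratedDeriv k f t| ≤ 2 * (h t ^ k * f t) := by
  have h1 : ∀ k ∈ Finset.range (n + 1), ∀ᶠ t in atTop,
      |iteratedDeriv k f t| ≤ 2 * (h t ^ k * f t) := by
    intro k hk
    rw [Finset.mem_range, Nat.lt_succ_iff] at hk
    have h2 := (hf.deriv_asymp k hk).abs
    rw [abs_pow, abs_neg, abs_one, one_pow] at h2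
    filter_upwards [h2.eventually_le_const (show (1 : ℝ) < 2 by norm_num), hf.hazard_pos]
      with t ht hh
    have h3 : 0 < h t ^ k * f t := mul_pos (pow_pos hh k) (hf.pos t)
    rwa [abs_div, abs_of_pos h3, div_le_iff₀ h3] at ht
  filter_upwards [(Filter.eventually_all_finset _).2 h1] with t ht k hk
  exact ht k (Finset.mem_range.2 (by omega))

lemma RegularTail.exists_hazard_bound {n : ℕ} {f h : ℝ → ℝ} (hf : RegularTail n f h) :
    ∃ C, 1 ≤ C ∧ ∀ᶠ t in atTop, ∀ s ∈ Set.Icc (t / 2) (2 * t), h s ≤ C * h t := by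
  obtain ⟨ρ, -, hrv⟩ := hf.hazard_regVar
  obtain ⟨C, hC, hb⟩ := hrv.exists_bound 2
  have h2 : Tendsto (fun t : ℝ => t / 2) atTop atTop := tendsto_id.atTop_div_const (by norm_num)
  refine ⟨C, hC, ?_⟩
  filter_upwards [hb, h2.eventually (eventually_forall_ge_atTop.2 hb)] with t h1 h2 s hs
  rcases le_total t s with hts | hts
  · exact (h1 s ⟨hts, hs.2⟩).1
  · exact (h2 s hs.1 t ⟨hts, by linarith [hs.1]⟩).2

lemma RegularTail.eventually_shift_le {n : ℕ} {f h : ℝ → ℝ} (hf : RegularTail n f h) {C : ℝ}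
    (hC : ∀ᶠ t in atTop, ∀ s ∈ Set.Icc (t / 2) (2 * t), h s ≤ C * h t) :
    ∀ᶠ t in atTop, ∀ x, 0 ≤ x → x ≤ t / 2 → f (t - x) ≤ f t * Real.exp (C * h t * x) := by
  have h2 : Tendsto (fun t : ℝ => t / 2) atTop atTop := tendsto_id.atTop_div_const (by norm_num)
  filter_upwards [hC, h2.eventually (eventually_forall_ge_atTop.2 hf.exists_slope)]
    with t h1 hs x hx0 hx
  rcases hx0.eq_or_lt with rfl | hx0
  · simp
  obtain ⟨ξ, hξ, he⟩ := hs (t - x) (by linarith) t (by linarith)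
  have h3 := h1 ξ ⟨by linarith [hξ.1], by linarith [hξ.2]⟩
  rw [← Real.exp_log (hf.pos (t - x)), ← Real.exp_log (hf.pos t), ← Real.exp_add,
    Real.exp_le_exp]
  have h4 : h ξ * x ≤ C * h t * x := by gcongr
  rw [sub_sub_cancel] at he
  linarith

/-- The remainder in the Taylor expansion of `f (t - x)` truncated to `x ≤ ε t`, relative to
`h t ^ m * f t`. -/
def relRemainder (m : ℕ) (f h : ℝ → ℝ) (ε t x : ℝ) : ℝ :=
  (Set.indicator (Set.Iic (ε * t)) (fun y => f (t - y)) x -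
    ∑ k ∈ Finset.range (m + 1), (-x) ^ k / (k.factorial : ℝ) * iteratedDeriv k f t) /
    (h t ^ m * f t)

lemma abs_sum_le_of_one_le {m : ℕ} {D : ℕ → ℝ} {x a F : ℝ} (hF : 0 ≤ F)
    (hx : 1 ≤ |x| * a) (hD : ∀ k ≤ m, |D k| ≤ 2 * (a ^ k * F)) :
    |∑ k ∈ Finset.range (m + 1), (-x) ^ k / (k.factorial : ℝ) * D k| ≤
      2 * (m + 1) * |x| ^ m * (a ^ m * F) := by
  refine (Finset.abs_sum_le_sum_abs _ _).trans ?_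
  have hterm : ∀ k ∈ Finset.range (m + 1), |(-x) ^ k / (k.factorial : ℝ) * D k| ≤
      2 * |x| ^ m * (a ^ m * F) := by
    intro k hk
    have hkm : k ≤ m := Nat.lt_succ_iff.1 (Finset.mem_range.1 hk)
    have hfac : (1 : ℝ) ≤ (k.factorial : ℝ) := by
      exact_mod_cast Nat.one_le_iff_ne_zero.2 (Nat.factorial_ne_zero _)
    have hpow : |x| ^ k * a ^ k ≤ |x| ^ m * a ^ m := by
      rw [← mul_pow, ← mul_pow]
      exact pow_le_pow_right₀ hx hkm
    rw [abs_mul, abs_div, abs_pow, abs_neg, abs_of_pos (show (0 : ℝ) <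
      (k.factorial : ℝ) by linarith)]
    calc |x| ^ k / (k.factorial : ℝ) * |D k|
        ≤ |x| ^ k * (2 * (a ^ k * F)) :=
          mul_le_mul (div_le_self (by positivity) hfac) (hD k hkm) (abs_nonneg _) (by positivity)
      _ = 2 * (|x| ^ k * a ^ k) * F := by ring
      _ ≤ 2 * (|x| ^ m * a ^ m) * F := by gcongr
      _ = 2 * |x| ^ m * (a ^ m * F) := by ring
  refine (Finset.sum_le_card_nsmul _ _ _ hterm).trans (le_of_eq ?_)
  rw [Finset.card_range, nsmul_eq_mul]
  push_cast
  ring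

/-- Pointwise and uniform bounds on the relative remainder. For `|x| ≤ 1 / h t` they come from
Taylor's formula. For larger `x` the polynomial is of order `|x| ^ m`, whereas `f (t - x)` is
controlled by the gauge if `x > 0` and by monotonicity if `x < 0`. -/
lemma RegularTail.exists_relRemainder_bound {m : ℕ} {f h Q : ℝ → ℝ}
    (hf : RegularTail (m + 1) f h) (hQ : Gauge Q)
    (hQf : ∀ᶠ t in atTop, Q t = -Real.log (f t)) :
    ∃ ε₀ > 0, ∃ A : ℝ, 0 ≤ A ∧ ∀ ε, 0 < ε → ε ≤ ε₀ → ∀ᶠ t in atTop, ∀ x,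
      |relRemainder m f h ε t x| ≤ A * (|x| ^ m + Real.exp (1 / 2 * Q (max x 0))) ∧
      (|x| * h t ≤ 1 → |relRemainder m f h ε t x| ≤ A * |x| ^ (m + 1) * h t) := by
  obtain ⟨ρ, hρ, hrv⟩ := hf.hazard_regVar
  obtain ⟨C₁, hC₁, hb⟩ := hf.exists_hazard_bound
  obtain ⟨κ, hκ0, hκ1, hκ⟩ := hf.exists_mul_hazard_le
  obtain ⟨M, hM0, hM⟩ := hQ.exists_pow_le (show (0 : ℝ) < 1 / 4 by norm_num) m
  obtain ⟨T, hT⟩ := hf.smooth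
  -- for this `ε₀` the hazard rate at `ε t` exceeds `4 C₁ h t`
  set ε₀ : ℝ := (4 * C₁ + 1) ^ ρ⁻¹ with hε₀
  have hε₀0 : 0 < ε₀ := by positivity
  have hε₀ρ : ε₀ ^ ρ = 4 * C₁ + 1 := by
    rw [hε₀, ← Real.rpow_mul (by positivity), inv_mul_cancel₀ hρ.ne, Real.rpow_one]
  set A₁ : ℝ := 2 * C₁ ^ (m + 1) * Real.exp C₁ with hA₁
  have hA₁0 : 0 ≤ A₁ := by positivity
  refine ⟨min ε₀ (1 / 2), by positivity, A₁ + 2 * (m + 1) + 1 + M, by positivity,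
    fun ε hε hεε => ?_⟩
  have hε1 : ε ≤ ε₀ := hεε.trans (min_le_left _ _)
  have hε2 : ε ≤ 1 / 2 := hεε.trans (min_le_right _ _)
  have hερ : 4 * C₁ < ε ^ ρ := by
    have := Real.rpow_le_rpow_of_nonpos hε hε1 hρ.le
    linarith
  have hεt : Tendsto (fun t => ε * t) atTop atTop := tendsto_id.const_mul_atTop hε
  have h2t : Tendsto (fun t : ℝ => t / 2) atTop atTop := tendsto_id.atTop_div_const (by norm_num)
  filter_upwards [hb, hf.eventually_shift_le hb,
    h2t.eventually (eventually_forall_ge_atTop.2 hf.eventually_deriv_bound),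
    h2t.eventually (eventually_forall_ge_atTop.2 hf.hazard_pos), h2t.eventually_gt_atTop T,
    hf.eventually_one_le_mul ε⁻¹, (hrv.ratio ε hε).eventually (lt_mem_nhds hερ),
    hεt.eventually hκ, hεt.eventually hQf, eventually_gt_atTop 0]
    with t hbt hsh hdb hhp hTt h1t hrat hκt hQt ht0
  have hh : 0 < h t := hhp t (by linarith)
  have hft := hf.pos t
  set N := h t ^ m * f t with hN
  have hN0 : 0 < N := by positivity
  have hεth : 1 ≤ ε * t * h t := by
    have := mul_le_mul_of_nonneg_left h1t hε.le
    rw [mul_inv_cancel₀ hε.ne'] at this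
    linarith
  have hsmall : ∀ x, |x| * h t ≤ 1 → |relRemainder m f h ε t x| ≤ A₁ * |x| ^ (m + 1) * h t := by
    intro x hx
    have hxt : |x| ≤ ε * t := by
      by_contra hcon
      push Not at hcon
      nlinarith
    have hxt2 : |x| ≤ t / 2 := hxt.trans (by nlinarith)
    obtain ⟨hx1, hx2⟩ := abs_le.1 hxt
    obtain ⟨hx3, hx4⟩ := abs_le.1 hxt2
    obtain ⟨ξ, hξ, he⟩ := exists_taylor_lagrange (m := m) (x := x) (t := t)
      hT (by linarith) (by linarith)
    have hξ1 : t - |x| ≤ ξ := by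
      refine le_trans ?_ hξ.1
      exact le_min (by linarith [abs_nonneg x]) (by linarith [le_abs_self x])
    have hξ2 : ξ ≤ t + |x| := by
      refine hξ.2.trans ?_
      exact max_le (by linarith [abs_nonneg x]) (by linarith [neg_abs_le x])
    have hξh := hbt ξ ⟨by linarith, by linarith⟩
    have hξ0 := hhp ξ (by linarith)
    have hξf : f ξ ≤ f t * Real.exp C₁ := by
      refine (hf.anti hξ1).trans ((hsh |x| (abs_nonneg x) hxt2).trans ?_)
      gcongr
      rw [mul_assoc, mul_comm (h t)]
      nlinarith
    have hder := hdb ξ (by linarith) (m + 1) le_rfl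
    have hfac : (1 : ℝ) ≤ ((m + 1).factorial : ℝ) := by
      exact_mod_cast Nat.one_le_iff_ne_zero.2 (Nat.factorial_ne_zero _)
    rw [relRemainder, Set.indicator_of_mem (Set.mem_Iic.2 hx2), he, abs_div, abs_of_pos hN0,
      div_le_iff₀ hN0, abs_div, abs_mul, abs_pow, abs_neg, abs_of_pos (show (0 : ℝ) <
        ((m + 1).factorial : ℝ) by linarith)]
    calc |iteratedDeriv (m + 1) f ξ| * |x| ^ (m + 1) / ((m + 1).factorial : ℝ)
        ≤ |iteratedDeriv (m + 1) f ξ| * |x| ^ (m + 1) := div_le_self (by positivity) hfac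
      _ ≤ 2 * (h ξ ^ (m + 1) * f ξ) * |x| ^ (m + 1) := by gcongr
      _ ≤ 2 * ((C₁ * h t) ^ (m + 1) * (f t * Real.exp C₁)) * |x| ^ (m + 1) := by
          have := hf.pos ξ
          gcongr
      _ = A₁ * |x| ^ (m + 1) * h t * N := by rw [hA₁, hN, mul_pow]; ring
  have hmid : ∀ x, 0 < x → x ≤ ε * t → C₁ * h t * x ≤ 1 / 4 * Q x := by
    intro x hxpos hxt
    have h1 := hQ.star x (ε * t) hxpos hxt
    rw [lt_div_iff₀ hh] at hrat
    have h2 : ε * t * h (ε * t) ≤ Q (ε * t) := by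
      rw [hQt]
      refine hκt.trans ?_
      have := mul_nonneg hκ0.le (hf.neg_log_nonneg (ε * t))
      linarith
    have hεt0 : 0 < ε * t := by positivity
    have h3 : ε * t * (4 * C₁ * h t * x) ≤ ε * t * Q x := by
      calc ε * t * (4 * C₁ * h t * x) = x * (ε * t * (4 * C₁ * h t)) := by ring
        _ ≤ x * (ε * t * h (ε * t)) := by gcongr
        _ ≤ x * Q (ε * t) := by gcongr
        _ ≤ ε * t * Q x := h1
    have h4 := le_of_mul_le_mul_left h3 hεt0
    linarith
  have hall : ∀ x, |relRemainder m f h ε t x| ≤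
      (A₁ + 2 * (m + 1) + 1 + M) * (|x| ^ m + Real.exp (1 / 2 * Q (max x 0))) := by
    intro x
    have hE : 0 < Real.exp (1 / 2 * Q (max x 0)) := Real.exp_pos _
    have hX : 0 ≤ |x| ^ m := by positivity
    rcases le_total (|x| * h t) 1 with hx | hx
    · have h1 : A₁ * |x| ^ (m + 1) * h t ≤ A₁ * |x| ^ m := by
        calc A₁ * |x| ^ (m + 1) * h t = A₁ * |x| ^ m * (|x| * h t) := by ring
          _ ≤ A₁ * |x| ^ m * 1 := by gcongr
          _ = _ := mul_one _
      have h2 : A₁ * |x| ^ m ≤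
          (A₁ + 2 * (m + 1) + 1 + M) * (|x| ^ m + Real.exp (1 / 2 * Q (max x 0))) :=
        mul_le_mul (by linarith [show (0 : ℝ) ≤ m from Nat.cast_nonneg m]) (by linarith) hX
          (by positivity)
      exact (hsmall x hx).trans (h1.trans h2)
    · have hxm : 1 ≤ |x| ^ m * h t ^ m := by
        rw [← mul_pow]
        exact one_le_pow₀ hx
      have hpoly := abs_sum_le_of_one_le (m := m) hft.le hx
        (D := fun k => iteratedDeriv k f t) fun k hk => hdb t (by linarith) k (by omega)
      rw [← hN] at hpoly
      have hind : |Set.indicator (Set.Iic (ε * t)) (fun y => f (t - y)) x| ≤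
          (|x| ^ m + M * Real.exp (1 / 2 * Q (max x 0))) * N := by
        have hME := mul_nonneg hM0 hE.le
        by_cases hxt : x ≤ ε * t
        · rw [Set.indicator_of_mem (Set.mem_Iic.2 hxt), abs_of_pos (hf.pos _)]
          rcases le_total x 0 with hx0 | hx0
          · calc f (t - x) ≤ f t := hf.anti (by linarith)
              _ ≤ (|x| ^ m * h t ^ m) * f t := le_mul_of_one_le_left hft.le hxm
              _ = |x| ^ m * N := by rw [hN]; ring
              _ ≤ _ := mul_le_mul_of_nonneg_right (by linarith) hN0.le
          · have hxpos : 0 < x := by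
              refine lt_of_le_of_ne hx0 fun h0 => ?_
              rw [← h0, abs_zero, zero_mul] at hx
              exact absurd hx (by norm_num)
            rw [max_eq_left hx0]
            have hq := hmid x hxpos hxt
            have hx2 : x ≤ t / 2 := hxt.trans (by nlinarith only [hε2, ht0])
            calc f (t - x) ≤ f t * Real.exp (C₁ * h t * x) := hsh x hx0 hx2
              _ ≤ f t * Real.exp (1 / 4 * Q x) := by gcongr
              _ ≤ (|x| ^ m * h t ^ m) * (f t * Real.exp (1 / 4 * Q x)) :=
                le_mul_of_one_le_left (by positivity) hxm
              _ = x ^ m * Real.exp (1 / 4 * Q x) * N := by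
                rw [abs_of_pos hxpos, hN]; ring
              _ ≤ M * Real.exp (1 / 4 * Q x) * Real.exp (1 / 4 * Q x) * N := by
                gcongr
                exact hM x hx0
              _ = M * Real.exp (1 / 2 * Q x) * N := by
                rw [mul_assoc M, ← Real.exp_add]; congr 4; ring
              _ ≤ _ := by
                refine mul_le_mul_of_nonneg_right ?_ hN0.le
                linarith
        · rw [Set.indicator_of_notMem (by simpa using hxt), abs_zero]
          positivity
      rw [relRemainder, abs_div, abs_of_pos hN0, div_le_iff₀ hN0]
      refine (abs_sub _ _).trans ((add_le_add hind hpoly).trans ?_)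
      rw [← add_mul]
      refine mul_le_mul_of_nonneg_right ?_ hN0.le
      nlinarith only [hX, hE.le, mul_nonneg hA₁0 hX, mul_nonneg hA₁0 hE.le, mul_nonneg hM0 hX,
        mul_nonneg (show (0 : ℝ) ≤ m from Nat.cast_nonneg m) hE.le]
  intro x
  refine ⟨hall x, fun hx => (hsmall x hx).trans ?_⟩
  gcongr
  linarith [show (0 : ℝ) ≤ m from Nat.cast_nonneg m]

lemma integrable_pow_of_le {ν : Measure ℝ} [IsProbabilityMeasure ν] {m : ℕ}
    (hm : Integrable (fun x : ℝ => |x| ^ m) ν) {k : ℕ} (hk : k ≤ m) :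
    Integrable (fun x : ℝ => x ^ k) ν := by
  refine ((integrable_const (1 : ℝ)).add hm).mono' (by fun_prop) (Eventually.of_forall fun x => ?_)
  rw [norm_pow, Real.norm_eq_abs, Pi.add_apply]
  rcases le_total |x| 1 with hx | hx
  · have h1 := pow_le_one₀ (n := k) (abs_nonneg x) hx
    have h2 : 0 ≤ |x| ^ m := by positivity
    linarith
  · have := pow_le_pow_right₀ hx hk
    linarith

/-- Convolution of a regular tail with a distribution whose tail is not heavier: the Laplace
character gives the expansion of the convolution truncated at `ε t`. -/
lemma RegularTail.exists_laplace_expansion {m : ℕ} {f h Q : ℝ → ℝ}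
    (hf : RegularTail (m + 1) f h) (hQ : Gauge Q)
    (hQf : ∀ᶠ t in atTop, Q t = -Real.log (f t)) :
    ∃ ε₀ > 0, ∀ ε, 0 < ε → ε ≤ ε₀ → ∀ (ν : Measure ℝ) [IsProbabilityMeasure ν],
      Integrable (fun x : ℝ => |x| ^ m) ν →
      Integrable (fun x => Real.exp (1 / 2 * Q (max x 0))) ν →
      (fun t => ∫ x, Set.indicator (Set.Iic (ε * t)) (fun y => f (t - y)) x ∂ν -
        laplaceCharacter ν m f t) =o[atTop] fun t => h t ^ m * f t := by
  obtain ⟨ε₀, hε₀, A, hA, hbound⟩ := hf.exists_relRemainder_bound hQ hQf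
  refine ⟨ε₀, hε₀, fun ε hε hεε ν _ hm hexp => ?_⟩
  have hb := hbound ε hε hεε
  have hfm : Measurable f := hf.anti.measurable
  have hindm : ∀ t, Measurable (Set.indicator (Set.Iic (ε * t)) fun y => f (t - y)) := fun t =>
    (hfm.comp (measurable_const.sub measurable_id)).indicator measurableSet_Iic
  have hlim : Tendsto (fun t => ∫ x, relRemainder m f h ε t x ∂ν) atTop (𝓝 (∫ _, 0 ∂ν)) := by
    refine tendsto_integral_filter_of_dominated_convergence
      (fun x => A * (|x| ^ m + Real.exp (1 / 2 * Q (max x 0)))) ?_ ?_ ((hm.add hexp).const_mul A)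
      (Eventually.of_forall fun x => ?_)
    · refine Eventually.of_forall fun t => Measurable.aestronglyMeasurable ?_
      have h1 : Measurable fun x : ℝ => ∑ k ∈ Finset.range (m + 1),
        (-x) ^ k / (k.factorial : ℝ) * iteratedDeriv k f t := by fun_prop
      exact ((hindm t).sub h1).div_const _
    · filter_upwards [hb] with t ht
      exact Eventually.of_forall fun x => (ht x).1
    · have h1 : Tendsto (fun t => A * |x| ^ (m + 1) * h t) atTop (𝓝 0) := by
        simpa using hf.hazard_tendsto.const_mul (A * |x| ^ (m + 1))
      have h2 : Tendsto (fun t => |x| * h t) atTop (𝓝 0) := by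
        simpa using hf.hazard_tendsto.const_mul |x|
      refine squeeze_zero_norm' ?_ h1
      filter_upwards [hb, h2.eventually_le_const one_pos] with t ht hx
      exact (ht x).2 hx
  rw [integral_zero] at hlim
  rw [isLittleO_iff_tendsto' ?_]
  · refine hlim.congr fun t => ?_
    simp only [relRemainder]
    rw [integral_div, integral_sub, integral_finsetSum]
    · congr 2
      rw [laplaceCharacter]
      refine Finset.sum_congr rfl fun k _ => ?_
      rw [integral_mul_const]
      congr 1
      rw [← integral_const_mul]
      refine integral_congr_ae (Eventually.of_forall fun x => ?_)
      simp only
      rw [neg_pow]; ring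
    · intro k hk
      rw [Finset.mem_range] at hk
      refine Integrable.mul_const ?_ _
      have := (integrable_pow_of_le hm (Nat.lt_succ_iff.1 hk)).const_mul
        ((-1) ^ k / (k.factorial : ℝ))
      refine this.congr (Eventually.of_forall fun x => ?_)
      simp only
      rw [neg_pow x]; ring
    · refine (integrable_const (1 : ℝ)).mono' (hindm t).aestronglyMeasurable
        (Eventually.of_forall fun x => ?_)
      rw [Set.indicator_apply]
      split_ifs
      · rw [Real.norm_of_nonneg (hf.pos _).le]; exact hf.le_one _
      · simp
    · refine integrable_finsetSum _ fun k hk => ?_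
      rw [Finset.mem_range] at hk
      refine Integrable.mul_const ?_ _
      have := (integrable_pow_of_le hm (Nat.lt_succ_iff.1 hk)).const_mul
        ((-1) ^ k / (k.factorial : ℝ))
      refine this.congr (Eventually.of_forall fun x => ?_)
      simp only
      rw [neg_pow x]; ring
  · filter_upwards [hf.hazard_pos] with t ht h0
    exact absurd h0 (mul_pos (pow_pos ht m) (hf.pos t)).ne'

/-! ### Comparison of weights -/

/-- Two proportional regular tails have hazard rates of the same order. -/
lemma RegularTail.hazard_isBigO {n : ℕ} {f g h k : ℝ → ℝ} (hf : RegularTail n f h)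
    (hg : RegularTail n g k) {C : ℝ} (hC : 1 ≤ C) (hfg : ∀ t, f t ≤ C * g t)
    (hgf : ∀ t, g t ≤ C * f t) : k =O[atTop] h := by
  obtain ⟨ρ, -, hrv⟩ := hf.hazard_regVar
  obtain ⟨σ, -, krv⟩ := hg.hazard_regVar
  obtain ⟨C₁, hC₁, hb₁⟩ := hrv.exists_bound 2
  obtain ⟨C₂, hC₂, hb₂⟩ := krv.exists_bound 2
  refine IsBigO.of_bound (C₂ * (C₁ + 1)) ?_
  filter_upwards [hb₁, hb₂, hf.exists_slope, hg.exists_slope, hf.hazard_pos, hg.hazard_pos,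
    hf.eventually_one_le_mul (2 * Real.log C), eventually_gt_atTop 0]
    with t h1 h2 h3 h4 hh hk hl ht
  obtain ⟨ξ, hξ, hξe⟩ := h3 (2 * t) (by linarith)
  obtain ⟨ζ, hζ, hζe⟩ := h4 (2 * t) (by linarith)
  have hξ1 := (h1 ξ ⟨hξ.1.le, hξ.2.le⟩).1
  have hζ1 := (h2 ζ ⟨hζ.1.le, hζ.2.le⟩).2
  have hlog : ∀ s, |Real.log (f s) - Real.log (g s)| ≤ Real.log C := by
    intro s
    have e1 := Real.log_le_log (hf.pos s) (hfg s)
    have e2 := Real.log_le_log (hg.pos s) (hgf s)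
    rw [Real.log_mul (by positivity) (hg.pos s).ne'] at e1
    rw [Real.log_mul (by positivity) (hf.pos s).ne'] at e2
    rw [abs_le]
    constructor <;> linarith
  have e1 := abs_le.1 (hlog t)
  have e2 := abs_le.1 (hlog (2 * t))
  rw [show 2 * t - t = t by ring] at hξe hζe
  have e3 : k ζ * t ≤ h ξ * t + t * h t := by
    rw [← hξe, ← hζe]
    linarith [e1.1, e1.2, e2.1, e2.2]
  have e4 : k ζ ≤ (C₁ + 1) * h t := by
    have : t * k ζ ≤ t * ((C₁ + 1) * h t) := by nlinarith
    exact le_of_mul_le_mul_left this ht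
  rw [Real.norm_of_nonneg hk.le, Real.norm_of_nonneg hh.le]
  calc k t ≤ C₂ * k ζ := hζ1
    _ ≤ C₂ * ((C₁ + 1) * h t) := by gcongr
    _ = _ := by ring

lemma PosRegVar.comp_mul_isBigO {ρ a : ℝ} {g : ℝ → ℝ} (hg : PosRegVar ρ g) (ha : 0 < a) :
    (fun t => a * g (a * t)) =O[atTop] g := by
  refine IsBigO.const_mul_left ?_ a
  refine IsBigO.of_bound (a ^ ρ + 1) ?_
  have hat : Tendsto (fun t => a * t) atTop atTop := tendsto_id.const_mul_atTop ha
  filter_upwards [(hg.ratio a ha).eventually_le_const (lt_add_one _), hg.pos,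
    hat.eventually hg.pos] with t h1 h2 h3
  rw [Real.norm_of_nonneg h3.le, Real.norm_of_nonneg h2.le]
  rwa [div_le_iff₀ h2] at h1

lemma exists_bound_of_tendsto_div {f g : ℝ → ℝ} (hf : Antitone f) (hg : Antitone g)
    (hf0 : ∀ t, 0 < f t) (hg0 : ∀ t, 0 < g t) (hf1 : ∀ t, f t ≤ 1) (hg1 : ∀ t, g t ≤ 1) {L : ℝ}
    (hL : 0 < L) (h : Tendsto (fun t => f t / g t) atTop (𝓝 L)) :
    ∃ C, 1 ≤ C ∧ ∀ t, f t ≤ C * g t ∧ g t ≤ C * f t := by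
  obtain ⟨T, hT⟩ := eventually_atTop.1
    ((h.eventually_le_const (lt_add_one L)).and (h.eventually_const_le (half_lt_self hL)))
  set C := 1 + (L + 1) + 2 / L + (g T)⁻¹ + (f T)⁻¹ with hC
  have i1 : 0 < 2 / L := by positivity
  have i2 : 0 < (g T)⁻¹ := inv_pos.2 (hg0 T)
  have i3 : 0 < (f T)⁻¹ := inv_pos.2 (hf0 T)
  refine ⟨C, by linarith, fun t => ?_⟩
  have hft := hf0 t
  have hgt := hg0 t
  rcases le_total T t with ht | ht
  · obtain ⟨h1, h2⟩ := hT t ht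
    rw [div_le_iff₀ hgt] at h1
    rw [le_div_iff₀ hgt] at h2
    constructor
    · exact h1.trans (by gcongr; linarith)
    · have : g t ≤ 2 / L * f t := by
        rw [div_mul_eq_mul_div, le_div_iff₀ hL]; linarith
      exact this.trans (by gcongr; linarith)
  · have h1 : 1 ≤ (g T)⁻¹ * g t := by
      rw [← div_eq_inv_mul, le_div_iff₀ (hg0 T), one_mul]; exact hg ht
    have h2 : 1 ≤ (f T)⁻¹ * f t := by
      rw [← div_eq_inv_mul, le_div_iff₀ (hf0 T), one_mul]; exact hf ht
    constructor
    · exact (hf1 t).trans (h1.trans (by gcongr; linarith))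
    · exact (hg1 t).trans (h2.trans (by gcongr; linarith))

instance isProbabilityMeasure_scale (a : ℝ) (μ : Measure ℝ) [IsProbabilityMeasure μ] :
    IsProbabilityMeasure (scale a μ) :=
  Measure.isProbabilityMeasure_map (by fun_prop)

lemma tail_scale_eq (a : ℝ) (μ : Measure ℝ) (t : ℝ) :
    tail (scale a μ) t = μ.real {x | t < a * x} := by
  rw [tail, scale, map_measureReal_apply (by fun_prop) measurableSet_Ioi]
  rfl

lemma tail_scale_of_pos {a : ℝ} (ha : 0 < a) (μ : Measure ℝ) :
    tail (scale a μ) = fun t => tail μ (a⁻¹ * t) := by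
  funext t
  rw [tail_scale_eq, tail]
  congr 1
  ext x
  simp [inv_mul_lt_iff₀ ha]

lemma tail_scale_of_neg {a : ℝ} (ha : a < 0) (μ : Measure ℝ) :
    tail (scale a μ) = fun t => tail (scale (-1) μ) (|a|⁻¹ * t) := by
  funext t
  rw [tail_scale_eq, tail_scale_eq]
  congr 1
  ext x
  have ha' : 0 < |a| := abs_pos.2 ha.ne
  simp only [Set.mem_ofPred_eq]
  rw [inv_mul_lt_iff₀ ha', abs_of_neg ha]
  simp

/-- The effective weight `e a` governs the size of the upper tail of `a * X`: it is `|a|` when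
both tails are of the same order, and the positive part of `a` when `X` is bounded below. -/
structure WeightProfile (m : ℕ) (μ : Measure ℝ) (e : ℝ → ℝ) : Prop where
  nonneg : ∀ a, 0 ≤ e a
  le_abs : ∀ a, e a ≤ |a|
  regular : ∀ a, 0 < e a →
    ∃ h, RegularTail (m + 1) (tail (scale a μ)) h ∧ h =O[atTop] hazardRate μ
  compare : ∃ C, 1 ≤ C ∧ ∀ a, 0 < e a → ∀ z,
    tail (scale a μ) (e a * z) ≤ C * tail μ z ∧ tail μ z ≤ C * tail (scale a μ) (e a * z)
  zero : ∃ B, 0 ≤ B ∧ ∀ a, e a = 0 → ∀ t, |a| * B ≤ t → tail (scale a μ) t = 0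
  abs_tail : ∃ C, 0 < C ∧ ∀ z, 0 ≤ z → μ.real {x | z < |x|} ≤ C * tail μ z

lemma measureReal_abs_le (μ : Measure ℝ) [IsProbabilityMeasure μ] (z : ℝ) :
    μ.real {x | z < |x|} ≤ tail μ z + tail (scale (-1) μ) z := by
  rw [tail_scale_eq, tail]
  refine le_trans (measureReal_mono fun x hx => ?_) (measureReal_union_le _ _)
  rcases lt_abs.1 (show z < |x| from hx) with h | h
  · exact Or.inl h
  · exact Or.inr (by simpa using h)

lemma weightProfile_of_vanishesNearBot {m : ℕ} {μ : Measure ℝ} [IsProbabilityMeasure μ]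
    (hμ : RegularTail (m + 1) (tail μ) (hazardRate μ)) (hv : VanishesNearBot μ) :
    WeightProfile m μ fun a => max a 0 := by
  obtain ⟨a₀, ha₀⟩ := hv
  have hpos : ∀ {a : ℝ}, 0 < max a 0 → 0 < a := fun h => by simpa using h
  obtain ⟨ρ, -, hrv⟩ := hμ.hazard_regVar
  have hlow : ∀ᵐ x ∂μ, a₀ < x := by
    rw [ae_iff]
    convert ha₀ using 2
    ext x; simp
  refine ⟨fun a => le_max_right _ _, fun a => max_le (le_abs_self a) (abs_nonneg a),
    fun a ha => ?_, ⟨1, le_rfl, fun a ha z => ?_⟩, ⟨|a₀|, abs_nonneg _, fun a ha t ht => ?_⟩,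
    ⟨(tail μ |a₀|)⁻¹, inv_pos.2 (hμ.pos _), fun z hz => ?_⟩⟩
  · have ha' := hpos ha
    refine ⟨_, ?_, hrv.comp_mul_isBigO (inv_pos.2 ha')⟩
    rw [tail_scale_of_pos ha']
    exact hμ.comp_mul (inv_pos.2 ha')
  · have ha' := hpos ha
    rw [tail_scale_of_pos ha', max_eq_left ha'.le, one_mul, one_mul]
    beta_reduce
    rw [inv_mul_cancel_left₀ ha'.ne']
    exact ⟨le_rfl, le_rfl⟩
  · have ha' : a ≤ 0 := by simpa using ha
    rw [tail_scale_eq, measureReal_eq_zero_iff, ← nonpos_iff_eq_zero, ← ha₀]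
    refine measure_mono fun x hx => ?_
    by_contra hcon
    rw [Set.mem_Iic, not_le] at hcon
    have h1 : t < a * x := hx
    have h2 : a * x ≤ a * a₀ := mul_le_mul_of_nonpos_left hcon.le ha'
    have h3 : a * a₀ ≤ |a| * |a₀| := by rw [← abs_mul]; exact le_abs_self _
    linarith
  · have h1 : 1 ≤ (tail μ |a₀|)⁻¹ := (one_le_inv₀ (hμ.pos _)).2 (hμ.le_one _)
    rcases le_total |a₀| z with hle | hle
    · have h2 : μ.real {x | z < |x|} ≤ tail μ z := by
        refine ENNReal.toReal_mono (measure_ne_top _ _) (measure_mono_ae ?_)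
        filter_upwards [hlow] with x hx hxz
        rcases lt_abs.1 (show z < |x| from hxz) with h | h
        · exact h
        · linarith [neg_abs_le a₀]
      have := hμ.pos z
      nlinarith
    · refine measureReal_le_one.trans ?_
      rw [← div_eq_inv_mul, le_div_iff₀ (hμ.pos _), one_mul]
      exact hμ.anti hle

lemma weightProfile_of_tailBalanced {m : ℕ} {μ : Measure ℝ} [IsProbabilityMeasure μ]
    (hμ : RegularTail (m + 1) (tail μ) (hazardRate μ))
    (hs : StronglyTailBalanced (WeibullLike m) μ) :
    WeightProfile m μ fun a => |a| := by
  obtain ⟨⟨L, hL, hlim⟩, hhaz, hw⟩ := hs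
  have hν := regularTail_of_weibullLike hhaz hw
  obtain ⟨C, hC, hcmp⟩ := exists_bound_of_tendsto_div hμ.anti hν.anti hμ.pos hν.pos hμ.le_one
    hν.le_one hL hlim
  obtain ⟨ρ, -, hrv⟩ := hμ.hazard_regVar
  obtain ⟨σ, -, hrv'⟩ := hν.hazard_regVar
  have hO := hμ.hazard_isBigO hν hC (fun t => (hcmp t).1) fun t => (hcmp t).2
  refine ⟨fun a => abs_nonneg a, fun a => le_rfl, fun a ha => ?_, ⟨C, hC, fun a ha z => ?_⟩,
    ⟨0, le_rfl, fun a ha t ht => ?_⟩, ⟨1 + C, by linarith, fun z _ => ?_⟩⟩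
  · rcases lt_or_gt_of_ne (abs_pos.1 ha) with h | h
    · refine ⟨_, ?_, (hrv'.comp_mul_isBigO (inv_pos.2 ha)).trans hO⟩
      rw [tail_scale_of_neg h]
      exact hν.comp_mul (inv_pos.2 ha)
    · refine ⟨_, ?_, hrv.comp_mul_isBigO (inv_pos.2 h)⟩
      rw [tail_scale_of_pos h]
      exact hμ.comp_mul (inv_pos.2 h)
  · rcases lt_or_gt_of_ne (abs_pos.1 ha) with h | h
    · rw [tail_scale_of_neg h]
      beta_reduce
      rw [inv_mul_cancel_left₀ ha.ne']
      exact ⟨(hcmp z).2, (hcmp z).1⟩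
    · rw [tail_scale_of_pos h, abs_of_pos h]
      beta_reduce
      rw [inv_mul_cancel_left₀ h.ne']
      have := (hμ.pos z).le
      exact ⟨by nlinarith, by nlinarith⟩
  · rw [tail_scale_eq, abs_eq_zero.1 ha]
    rw [mul_zero] at ht
    simp [not_lt.2 ht]
  · refine (measureReal_abs_le μ z).trans ?_
    linarith [(hcmp z).2]

section

variable {m : ℕ} {μ : Measure ℝ} {e : ℝ → ℝ}

lemma WeightProfile.eventually_zero (he : WeightProfile m μ e) {a : ℝ} (ha : e a = 0) :
    tail (scale a μ) =ᶠ[atTop] 0 := by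
  obtain ⟨B, -, hB⟩ := he.zero
  filter_upwards [eventually_ge_atTop (|a| * B)] with t ht using hB a ha t ht

lemma WeightProfile.pos (he : WeightProfile m μ e) {a : ℝ} (ha : 0 < e a) (t : ℝ) :
    0 < tail (scale a μ) t := by
  obtain ⟨h, hh, -⟩ := he.regular a ha
  exact hh.pos t

lemma WeightProfile.exists_le_mul (he : WeightProfile m μ e) : ∃ C, 1 ≤ C ∧ ∀ a b, 0 < e a →
    e a = e b → ∀ t, tail (scale a μ) t ≤ C * tail (scale b μ) t := by
  obtain ⟨C, hC, hcmp⟩ := he.compare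
  refine ⟨C * C, by nlinarith, fun a b ha hab t => ?_⟩
  have h1 := (hcmp a ha ((e a)⁻¹ * t)).1
  have h2 := (hcmp b (hab ▸ ha) ((e a)⁻¹ * t)).2
  rw [mul_inv_cancel_left₀ ha.ne'] at h1
  rw [← hab, mul_inv_cancel_left₀ ha.ne'] at h2
  nlinarith

lemma WeightProfile.tailEquiv_of_eq (he : WeightProfile m μ e) {a b : ℝ} (hab : e a = e b) :
    TailEquiv μ a b := by
  rcases (he.nonneg a).eq_or_lt with h0 | h0
  · refine ⟨1, one_pos, ?_⟩
    filter_upwards [he.eventually_zero h0.symm, he.eventually_zero (hab ▸ h0.symm)] with t h1 h2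
    rw [h1, h2]
    simp
  · obtain ⟨C, hC, hcmp⟩ := he.exists_le_mul
    refine ⟨C⁻¹, by positivity, Eventually.of_forall fun t => ⟨?_, ?_⟩⟩
    · rw [inv_mul_le_iff₀ (by linarith)]
      exact hcmp a b h0 hab t
    · rw [inv_inv]
      exact hcmp b a (hab ▸ h0) hab.symm t

lemma WeightProfile.tailPrec_of_lt (he : WeightProfile m μ e) {n : ℕ} {h : ℝ → ℝ}
    (hμ : RegularTail n (tail μ) h) {a b : ℝ} (hab : e a < e b) : TailPrec μ a b := by
  rcases (he.nonneg a).eq_or_lt with h0 | h0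
  · exact (he.eventually_zero h0.symm).trans_isLittleO (isLittleO_zero _ _)
  · obtain ⟨C, hC, hcmp⟩ := he.compare
    have hb := h0.trans hab
    have hl : 1 < e b / e a := by rwa [one_lt_div h0]
    have hbt : Tendsto (fun t => (e b)⁻¹ * t) atTop atTop :=
      tendsto_id.const_mul_atTop (inv_pos.2 hb)
    have h1 := (hμ.scale_isLittleO 0 hl).comp_tendsto hbt
    have h2 : tail (scale a μ) =O[atTop] ((fun t => tail μ (e b / e a * t)) ∘
        fun t => (e b)⁻¹ * t) := by
      refine IsBigO.of_bound C (Eventually.of_forall fun t => ?_)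
      have h3 := (hcmp a h0 ((e a)⁻¹ * t)).1
      rw [mul_inv_cancel_left₀ h0.ne'] at h3
      simp only [Function.comp_apply]
      rw [Real.norm_of_nonneg (he.pos h0 t).le, Real.norm_of_nonneg (hμ.pos _).le]
      refine h3.trans (le_of_eq ?_)
      congr 2
      field_simp
    have h4 : ((fun t => tail μ t / t ^ 0) ∘ fun t => (e b)⁻¹ * t) =O[atTop]
        tail (scale b μ) := by
      refine IsBigO.of_bound C (Eventually.of_forall fun t => ?_)
      have h3 := (hcmp b hb ((e b)⁻¹ * t)).2
      rw [mul_inv_cancel_left₀ hb.ne'] at h3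
      simp only [Function.comp_apply, pow_zero, div_one]
      rwa [Real.norm_of_nonneg (he.pos hb t).le, Real.norm_of_nonneg (hμ.pos _).le]
    exact (h2.trans_isLittleO h1).trans_isBigO h4

lemma not_isLittleO_self_of_pos {g : ℝ → ℝ} (hg : ∀ t, 0 < g t) : ¬ g =o[atTop] g :=
  isLittleO_irrefl' (Eventually.of_forall fun t => norm_ne_zero_iff.2 (hg t).ne').frequently

lemma TailEquiv.isBigO {a b : ℝ} (h : TailEquiv μ a b) :
    tail (scale a μ) =O[atTop] tail (scale b μ) ∧
      tail (scale b μ) =O[atTop] tail (scale a μ) := by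
  obtain ⟨ε, hε, h⟩ := h
  have hn : ∀ a t, ‖tail (scale a μ) t‖ = tail (scale a μ) t := fun a t =>
    Real.norm_of_nonneg measureReal_nonneg
  constructor
  · refine IsBigO.of_bound ε⁻¹ ?_
    filter_upwards [h] with t ht
    rw [hn, hn, ← div_eq_inv_mul, le_div_iff₀ hε]
    linarith [ht.1]
  · refine IsBigO.of_bound ε⁻¹ ?_
    filter_upwards [h] with t ht
    rw [hn, hn]
    exact ht.2

lemma WeightProfile.tailEquiv_iff (he : WeightProfile m μ e) {n : ℕ} {h : ℝ → ℝ}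
    (hμ : RegularTail n (tail μ) h) {a b : ℝ} : TailEquiv μ a b ↔ e a = e b := by
  refine ⟨fun hab => ?_, he.tailEquiv_of_eq⟩
  rcases lt_trichotomy (e a) (e b) with hlt | heq | hgt
  · have hb := (he.nonneg a).trans_lt hlt
    exact absurd (hab.isBigO.2.trans_isLittleO (he.tailPrec_of_lt hμ hlt))
      (not_isLittleO_self_of_pos (he.pos hb))
  · exact heq
  · have ha := (he.nonneg b).trans_lt hgt
    exact absurd (hab.isBigO.1.trans_isLittleO (he.tailPrec_of_lt hμ hgt))
      (not_isLittleO_self_of_pos (he.pos ha))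

lemma WeightProfile.isLargestWeight_iff (he : WeightProfile m μ e) {n : ℕ} {h : ℝ → ℝ}
    (hμ : RegularTail n (tail μ) h) {c : ℤ → ℝ} {i₁ : ℤ} :
    IsLargestWeight μ c i₁ ↔ ∀ i, e (c i) ≤ e (c i₁) := by
  refine ⟨fun hl i => ?_, fun hl i => ?_⟩
  · by_contra hcon
    push Not at hcon
    have hpos := he.pos ((he.nonneg _).trans_lt hcon)
    have h1 := he.tailPrec_of_lt hμ hcon
    rcases hl i with h2 | h2
    · exact not_isLittleO_self_of_pos hpos (IsLittleO.trans h2 h1)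
    · exact not_isLittleO_self_of_pos hpos (h2.isBigO.1.trans_isLittleO h1)
  · rcases (hl i).lt_or_eq with h1 | h1
    · exact Or.inl (he.tailPrec_of_lt hμ h1)
    · exact Or.inr (he.tailEquiv_of_eq h1)

lemma WeightProfile.finite_setOf_le (he : WeightProfile m μ e) {c : ℤ → ℝ}
    (hc : Summable fun i => |c i|) {w : ℝ} (hw : 0 < w) : {i | w ≤ e (c i)}.Finite := by
  have h1 := hc.tendsto_cofinite_zero.eventually (gt_mem_nhds hw)
  rw [Filter.eventually_cofinite] at h1
  refine h1.subset fun i hi => ?_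
  simp only [Set.mem_ofPred_eq, not_lt] at hi ⊢
  exact hi.trans (he.le_abs _)

lemma WeightProfile.exists_isLargest (he : WeightProfile m μ e) {c : ℤ → ℝ}
    (hc : Summable fun i => |c i|) : ∃ i₁, ∀ i, e (c i) ≤ e (c i₁) := by
  by_cases h0 : ∃ i₀, 0 < e (c i₀)
  · obtain ⟨i₀, hi₀⟩ := h0
    obtain ⟨i₁, hi₁, hmax⟩ := Set.exists_max_image _ (fun i => e (c i))
      (he.finite_setOf_le hc hi₀) ⟨i₀, Set.mem_ofPred_eq ▸ le_rfl⟩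
    refine ⟨i₁, fun i => ?_⟩
    rcases le_total (e (c i₀)) (e (c i)) with h | h
    · exact hmax i h
    · exact h.trans (hmax i₀ (Set.mem_ofPred_eq ▸ le_rfl))
  · push Not at h0
    exact ⟨0, fun i => (h0 i).trans (he.nonneg _)⟩

end

/-! ### Convergence and moments of the weighted sum -/

lemma summable_abs_of_summable_rpow {ι : Type*} {c : ι → ℝ} {δ : ℝ} (hδ0 : 0 < δ) (hδ1 : δ < 1)
    (h : Summable fun i => |c i| ^ δ) : Summable fun i => |c i| := by
  refine Summable.of_norm_bounded_eventually h ?_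
  filter_upwards [h.tendsto_cofinite_zero.eventually (gt_mem_nhds one_pos)] with i hi
  rw [Real.norm_of_nonneg (abs_nonneg _)]
  have h1 : |c i| ≤ 1 := by
    by_contra hcon
    exact absurd (Real.one_le_rpow (not_le.1 hcon).le hδ0.le) (not_le.2 hi)
  simpa using Real.rpow_le_rpow_of_exponent_ge' (abs_nonneg (c i)) h1 hδ0.le hδ1.le

section

variable {Ω : Type*} [MeasurableSpace Ω] {P : Measure Ω} {μ : Measure ℝ} {X : ℤ → Ω → ℝ}
  {c : ℤ → ℝ}

lemma ae_summable_weighted (hX : ∀ i, Measurable (X i)) (hlaw : ∀ i, P.map (X i) = μ)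
    (hint : Integrable (fun x => x) μ) (hc : Summable fun i => |c i|) :
    ∀ᵐ ω ∂P, Summable fun i => |c i * X i ω| := by
  have h1 : ∀ i, eLpNorm (fun ω => c i * X i ω) 1 P = ENNReal.ofReal |c i| *
      ∫⁻ x, ‖x‖ₑ ∂μ := by
    intro i
    rw [eLpNorm_one_eq_lintegral_enorm, ← hlaw i, lintegral_map (by fun_prop) (hX i),
      ← lintegral_const_mul _ (by fun_prop)]
    refine lintegral_congr fun ω => ?_
    rw [enorm_mul, Real.enorm_eq_ofReal_abs]
  have h2 : ∑' i, eLpNorm (fun ω => c i * X i ω) 1 P ≠ ⊤ := by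
    simp_rw [h1]
    rw [ENNReal.tsum_mul_right]
    exact ENNReal.mul_ne_top hc.tsum_ofReal_ne_top hint.2.ne
  have h3 := summable_norm_of_tsum_eLpNorm_ne_top (f := fun i ω => c i * X i ω) le_rfl
    (fun i => ((hX i).const_mul (c i)).aestronglyMeasurable) h2
  simpa only [Real.norm_eq_abs] using h3

lemma measureReal_lt_mul (hX : ∀ i, Measurable (X i)) (hlaw : ∀ i, P.map (X i) = μ) (a : ℝ) (i : ℤ)
    (t : ℝ) : P.real {ω | t < a * X i ω} = tail (scale a μ) t := by
  rw [tail_scale_eq, ← hlaw i, map_measureReal_apply (hX i)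
    (measurableSet_lt measurable_const (by fun_prop))]
  rfl

lemma map_const_mul_eq_scale (hX : ∀ i, Measurable (X i)) (hlaw : ∀ i, P.map (X i) = μ) (a : ℝ)
    (i : ℤ) : P.map (fun ω => a * X i ω) = scale a μ := by
  rw [scale, ← hlaw i, Measure.map_map (by fun_prop) (hX i)]
  rfl

end

section

variable {Ω : Type*} [MeasurableSpace Ω] {P : Measure Ω} {μ : Measure ℝ}
  {m : ℕ} {e : ℝ → ℝ} {X : ℤ → Ω → ℝ} {c : ℤ → ℝ}

lemma WeightProfile.integrable_id [IsProbabilityMeasure μ] (he : WeightProfile m μ e)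
    {n : ℕ} {h : ℝ → ℝ} (hμ : RegularTail n (tail μ) h) : Integrable (fun x => x) μ := by
  obtain ⟨Q, hQ, ⟨C', hC', hfQ⟩, -⟩ := hμ.exists_gauge
  obtain ⟨C, hC, hcmp⟩ := he.abs_tail
  obtain ⟨M, hM, hpow⟩ := hQ.exists_pow_le (η := 1 / 2) (by norm_num) 1
  obtain ⟨K, hK, hexp⟩ := hQ.exists_lintegral_exp_le (P := μ) (γ := 1 / 2) (by norm_num)
    (by norm_num) (C * C')
  have h1 := hexp (fun x => |x|) (by fun_prop) (fun x => abs_nonneg x) fun z hz => by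
    refine (hcmp z hz).trans ?_
    rw [mul_assoc]
    exact mul_le_mul_of_nonneg_left (hfQ z) hC.le
  have h2 : Integrable (fun x => Real.exp (1 / 2 * Q |x|)) μ := by
    refine ⟨(Real.measurable_exp.comp ((hQ.measurable.comp (by fun_prop)).const_mul
      _)).aestronglyMeasurable, ?_⟩
    rw [hasFiniteIntegral_iff_ofReal (Eventually.of_forall fun x => (Real.exp_pos _).le)]
    exact h1.trans_lt ENNReal.ofReal_lt_top
  refine (h2.const_mul M).mono' (by fun_prop) (Eventually.of_forall fun x => ?_)
  simpa using hpow |x| (abs_nonneg x)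

lemma WeightProfile.jumpFamily_abs [IsProbabilityMeasure μ] (he : WeightProfile m μ e)
    {n : ℕ} {h : ℝ → ℝ} (hμ : RegularTail n (tail μ) h) (hX : ∀ i, Measurable (X i))
    (hind : iIndepFun X P) (hlaw : ∀ i, P.map (X i) = μ) (hc : Summable fun i => |c i|)
    (hc1 : ∀ i, |c i| ≤ 1) :
    ∃ C, JumpFamily P (tail μ) (fun i ω => |c i * X i ω|) (fun i => |c i|) C := by
  obtain ⟨C, hC, hcmp⟩ := he.abs_tail
  refine ⟨C, fun i => ((hX i).const_mul (c i)).norm,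
    hind.comp (fun i x => |c i * x|) fun i => (measurable_const_mul (c i)).norm,
    ae_summable_weighted hX hlaw (he.integrable_id hμ) hc, fun i => abs_nonneg _, hc1, hc, hC,
    fun i z hz => ?_⟩
  rcases eq_or_ne (c i) 0 with h0 | h0
  · simp only [h0, abs_zero, zero_mul, lt_irrefl, Set.ofPred_false, measureReal_empty]
    exact mul_nonneg hC.le (hμ.pos z).le
  · refine le_trans (le_of_eq ?_) (hcmp z hz)
    rw [← hlaw i, map_measureReal_apply (hX i) (measurableSet_lt measurable_const (by fun_prop))]
    congr 1
    ext ω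
    simp [abs_mul, abs_pos.2 h0]

lemma WeightProfile.integrable_restSum_pow [IsProbabilityMeasure P] [IsProbabilityMeasure μ]
    (he : WeightProfile m μ e) {n : ℕ} {h : ℝ → ℝ}
    (hμ : RegularTail n (tail μ) h) (hX : ∀ i, Measurable (X i))
    (hind : iIndepFun X P) (hlaw : ∀ i, P.map (X i) = μ)
    (hc : Summable fun i => |c i|) (i : ℤ) (k : ℕ) :
    Integrable (fun ω => |restSum (fun j ω => c j * X j ω) i ω| ^ k) P := by
  set A := 1 + ∑' j, |c j| with hA
  have hle : ∀ j, |c j| ≤ A := fun j => by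
    linarith [hc.le_tsum j fun j _ => abs_nonneg (c j)]
  have hA0 : 0 < A := by 
    have : 0 ≤ ∑' j, |c j| := tsum_nonneg fun j => abs_nonneg (c j)
    linarith
  have hcA : ∀ j, |A⁻¹ * c j| = A⁻¹ * |c j| := fun j => by rw [abs_mul, abs_of_pos (inv_pos.2 hA0)]
  obtain ⟨C, hJ⟩ := he.jumpFamily_abs hμ hX hind hlaw (c := fun j => A⁻¹ * c j)
    (by simpa only [hcA] using hc.mul_left A⁻¹) fun j => by
      rw [hcA, inv_mul_le_iff₀ hA0, mul_one]; exact hle j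
  obtain ⟨Q, hQ, ⟨C', hC', hfQ⟩, -⟩ := hμ.exists_gauge
  obtain ⟨M, hM, hpow⟩ := hQ.exists_pow_le (η := 1 / 2) (by norm_num) k
  have hint := hJ.integrable_exp hQ hfQ (γ := 1 / 2) (by norm_num) (by norm_num)
  have hmeas := measurable_restSum (U := fun j ω => c j * X j ω) (i := i)
    fun j _ => (hX j).const_mul (c j)
  refine (hint.const_mul (A ^ k * M)).mono' (hmeas.norm.pow_const k).aestronglyMeasurable ?_
  filter_upwards [hJ.ae_summable] with ω hω
  set S := ∑' j, |A⁻¹ * c j * X j ω| with hS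
  have hS0 : 0 ≤ S := tsum_nonneg fun j => abs_nonneg _
  have h1 : |restSum (fun j ω => c j * X j ω) i ω| ≤ A * S := by
    rw [hS, ← tsum_mul_left]
    refine tsum_of_norm_bounded (f := fun j => if j = i then 0 else c j * X j ω)
      (hω.mul_left A).hasSum fun j => ?_
    split_ifs
    · rw [norm_zero]
      positivity
    · rw [mul_assoc, abs_mul, abs_of_pos (inv_pos.2 hA0), mul_inv_cancel_left₀ hA0.ne']
      exact le_rfl
  have h2 : Q S ≤ ∑' j, Q (max |A⁻¹ * c j * X j ω| 0) := by
    have h3 : ∀ x : ℝ, max |x| 0 = |x| := fun x => max_eq_left (abs_nonneg x)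
    simp_rw [h3]
    exact hQ.map_tsum_le (fun j => abs_nonneg _) hω
  rw [Real.norm_of_nonneg (by positivity)]
  calc |restSum (fun j ω => c j * X j ω) i ω| ^ k ≤ (A * S) ^ k := by gcongr
    _ = A ^ k * S ^ k := mul_pow _ _ _
    _ ≤ A ^ k * (M * Real.exp (1 / 2 * Q S)) := by gcongr; exact hpow S hS0
    _ ≤ A ^ k * M * Real.exp (1 / 2 * ∑' j, Q (max |A⁻¹ * c j * X j ω| 0)) := by
        rw [mul_assoc]; gcongr

/-- Conditioning on the second of two independent variables. -/
lemma measureReal_add_inter_eq_integral [IsProbabilityMeasure P] {U R : Ω → ℝ}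
    (hU : Measurable U) (hR : Measurable R) (hUR : IndepFun U R P) (s t : ℝ) :
    P.real {ω | t < U ω + R ω ∧ R ω ≤ s} =
      ∫ x, (Set.Iic s).indicator (fun y => tail (P.map U) (t - y)) x ∂(P.map R) := by
  have : IsProbabilityMeasure (P.map U) := Measure.isProbabilityMeasure_map hU.aemeasurable
  have : IsProbabilityMeasure (P.map R) := Measure.isProbabilityMeasure_map hR.aemeasurable
  have hS : MeasurableSet {p : ℝ × ℝ | t < p.1 + p.2 ∧ p.2 ≤ s} :=
    (measurableSet_lt measurable_const (measurable_fst.add measurable_snd)).inter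
      (measurableSet_le measurable_snd measurable_const)
  have h1 : P.real {ω | t < U ω + R ω ∧ R ω ≤ s} =
      ((P.map U).prod (P.map R)).real {p | t < p.1 + p.2 ∧ p.2 ≤ s} := by
    rw [← (indepFun_iff_map_prod_eq_prod_map_map hU.aemeasurable hR.aemeasurable).1 hUR,
      map_measureReal_apply (hU.prodMk hR) hS]
    rfl
  rw [h1, measureReal_def, Measure.prod_apply_symm hS,
    ← integral_toReal (measurable_measure_prodMk_right hS).aemeasurable
      (Eventually.of_forall fun x => measure_lt_top _ _)]
  refine integral_congr_ae (Eventually.of_forall fun x => ?_)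
  by_cases hx : x ≤ s
  · simp only [Set.indicator, Set.mem_Iic, hx, if_true]
    rw [tail, measureReal_def]
    congr 2
    ext y
    simp [hx, sub_lt_iff_lt_add]
  · simp [Set.indicator, hx]

end

/-! ### The tail expansion -/

section

variable {Ω : Type*} [MeasurableSpace Ω] {P : Measure Ω} {μ : Measure ℝ}
  {m : ℕ} {e : ℝ → ℝ} {X : ℤ → Ω → ℝ} {c : ℤ → ℝ}

/-- When `c i₁` has the largest effective weight `w`, the variables `c i * X i` form a jump family
for the tail of `c i₁ * X i₁`, and the scales of those of smaller effective weight stay away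
from `1`. -/
lemma WeightProfile.exists_jumpFamily [IsProbabilityMeasure μ] (he : WeightProfile m μ e)
    {n : ℕ} {h : ℝ → ℝ} (hμ : RegularTail n (tail μ) h) (hX : ∀ i, Measurable (X i))
    (hind : iIndepFun X P) (hlaw : ∀ i, P.map (X i) = μ) (hc : Summable fun i => |c i|) {i₁ : ℤ}
    (hw : 0 < e (c i₁))
    (hmax : ∀ i, e (c i) ≤ e (c i₁)) :
    ∃ C b, JumpFamily P (tail (scale (c i₁) μ)) (fun i ω => c i * X i ω) b C ∧
      ∃ β, 0 < β ∧ β < 1 ∧ ∀ i, e (c i) ≠ e (c i₁) → b i ≤ β := by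
  set w := e (c i₁) with hwdef
  obtain ⟨C, hC, hcmp⟩ := he.compare
  obtain ⟨B, hB, hzero⟩ := he.zero
  set M := ∑' j, |c j| with hM
  have hM0 : 0 ≤ M := tsum_nonneg fun j => abs_nonneg (c j)
  have hle : ∀ j, |c j| ≤ M := fun j => hc.le_tsum j fun j _ => abs_nonneg (c j)
  set g := tail (scale (c i₁) μ) with hg
  have hgpos : ∀ t, 0 < g t := he.pos hw
  set z₁ := B * (1 + 2 * M) with hz₁
  -- A vanishing effective weight means a bounded upper tail, so that any scale will do; the
  -- minimum keeps the scales summable and below `1 / 2`.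
  let b : ℤ → ℝ := fun i => if 0 < e (c i) then e (c i) / w else min |c i| (1 / 2)
  have hfar : ∃ β, (1 / 2 : ℝ) ≤ β ∧ β < 1 ∧
      ∀ i ∈ {i | w / 2 ≤ e (c i)}, e (c i) ≠ w → e (c i) / w ≤ β := by
    have h1 : ∀ᶠ β in 𝓝[<] (1 : ℝ), ∀ i ∈ {i | w / 2 ≤ e (c i)}, e (c i) ≠ w → e (c i) / w ≤ β := by
      rw [(he.finite_setOf_le hc (half_pos hw)).eventually_all]
      intro i _
      rcases (hmax i).eq_or_lt with heq | hlt
      · exact Eventually.of_forall fun β hne => absurd heq hne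
      · filter_upwards [Ioo_mem_nhdsLT ((div_lt_one hw).2 hlt)] with β hβ _ using hβ.1.le
    obtain ⟨β, h2, h3⟩ := (h1.and (Ioo_mem_nhdsLT (a := (1 / 2 : ℝ)) (by norm_num))).exists
    exact ⟨β, h3.1.le, h3.2, h2⟩
  obtain ⟨β, hβ, hβ1, hβb⟩ := hfar
  refine ⟨C * C + (g z₁)⁻¹, b, ⟨fun i => (hX i).const_mul (c i),
    hind.comp (fun i x => c i * x) fun i => measurable_const_mul (c i), ?_, fun i => ?_,
    fun i => ?_, ?_, ?_, fun i z hz => ?_⟩, β, by linarith, hβ1, fun i hi => ?_⟩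
  · filter_upwards [ae_summable_weighted hX hlaw (he.integrable_id hμ) hc] with ω hω using hω.of_abs
  · simp only [b]
    split_ifs
    · exact div_nonneg (he.nonneg _) hw.le
    · positivity
  · simp only [b]
    split_ifs
    · exact (div_le_one hw).2 (hmax i)
    · exact (min_le_right _ _).trans (by norm_num)
  · refine Summable.of_norm_bounded (hc.mul_left (w⁻¹ + 1)) fun i => ?_
    simp only [b]
    have h1 := abs_nonneg (c i)
    split_ifs with h0
    · rw [Real.norm_of_nonneg (div_nonneg h0.le hw.le), div_eq_inv_mul]
      nlinarith [mul_le_mul_of_nonneg_left (he.le_abs (c i)) (inv_pos.2 hw).le]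
    · rw [Real.norm_of_nonneg (by positivity)]
      have := min_le_left |c i| (1 / 2)
      have := mul_nonneg (inv_pos.2 hw).le h1
      linarith
  · have := inv_pos.2 (hgpos z₁)
    positivity
  · rw [measureReal_lt_mul hX hlaw]
    have hinv := inv_pos.2 (hgpos z₁)
    by_cases h0 : 0 < e (c i)
    · have h1 := (hcmp _ h0 (w⁻¹ * z)).1
      have h2 := (hcmp _ hw (w⁻¹ * z)).2
      rw [← hwdef, mul_inv_cancel_left₀ hw.ne'] at h2
      have h3 : b i * z = e (c i) * (w⁻¹ * z) := by
        simp only [b, if_pos h0]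
        ring
      rw [h3]
      have := hgpos z
      nlinarith
    · have h0' : e (c i) = 0 := le_antisymm (not_lt.1 h0) (he.nonneg _)
      rcases le_total z₁ z with h1 | h1
      · have h2 : tail (scale (c i) μ) (b i * z) = 0 := by
          refine hzero _ h0' _ ?_
          simp only [b, if_neg h0]
          have h3 : |c i| ≤ min |c i| (1 / 2) * (1 + 2 * M) := by
            rcases le_total |c i| (1 / 2) with h4 | h4
            · rw [min_eq_left h4]
              nlinarith [abs_nonneg (c i)]
            · rw [min_eq_right h4]
              linarith [hle i]
          calc |c i| * B ≤ min |c i| (1 / 2) * (1 + 2 * M) * B := by gcongr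
            _ = min |c i| (1 / 2) * z₁ := by rw [hz₁]; ring
            _ ≤ _ := by gcongr
        rw [h2]
        have := hgpos z
        positivity
      · have h2 : tail (scale (c i) μ) (b i * z) ≤ 1 := measureReal_le_one
        have h3 : g z₁ ≤ g z := tail_antitone _ h1
        have h4 : 1 ≤ (g z₁)⁻¹ * g z := by
          rw [← div_eq_inv_mul]
          exact (one_le_div (hgpos z₁)).2 h3
        nlinarith [hgpos z]
  · simp only [b]
    split_ifs
    · by_cases h1 : w / 2 ≤ e (c i)
      · exact hβb i h1 hi
      · refine le_trans ?_ hβ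
        rw [div_le_iff₀ hw]
        linarith
    · exact (min_le_right _ _).trans hβ

lemma WeightProfile.tail_expansion [IsProbabilityMeasure P] [IsProbabilityMeasure μ]
    (he : WeightProfile m μ e) {n : ℕ} (hμ : RegularTail n (tail μ) (hazardRate μ))
    (hX : ∀ i, Measurable (X i)) (hind : iIndepFun X P) (hlaw : ∀ i, P.map (X i) = μ)
    (hc : Summable fun i => |c i|) {i₁ : ℤ}
    (hw : 0 < e (c i₁)) (hmax : ∀ i, e (c i) ≤ e (c i₁)) {I : Finset ℤ}
    (hI : ∀ i, i ∈ I ↔ e (c i) = e (c i₁)) :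
    (fun t => P.real {ω | t < ∑' i, c i * X i ω} - ∑ i ∈ I,
      laplaceCharacter (P.map (restSum (fun j ω => c j * X j ω) i)) m (tail (scale (c i) μ)) t)
      =o[atTop] fun t => hazardRate μ t ^ m * tail (scale (c i₁) μ) t := by
  set U : ℤ → Ω → ℝ := fun j ω => c j * X j ω with hU
  have hUm : ∀ j, Measurable (U j) := fun j => (hX j).const_mul (c j)
  have hRm : ∀ i, Measurable (restSum U i) := fun i => measurable_restSum fun j _ => hUm j
  have hUind : iIndepFun U P := hind.comp (fun i x => c i * x) fun i => measurable_const_mul (c i)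
  -- the contribution of each of the largest weights
  have hterm : ∀ i ∈ I, ∃ ε₀ > 0, ∀ ε, 0 < ε → ε ≤ ε₀ →
      (fun t => P.real {ω | t < U i ω + restSum U i ω ∧ restSum U i ω ≤ ε * t} -
        laplaceCharacter (P.map (restSum U i)) m (tail (scale (c i) μ)) t)
      =o[atTop] fun t => hazardRate μ t ^ m * tail (scale (c i₁) μ) t := by
    intro i hi
    have hei := (hI i).1 hi
    have hwi : 0 < e (c i) := hei ▸ hw
    obtain ⟨h, hreg, hO⟩ := he.regular _ hwi
    obtain ⟨Q, hQ, ⟨C', hC', hfQ⟩, hQf⟩ := hreg.exists_gauge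
    obtain ⟨C, b, hJ, -⟩ := he.exists_jumpFamily hμ hX hind hlaw hc hwi fun j => hei ▸ hmax j
    obtain ⟨ε₀, hε₀, hexp⟩ := hreg.exists_laplace_expansion hQ hQf
    refine ⟨ε₀, hε₀, fun ε hε hεle => ?_⟩
    have : IsProbabilityMeasure (P.map (restSum U i)) :=
      Measure.isProbabilityMeasure_map (hRm i).aemeasurable
    have h1 : Integrable (fun x => |x| ^ m) (P.map (restSum U i)) := by
      rw [integrable_map_measure (by fun_prop) (hRm i).aemeasurable]
      exact he.integrable_restSum_pow hμ hX hind hlaw hc i m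
    have h2 : Integrable (fun x => Real.exp (1 / 2 * Q (max x 0))) (P.map (restSum U i)) := by
      have h5 : Measurable fun x => Real.exp (1 / 2 * Q (max x 0)) := Real.measurable_exp.comp
        ((hQ.measurable.comp (measurable_id.max measurable_const)).const_mul _)
      rw [integrable_map_measure h5.aestronglyMeasurable (hRm i).aemeasurable]
      exact hJ.integrable_exp_restSum hQ hfQ (by norm_num) (by norm_num) i
    have h3 := hexp ε hε hεle _ h1 h2
    obtain ⟨K, -, hK⟩ := he.exists_le_mul
    have h4 : tail (scale (c i) μ) =O[atTop] tail (scale (c i₁) μ) :=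
      IsBigO.of_bound K (Eventually.of_forall fun t => by
        rw [Real.norm_of_nonneg (he.pos hwi t).le, Real.norm_of_nonneg (he.pos hw t).le]
        exact hK _ _ hwi hei t)
    refine IsLittleO.trans_isBigO ?_ ((hO.pow m).mul h4)
    refine h3.congr_left fun t => ?_
    rw [measureReal_add_inter_eq_integral (hUm i) (hRm i) (indepFun_restSum hUm hUind i),
      map_const_mul_eq_scale hX hlaw]
  obtain ⟨ε, hε, hε4, hεI⟩ : ∃ ε : ℝ, 0 < ε ∧ ε ≤ 1 / 4 ∧ ∀ i ∈ I,
      (fun t => P.real {ω | t < U i ω + restSum U i ω ∧ restSum U i ω ≤ ε * t} -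
        laplaceCharacter (P.map (restSum U i)) m (tail (scale (c i) μ)) t)
      =o[atTop] fun t => hazardRate μ t ^ m * tail (scale (c i₁) μ) t := by
    have h1 : ∀ᶠ ε in 𝓝[>] (0 : ℝ), ∀ i ∈ I,
        (fun t => P.real {ω | t < U i ω + restSum U i ω ∧ restSum U i ω ≤ ε * t} -
          laplaceCharacter (P.map (restSum U i)) m (tail (scale (c i) μ)) t)
        =o[atTop] fun t => hazardRate μ t ^ m * tail (scale (c i₁) μ) t := by
      rw [Finset.eventually_all]
      intro i hi
      obtain ⟨ε₀, hε₀, h⟩ := hterm i hi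
      filter_upwards [Ioc_mem_nhdsGT hε₀] with ε hε using h ε hε.1 hε.2
    obtain ⟨ε, h2, h3⟩ := (h1.and (Ioc_mem_nhdsGT (show (0 : ℝ) < 1 / 4 by norm_num))).exists
    exact ⟨ε, h3.1, h3.2, h2⟩
  obtain ⟨h, hreg, -⟩ := he.regular _ hw
  obtain ⟨C, b, hJ, β, hβ0, hβ1, hβ⟩ := he.exists_jumpFamily hμ hX hind hlaw hc hw hmax
  have hjump := hJ.one_big_jump hreg I hβ0 hβ1 (fun i hi => hβ i fun h => hi ((hI i).2 h)) hε hε4 m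
  have hO : (fun t => tail (scale (c i₁) μ) t / t ^ m) =O[atTop]
      fun t => hazardRate μ t ^ m * tail (scale (c i₁) μ) t := by
    refine IsBigO.of_bound 1 ?_
    filter_upwards [hμ.eventually_one_le_mul 1, eventually_gt_atTop 0] with t ht ht0
    have hf := he.pos hw t
    have hh : 0 < hazardRate μ t := by
      by_contra hcon
      nlinarith [mul_nonneg ht0.le (neg_nonneg.2 (not_lt.1 hcon))]
    rw [Real.norm_of_nonneg (by positivity), Real.norm_of_nonneg (by positivity), one_mul,
      div_le_iff₀ (by positivity)]
    have h1 : 1 ≤ (t * hazardRate μ t) ^ m := one_le_pow₀ ht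
    calc tail (scale (c i₁) μ) t ≤ (t * hazardRate μ t) ^ m * tail (scale (c i₁) μ) t :=
          le_mul_of_one_le_left hf.le h1
      _ = _ := by rw [mul_pow]; ring
  refine ((hjump.trans_isBigO hO).add (IsLittleO.sum hεI)).congr_left fun t => ?_
  rw [Finset.sum_apply, Finset.sum_sub_distrib]
  ring

/-- If all effective weights vanish, the variables `c i * X i`, hence their sum, are bounded
above. -/
lemma WeightProfile.eventually_tail_eq_zero [IsProbabilityMeasure P]
    (he : WeightProfile m μ e) (hX : ∀ i, Measurable (X i)) (hlaw : ∀ i, P.map (X i) = μ)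
    (hc : Summable fun i => |c i|) (hs : ∀ᵐ ω ∂P, Summable fun i => c i * X i ω)
    (h0 : ∀ i, e (c i) = 0) :
    ∀ᶠ t in atTop, P.real {ω | t < ∑' i, c i * X i ω} = 0 := by
  obtain ⟨B, -, hzero⟩ := he.zero
  have h1 : ∀ᵐ ω ∂P, ∀ i, c i * X i ω ≤ |c i| * B := by
    refine ae_all_iff.2 fun i => ?_
    have h2 := hzero _ (h0 i) _ le_rfl
    rw [← measureReal_lt_mul hX hlaw _ i, measureReal_eq_zero_iff] at h2
    rw [ae_iff]
    simpa only [not_le] using h2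
  filter_upwards [eventually_ge_atTop (∑' i, |c i| * B)] with t ht
  rw [measureReal_eq_zero_iff]
  have h3 : ∀ᵐ ω ∂P, ¬ t < ∑' i, c i * X i ω := by
    filter_upwards [h1, hs] with ω hω hsω
    exact not_lt.2 ((hsω.tsum_le_tsum hω (hc.mul_right B)).trans ht)
  simpa only [ae_iff, not_not] using h3

/-- The Laplace characters of the vanishing tails vanish on a common neighborhood of infinity. -/
lemma WeightProfile.eventually_laplaceCharacter_eq_zero (he : WeightProfile m μ e)
    (hc : Summable fun i => |c i|) (h0 : ∀ i, e (c i) = 0) (K : ℤ → Measure ℝ) :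
    ∀ᶠ t in atTop, ∀ i, laplaceCharacter (K i) m (tail (scale (c i) μ)) t = 0 := by
  obtain ⟨B, hB, hzero⟩ := he.zero
  filter_upwards [eventually_gt_atTop (∑' i, |c i| * B)] with t ht i
  have h1 : |c i| * B < t := lt_of_le_of_lt
    ((hc.mul_right B).le_tsum i fun j _ => mul_nonneg (abs_nonneg _) hB) ht
  have h2 : tail (scale (c i) μ) =ᶠ[𝓝 t] fun _ => 0 := by
    filter_upwards [lt_mem_nhds h1] with s hs using hzero _ (h0 i) s hs.le
  refine Finset.sum_eq_zero fun k _ => ?_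
  rw [h2.iteratedDeriv_eq k]
  simp

end

section

variable {Ω : Type*} [MeasurableSpace Ω] {P : Measure Ω} {X Y : ℤ → Ω → ℝ}

lemma weightedLaw_congr (h : ∀ᵐ ω ∂P, ∀ i, X i ω = Y i ω) (c : ℤ → ℝ) :
    weightedLaw P X c = weightedLaw P Y c := by
  refine Measure.map_congr ?_
  filter_upwards [h] with ω hω
  simp_rw [hω]

lemma deletedLaw_eq_map_restSum (P : Measure Ω) (X : ℤ → Ω → ℝ) (c : ℤ → ℝ) (i : ℤ) :
    deletedLaw P X c i = P.map (restSum (fun j ω => c j * X j ω) i) := by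
  rw [deletedLaw, weightedLaw]
  congr 1
  funext ω
  refine tsum_congr fun j => ?_
  by_cases hj : j = i
  · simp [hj]
  · simp [hj]

lemma tail_weightedLaw (hX : ∀ i, Measurable (X i)) (c : ℤ → ℝ) (t : ℝ) :
    tail (weightedLaw P X c) t = P.real {ω | t < ∑' i, c i * X i ω} := by
  rw [tail, weightedLaw, map_measureReal_apply
    (Measurable.tsum fun i => (hX i).const_mul (c i)) measurableSet_Ioi]
  rfl

end

lemma StandardConditions.exists_weightProfile {m : ℕ} {μ : Measure ℝ} [IsProbabilityMeasure μ]
    {c : ℤ → ℝ} (hstd : StandardConditions (WeibullLike m) μ c)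
    (hμ : RegularTail (m + 1) (tail μ) (hazardRate μ)) : ∃ e, WeightProfile m μ e := by
  rcases hstd.2 with h | h
  · exact ⟨_, weightProfile_of_vanishesNearBot hμ h⟩
  · exact ⟨_, weightProfile_of_tailBalanced hμ h⟩

lemma WeightProfile.exists_contDiffOn {m : ℕ} {μ : Measure ℝ} {e : ℝ → ℝ}
    (he : WeightProfile m μ e) (a : ℝ) :
    ∃ T : ℝ, ContDiffOn ℝ m (tail (scale a μ)) (Set.Ioi T) := by
  rcases (he.nonneg a).eq_or_lt with h0 | h0
  · obtain ⟨T, hT⟩ := eventually_atTop.1 (he.eventually_zero h0.symm)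
    exact ⟨T, contDiffOn_const.congr fun t ht => hT t (Set.mem_Ioi.1 ht).le⟩
  · obtain ⟨h, hreg, -⟩ := he.regular a h0
    obtain ⟨T, hT⟩ := hreg.smooth
    exact ⟨T, hT.of_le (by exact_mod_cast Nat.le_succ m)⟩

end WeightedConvolution

end

open WeightedConvolution

theorem theorem2p3p1
    {Ω : Type*} [MeasurableSpace Ω] (P : Measure Ω) [IsProbabilityMeasure P]
    (μ : Measure ℝ) [IsProbabilityMeasure μ]
    (X : ℤ → Ω → ℝ) (hindep : iIndepFun X P) (hlaw : ∀ i, HasLaw (X i) μ P)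
    (c : ℤ → ℝ) (m : ℕ)
    (hstd : WeightedConvolution.StandardConditions (WeightedConvolution.WeibullLike m) μ c)
    (hhaz : WeightedConvolution.HasHazardRate μ)
    (hh : WeightedConvolution.WeibullLike m (WeightedConvolution.hazardRate μ)) :
    -- the weighted sum converges almost surely
    (∀ᵐ ω ∂P, Summable fun i => c i * X i ω) ∧
    -- a largest weight exists
    (∃ i₁, WeightedConvolution.IsLargestWeight μ c i₁) ∧
    ∀ i₁, WeightedConvolution.IsLargestWeight μ c i₁ →
      -- the terms of the sum below are well defined, and finitely many unless they all vanish
      (¬ WeightedConvolution.TailEquiv μ (c i₁) 0 →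
        {i | WeightedConvolution.TailEquiv μ (c i) (c i₁)}.Finite) ∧
      (∀ i, WeightedConvolution.TailEquiv μ (c i) (c i₁) →
        (∀ k ≤ m, Integrable (fun x : ℝ => x ^ k) (WeightedConvolution.deletedLaw P X c i)) ∧
        ∃ T : ℝ, ContDiffOn ℝ m
          (WeightedConvolution.tail (WeightedConvolution.scale (c i) μ)) (Set.Ioi T)) ∧
      -- the expansion
      (fun t => WeightedConvolution.tail (WeightedConvolution.weightedLaw P X c) t -
          ∑ᶠ (i : ℤ) (_ : WeightedConvolution.TailEquiv μ (c i) (c i₁)),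
            WeightedConvolution.laplaceCharacter (WeightedConvolution.deletedLaw P X c i) m
              (WeightedConvolution.tail (WeightedConvolution.scale (c i) μ)) t)
        =o[atTop] (fun t => WeightedConvolution.hazardRate μ t ^ m *
            WeightedConvolution.tail (WeightedConvolution.scale (c i₁) μ) t) := by
  have hμ := regularTail_of_weibullLike hhaz hh
  obtain ⟨e, he⟩ := hstd.exists_weightProfile hμ
  obtain ⟨δ, hδ0, hδ1, hδ⟩ := hstd.1
  have hc := summable_abs_of_summable_rpow hδ0 hδ1 hδ
  -- measurable versions of the variables
  let Y : ℤ → Ω → ℝ := fun i => (hlaw i).aemeasurable.mk (X i)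
  have hY : ∀ i, Measurable (Y i) := fun i => (hlaw i).aemeasurable.measurable_mk
  have hXY : ∀ i, X i =ᵐ[P] Y i := fun i => (hlaw i).aemeasurable.ae_eq_mk
  have hXY' : ∀ᵐ ω ∂P, ∀ i, X i ω = Y i ω := ae_all_iff.2 hXY
  have hind : iIndepFun Y P := hindep.congr hXY
  have hlawY : ∀ i, P.map (Y i) = μ := fun i => by
    rw [← (hlaw i).map_eq]
    exact Measure.map_congr (hXY i).symm
  have hdel : ∀ i, deletedLaw P X c i = P.map (restSum (fun j ω => c j * Y j ω) i) := fun i => by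
    rw [← deletedLaw_eq_map_restSum]
    exact weightedLaw_congr hXY' _
  have hsumY : ∀ᵐ ω ∂P, Summable fun i => c i * Y i ω := by
    filter_upwards [ae_summable_weighted hY hlawY (he.integrable_id hμ) hc] with ω hω
      using hω.of_abs
  simp only [hdel, weightedLaw_congr hXY', tail_weightedLaw hY, he.tailEquiv_iff hμ,
    he.isLargestWeight_iff hμ]
  refine ⟨?_, he.exists_isLargest hc, fun i₁ hmax => ⟨fun hne => ?_, fun i _ => ⟨?_, ?_⟩, ?_⟩⟩
  · filter_upwards [hsumY, hXY'] with ω h1 h2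
    simpa only [h2] using h1
  · have h0 : e 0 = 0 := le_antisymm (by simpa using he.le_abs 0) (he.nonneg 0)
    have hw : 0 < e (c i₁) := (he.nonneg _).lt_of_ne' (h0 ▸ hne)
    exact (he.finite_setOf_le hc hw).subset fun i hi => (Set.mem_ofPred_eq ▸ hi : _ = _).ge
  · have hR := measurable_restSum (U := fun j ω => c j * Y j ω) (i := i)
      fun j _ => (hY j).const_mul (c j)
    have := Measure.isProbabilityMeasure_map (μ := P) hR.aemeasurable
    have h1 : Integrable (fun x => |x| ^ m) (P.map (restSum (fun j ω => c j * Y j ω) i)) := by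
      rw [integrable_map_measure (by fun_prop) hR.aemeasurable]
      exact he.integrable_restSum_pow hμ hY hind hlawY hc i m
    exact fun k hk => integrable_pow_of_le h1 hk
  · exact he.exists_contDiffOn _
  · rcases (he.nonneg (c i₁)).eq_or_lt with h0 | hw
    · have h0' : ∀ i, e (c i) = 0 := fun i => le_antisymm (h0 ▸ hmax i) (he.nonneg _)
      refine EventuallyEq.trans_isLittleO ?_ (isLittleO_zero _ _)
      filter_upwards [he.eventually_tail_eq_zero hY hlawY hc hsumY h0',
        he.eventually_laplaceCharacter_eq_zero hc h0'
          fun i => P.map (restSum (fun j ω => c j * Y j ω) i)] with t h1 h2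
      simp [h1, h2]
    · have hfin : {i | e (c i) = e (c i₁)}.Finite :=
        (he.finite_setOf_le hc hw).subset fun i hi => (Set.mem_ofPred_eq ▸ hi : _ = _).ge
      have hI : ∀ i, i ∈ hfin.toFinset ↔ e (c i) = e (c i₁) := fun i => by simp
      refine (he.tail_expansion hμ hY hind hlawY hc hw hmax hI).congr_left fun t => ?_
      rw [← finsum_mem_coe_finset]
      simp only [SetLike.mem_coe, hI]
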